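/- A glue is a label (coded as a natural number) with a nonnegative integer strength, and a tile type is a unit square with a glue on each of its four sides. For a finite set $T$ of tile types, an assembly over $T$ is a partial function $\alpha:\mathbb{Z}^2\dashrightarrow T$ whose domain is nonempty and connected in the grid graph; only finite assemblies are considered, and $|\alpha|=|\operatorname{dom}\alpha|$. Two tiles at adjacent positions interact if the glues on their abutting sides are equal and have positive strength; the binding graph of $\alpha$ has vertex set $\operatorname{dom}\alpha$ and an edge, weighted by the strength of the glue, between any two interacting tiles. $\alpha$ is $\tau$-stable if every cut of its binding graph has weight at least $\tau$. Let $\mathcal{T}=(T,s,\tau)$ be a seeded tile assembly system with seed tile $s\in T$ placed at the origin and temperature $\tau\ge 1$. Write $\alpha\to_1\beta$ if $\alpha,\beta$ are $\tau$-stable assemblies over $T$ such that $\beta$ extends $\alpha$ by exactly one tile, and let $\to$ be the reflexive transitive closure of $\to_1$. An assembly is producible if the seed produces it by $\to$; it is terminal if it is $\tau$-stable and no tile can be $\tau$-stably attached to it. $\mathcal{T}$ is directed if for all producible $\alpha,\beta$ there is a producible $\gamma$ with $\alpha\to\gamma$ and $\beta\to\gamma$. $\mathcal{T}$ uniquely produces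 $\alpha$ if $\mathcal{T}$ is directed and $\alpha$ is its only producible terminal assembly. Theorem. There is an algorithm that, given a temperature-1 seeded tile assembly system $\mathcal{T}=(T,s,1)$ and an assembly $\alpha$ of arbitrary tile types (not necessarily from $T$), decides whether $\mathcal{T}$ uniquely produces $\alpha$, and whose running time is $O(|\alpha|\log|T|)$ on instances with $|T|=O(|\alpha|)$. That is, there is one program such that for every $K$ there is a $C$ for which the program answers correctly within $C\,|\alpha|\,(1+\lfloor\log_2|T|\rfloor)$ steps on every instance with $|T|\le K|\alpha|$. Here the algorithm is a program for a word random access machine, whose registers and memory cells hold integers of $O(\log(L+M+2))$ bits, where $L$ is the length of the input and $M$ the largest absolute value of an entry of it; moving a word, adding, subtracting, multiplying or dividing two words, reading or writing the memory cell at a given address, and comparing two words each take one step; memory cells outside the input initially hold $0$. The input is the list of integers consisting of $|T|$, $|\alpha|$, the glues (label and strength on the four sides) of $s$, the glues of each $t\in T$ in any order, and, for each $p\in\operatorname{dom}\alpha$ in any order, the two coordinates of $p$ followed by the glues of $\alpha(p)$. -/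

import Mathlib

/-! ### The abstract tile assembly model (seeded) -/

namespace ATAM

/-- Points of the integer lattice. -/
abbrev Pos := ℤ × ℤ

/-- The four directions. -/
inductive Dir
  | north | east | south | west
  deriving DecidableEq

instance : Fintype Dir where
  elems := {.north, .east, .south, .west}
  complete d := by cases d <;> simp

/-- The unit vector of a direction. -/
def Dir.vec : Dir → Pos
  | .north => (0, 1)
  | .east => (1, 0)
  | .south => (0, -1)
  | .west => (-1, 0)

/-- The opposite direction. -/
def Dir.opp : Dir → Dir
  | .north => .south
  | .east => .west
  | .south => .north
  | .west => .east

/-- A glue: a label (coded as a natural number) and a nonnegative integer strength. -/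
structure Glue where
  label : ℕ
  strength : ℕ
  deriving DecidableEq

/-- A tile type: a unit square with a glue on each of its four sides. -/
abbrev TileType := Dir → Glue

/-- The infinite grid graph: lattice points are adjacent when their Euclidean distance is 1. -/
def gridGraph : SimpleGraph Pos where
  Adj u v := (u.1 - v.1) ^ 2 + (u.2 - v.2) ^ 2 = 1
  symm := ⟨fun u v h => by
    have e : (v.1 - u.1) ^ 2 + (v.2 - u.2) ^ 2 = (u.1 - v.1) ^ 2 + (u.2 - v.2) ^ 2 := by ring
    exact e.trans h⟩
  loopless := ⟨fun u h => by simp at h⟩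

/-- A (finite) assembly: a partial function from the lattice to tile types with finite domain,
whose full grid graph is connected (in particular the domain is nonempty). -/
@[ext]
structure Assembly where
  tile : Pos → Option TileType
  finite : {p | (tile p).isSome}.Finite
  connected : (gridGraph.induce {p | (tile p).isSome}).Connected

namespace Assembly

/-- The domain of an assembly. -/
noncomputable def dom (α : Assembly) : Finset Pos := α.finite.toFinset

/-- The size `|α|` of an assembly. -/
noncomputable def size (α : Assembly) : ℕ := α.dom.card

/-- `α` is a subassembly of `β`. -/
def Sub (α β : Assembly) : Prop :=
  α.dom ⊆ β.dom ∧ ∀ p ∈ α.dom, α.tile p = β.tile p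

/-- The strength of the bond of `α` between `p` and `p + d`: if both positions are tiled, the
glues on the two abutting sides are equal and their strength is positive (the tiles interact),
it is this strength; otherwise it is `0`, and there is no edge of the binding graph. -/
def bond (α : Assembly) (p : Pos) (d : Dir) : ℕ :=
  match α.tile p, α.tile (p + d.vec) with
  | some t, some t' => if t d = t' d.opp then (t d).strength else 0
  | _, _ => 0

/-- The total strength of the edges of the binding graph between `S` and `dom α \ S`. -/
noncomputable def cutWeight (α : Assembly) (S : Finset Pos) : ℕ :=
  ∑ p ∈ S, ∑ d : Dir, if p + d.vec ∈ α.dom \ S then α.bond p d else 0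

/-- `α` is `τ`-stable: every cut of its binding graph has weight at least `τ`. -/
def Stable (τ : ℕ) (α : Assembly) : Prop :=
  ∀ S : Finset Pos, S ⊆ α.dom → S.Nonempty → S ≠ α.dom → τ ≤ α.cutWeight S

/-- All tiles of `α` have types from `T`. -/
def Over (T : Finset TileType) (α : Assembly) : Prop :=
  ∀ p t, α.tile p = some t → t ∈ T

/-- The assembly consisting of the single tile `s` at the origin. -/
def single (s : TileType) : Assembly where
  tile p := if p = 0 then some s else none
  finite := (Set.finite_singleton (0 : Pos)).subset fun p hp => by
    by_contra h
    simp_all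
  connected := by
    have e : {p : Pos | (if p = 0 then some s else none).isSome} = {0} := by
      ext p
      by_cases h : p = 0 <;> simp [h]
    rw [e]
    exact { preconnected := fun u v => by rw [Subsingleton.elim u v] }

theorem mem_dom {α : Assembly} {p : Pos} : p ∈ α.dom ↔ (α.tile p).isSome := by
  simp [dom]

theorem dom_single (s : TileType) : (single s).dom = {0} := by
  ext p
  by_cases h : p = 0 <;> simp [mem_dom, single, h]

theorem stable_single (τ : ℕ) (s : TileType) : (single s).Stable τ := by
  intro S h h1 h2
  rw [dom_single] at h h2
  exact absurd ((Finset.subset_singleton_iff.mp h).resolve_left h1.ne_empty) h2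

theorem over_single {T : Finset TileType} {s : TileType} (hs : s ∈ T) : (single s).Over T := by
  intro p t h
  by_cases hp : p = 0 <;> simp_all [single]

end Assembly

/-- A seeded tile assembly system `(T, σ, τ)`. -/
structure SeededTAS where
  tiles : Finset TileType
  seed : Assembly
  temp : ℕ
  temp_pos : 0 < temp
  seed_over : seed.Over tiles
  seed_stable : seed.Stable temp

namespace SeededTAS

/-- The system `(T, s, τ)` whose seed is the single tile `s`, placed at the origin. -/
def ofTile (T : Finset TileType) (s : TileType) (hs : s ∈ T) (τ : ℕ) (hτ : 0 < τ) :
    SeededTAS where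
  tiles := T
  seed := Assembly.single s
  temp := τ
  temp_pos := hτ
  seed_over := Assembly.over_single hs
  seed_stable := Assembly.stable_single τ s

variable (𝒯 : SeededTAS)

/-- `α` produces `β` by the stable attachment of one tile. -/
def Step (α β : Assembly) : Prop :=
  α.Over 𝒯.tiles ∧ β.Over 𝒯.tiles ∧ α.Stable 𝒯.temp ∧ β.Stable 𝒯.temp ∧
    α.Sub β ∧ (β.dom \ α.dom).card = 1

/-- `α` produces `β` by the stable attachment of finitely many single tiles, one at a time. -/
def Produces : Assembly → Assembly → Prop := Relation.ReflTransGen 𝒯.Step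

/-- The set of producible assemblies. -/
def prodAsm : Set Assembly := {α | 𝒯.Produces 𝒯.seed α}

/-- The frontier of `α`: the positions at which a tile can be stably attached to `α`. -/
def frontier (α : Assembly) : Set Pos :=
  {p | ∃ β, 𝒯.Step α β ∧ p ∈ β.dom ∧ p ∉ α.dom}

/-- `α` is terminal: it is stable and no tile can be stably attached to it. -/
def Terminal (α : Assembly) : Prop := α.Stable 𝒯.temp ∧ 𝒯.frontier α = ∅

/-- The set of producible, terminal assemblies. -/
def termAsm : Set Assembly := {α | α ∈ 𝒯.prodAsm ∧ 𝒯.Terminal α}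

/-- The system is directed: any two producible assemblies produce a common one. -/
def Directed : Prop := DirectedOn 𝒯.Produces 𝒯.prodAsm

/-- The system uniquely produces `α`: it is directed, with unique producible terminal
assembly `α`. -/
def UniquelyProduces (α : Assembly) : Prop := 𝒯.Directed ∧ 𝒯.termAsm = {α}

end SeededTAS

/-! Encoding of the instances as lists of integers. -/

/-- The eight numbers of a tile type: label and strength of the glue on each side. -/
def encodeTile (t : TileType) : List ℤ :=
  [((t .north).label : ℤ), ((t .north).strength : ℤ), ((t .east).label : ℤ),
    ((t .east).strength : ℤ), ((t .south).label : ℤ), ((t .south).strength : ℤ),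
    ((t .west).label : ℤ), ((t .west).strength : ℤ)]

/-- A tile in an assembly: its two coordinates, followed by its tile type. -/
def encodePlacedTile (q : Pos × TileType) : List ℤ := q.1.1 :: q.1.2 :: encodeTile q.2

/-- The instance given by a list of tile types, a seed tile type and a list of placed tiles: the
lengths of the two lists, the seed, the tile types, the placed tiles. -/
def encodeInstance (tl : List TileType) (s : TileType) (al : List (Pos × TileType)) : List ℤ :=
  [(tl.length : ℤ), (al.length : ℤ)] ++ encodeTile s ++ tl.flatMap encodeTile ++
    al.flatMap encodePlacedTile

/-- `tl` lists the elements of the finite set `T`, each once, in some order. -/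
def ListsTiles (tl : List TileType) (T : Finset TileType) : Prop :=
  tl.Nodup ∧ ∀ t, t ∈ tl ↔ t ∈ T

/-- `al` lists the tiles of the assembly `α` with their positions, each once, in some order. -/
def ListsAssembly (al : List (Pos × TileType)) (α : Assembly) : Prop :=
  al.Nodup ∧ ∀ p t, (p, t) ∈ al ↔ α.tile p = some t

end ATAM

/-! ### Word random access machines

A program is a finite piece of syntax. Its registers and the cells of its memory (addressed by
natural numbers) hold integers of bounded absolute value (words). Every elementary instruction and
every evaluation of a test takes one step. -/

namespace WordRAM

/-- Contents of the registers and of the memory. -/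
structure State where
  reg : ℕ → ℤ
  mem : ℕ → ℤ

/-- An operand: a register or an integer constant. -/
inductive Operand
  | reg (i : ℕ)
  | const (c : ℤ)

/-- The value of an operand. -/
def Operand.val (s : State) : Operand → ℤ
  | .reg i => s.reg i
  | .const c => c

/-- Arithmetical operations. -/
inductive Op
  | add | sub | mul | div

/-- The value of an operation (`div` is integer division with rounding, and `a / 0 = 0`). -/
def Op.eval : Op → ℤ → ℤ → ℤ
  | .add, a, b => a + b
  | .sub, a, b => a - b
  | .mul, a, b => a * b
  | .div, a, b => a / b

/-- Tests: comparisons of two operands. -/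
inductive Test
  | eq (a b : Operand)
  | lt (a b : Operand)

/-- The truth of a test. -/
def Test.holds (s : State) : Test → Prop
  | .eq a b => a.val s = b.val s
  | .lt a b => a.val s < b.val s

/-- Programs. -/
inductive Prog
  | skip
  /-- register `i` becomes the value of `a` -/
  | move (i : ℕ) (a : Operand)
  /-- register `i` becomes the value of an operation on two operands -/
  | arith (i : ℕ) (o : Op) (a b : Operand)
  /-- register `i` becomes the content of the memory cell with address `a` -/
  | load (i : ℕ) (a : Operand)
  /-- the memory cell with address `a` becomes the value of `b` -/
  | store (a b : Operand)
  /-- sequential composition -/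
  | seq (P Q : Prog)
  /-- conditional -/
  | ite (b : Test) (P Q : Prog)
  /-- `while b do P` -/
  | loop (b : Test) (P : Prog)

/-- The state with register `i` set to `v`. -/
def State.setReg (s : State) (i : ℕ) (v : ℤ) : State :=
  { s with reg := Function.update s.reg i v }

/-- The state with memory cell `n` set to `v`. -/
def State.setMem (s : State) (n : ℕ) (v : ℤ) : State :=
  { s with mem := Function.update s.mem n v }

/-- `Exec W P s t s'`: with words of absolute value at most `W`, the program `P`, started in the
state `s`, halts after exactly `t` steps in the state `s'`. A program that computes a number which
is not a word, or uses a negative address, gets stuck and has no such execution. -/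
inductive Exec (W : ℕ) : Prog → State → ℕ → State → Prop
  | skip (s : State) : Exec W .skip s 1 s
  | move (s : State) (i : ℕ) (a : Operand) (h : (a.val s).natAbs ≤ W) :
      Exec W (.move i a) s 1 (s.setReg i (a.val s))
  | arith (s : State) (i : ℕ) (o : Op) (a b : Operand)
      (h : (o.eval (a.val s) (b.val s)).natAbs ≤ W) :
      Exec W (.arith i o a b) s 1 (s.setReg i (o.eval (a.val s) (b.val s)))
  | load (s : State) (i : ℕ) (a : Operand) (n : ℕ) (h : a.val s = n) (hn : n ≤ W) :
      Exec W (.load i a) s 1 (s.setReg i (s.mem n))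
  | store (s : State) (a b : Operand) (n : ℕ) (h : a.val s = n) (hn : n ≤ W)
      (hb : (b.val s).natAbs ≤ W) :
      Exec W (.store a b) s 1 (s.setMem n (b.val s))
  | seq {s s' s'' : State} {P Q : Prog} {t t' : ℕ} (h : Exec W P s t s')
      (h' : Exec W Q s' t' s'') : Exec W (.seq P Q) s (t + t') s''
  | iteTrue {s s' : State} {b : Test} {P Q : Prog} {t : ℕ} (hb : b.holds s)
      (h : Exec W P s t s') : Exec W (.ite b P Q) s (1 + t) s'
  | iteFalse {s s' : State} {b : Test} {P Q : Prog} {t : ℕ} (hb : ¬ b.holds s)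
      (h : Exec W Q s t s') : Exec W (.ite b P Q) s (1 + t) s'
  | loopFalse {s : State} {b : Test} {P : Prog} (hb : ¬ b.holds s) :
      Exec W (.loop b P) s 1 s
  | loopTrue {s s' s'' : State} {b : Test} {P : Prog} {t t' : ℕ} (hb : b.holds s)
      (h : Exec W P s t s') (h' : Exec W (.loop b P) s' t' s'') :
      Exec W (.loop b P) s (1 + t + t') s''

/-- Executions are deterministic, in particular the number of steps is well defined. -/
theorem Exec.deterministic {W : ℕ} {P : Prog} {s s₁ s₂ : State} {t₁ t₂ : ℕ}
    (h₁ : Exec W P s t₁ s₁) (h₂ : Exec W P s t₂ s₂) : t₁ = t₂ ∧ s₁ = s₂ := by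
  induction h₁ generalizing t₂ s₂ with
  | skip | move | arith => cases h₂; exact ⟨rfl, rfl⟩
  | load s i a n h | store s a b n h =>
    cases h₂ with
    | _ => simp_all
  | seq _ _ ih ih' =>
    cases h₂ with
    | seq g g' =>
      obtain ⟨rfl, rfl⟩ := ih g
      obtain ⟨rfl, rfl⟩ := ih' g'
      exact ⟨rfl, rfl⟩
  | iteTrue hb _ ih =>
    cases h₂ with
    | iteTrue _ g => obtain ⟨rfl, rfl⟩ := ih g; exact ⟨rfl, rfl⟩
    | iteFalse hn _ => exact absurd hb hn
  | iteFalse hb _ ih =>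
    cases h₂ with
    | iteFalse _ g => obtain ⟨rfl, rfl⟩ := ih g; exact ⟨rfl, rfl⟩
    | iteTrue hn _ => exact absurd hn hb
  | loopFalse hb =>
    cases h₂ with
    | loopFalse _ => exact ⟨rfl, rfl⟩
    | loopTrue hn _ _ => exact absurd hn hb
  | loopTrue hb _ _ ih ih' =>
    cases h₂ with
    | loopFalse hn => exact absurd hb hn
    | loopTrue _ g g' =>
      obtain ⟨rfl, rfl⟩ := ih g
      obtain ⟨rfl, rfl⟩ := ih' g'
      exact ⟨rfl, rfl⟩

/-- The initial state on input `x`: the input stands in the first cells of the memory, all other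
cells and all registers hold `0`. -/
def init (x : List ℤ) : State where
  reg _ := 0
  mem n := x.getD n 0

/-- The largest word on input `x`: the `k`-th power of the length of the input plus the largest
absolute value of its entries plus `2`, so that words have `O(log(length + largest entry))` bits. -/
def wordBound (k : ℕ) (x : List ℤ) : ℕ :=
  (x.length + (x.map Int.natAbs).foldr max 0 + 2) ^ k

/-- With exponent `k` for the word size, `P` halts on input `x` after `t` steps, with output `out`
(the content of register `0`). -/
def Runs (P : Prog) (k : ℕ) (x : List ℤ) (t : ℕ) (out : ℤ) : Prop :=
  ∃ s', Exec (wordBound k x) P (init x) t s' ∧ s'.reg 0 = out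

end WordRAM

/-! At temperature 1 a single matching glue of positive strength suffices for an attachment.
Stability is therefore connectivity of the binding graph, and a producible assembly can grow to
every stable assembly over `T` that contains it (`produces_of_sub`). Suppose that `α` is over `T`,
has the seed at the origin and has a connected binding graph. Production can deviate from `α` only
when some type of `T`, other than the one that `α` prescribes, binds to a tile at `q` and fills a
neighbouring position `p` that is still empty. An assembly with `q` filled and `p` empty can be
grown inside `α` exactly when the binding graph contains a path from the origin to `q` avoiding `p`.
So unique production means that for every such conflict with `p ≠ 0`, the position `p` separates `q`
from the origin (`uniquelyProduces_iff`).

All these separations are tested by one depth-first search from the origin, as in the computation of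
articulation points. If `p` is not on the search path when `q` is explored, the path itself reaches
`q` without `p`, and the answer is no. If `p` is on the path, let `c` be its successor there. Then
`p` fails to separate `q` exactly when some edge joins the subtree of `c` to a proper ancestor of
`p`. Hence it is enough to keep, for each vertex of the path, its low point and one bit telling
whether its subtree has a conflict with its parent, and to compare the two when the vertex is left.
`SearchInv` is the invariant, `SearchInv.step_halt` the correctness of the answers, and
`SearchInv.step_cont` bounds the number of steps linearly.

The machine makes each step constant time by direct addressing. Numbers are read as digits in a base
`B` larger than all entries, so that tiles, glues and positions become single words. A table indexed
by side and glue code tells whether no type, exactly one type or several types of `T` carry that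
glue; by `conflict_iff` one look at it decides a conflict. From address `L` on, the memory consists
of blocks of 16 cells in which three arrays are interleaved: offsets 0 to 5 belong to positions
(four glue codes, tile code, mark), 8 to 11 to the frames of the search path (vertex, low point,
conflict bit, direction), and 12 to 15 to the glue table. The total time is linear in the length of
the input, so the logarithmic factor is slack.

Programs without loops are verified by weakest preconditions (`wp`, `exec_of_wp`), loops by an
invariant with a decreasing measure (`exec_loop`), and `Rep` ties the machine to the abstract
search. -/

namespace ATAM

namespace Assembly

/-- Adjacency in the binding graph. -/
def Adj (α : Assembly) (p q : Pos) : Prop := ∃ d : Dir, q = p + d.vec ∧ 0 < α.bond p d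

/-- `α.Link A p q`: there is a path from `p` to `q` in the binding graph that avoids `A`. -/
def Link (α : Assembly) (A : Set Pos) (p q : Pos) : Prop :=
  p ∉ A ∧ q ∉ A ∧ Relation.ReflTransGen (fun x y => α.Adj x y ∧ x ∉ A ∧ y ∉ A) p q

/-- Some tile type of `T` can bind to side `d` of the tile of `α` at `q`, but is not the one that
`α` has there. -/
def Conflict (α : Assembly) (T : Finset TileType) (q : Pos) (d : Dir) : Prop :=
  ∃ t ∈ T, ∃ u, α.tile q = some u ∧ u d = t d.opp ∧ 0 < (u d).strength ∧
    α.tile (q + d.vec) ≠ some t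

end Assembly

theorem Dir.opp_opp (d : Dir) : d.opp.opp = d := by cases d <;> rfl

theorem Dir.vec_add_opp (p : Pos) (d : Dir) : p + d.vec + d.opp.vec = p := by
  cases d <;> ext <;> simp [Dir.vec, Dir.opp]

theorem Dir.add_vec_ne (p : Pos) (d : Dir) : p + d.vec ≠ p := by
  cases d <;> simp [Dir.vec, Prod.ext_iff]

theorem gridGraph_adj_vec (p : Pos) (d : Dir) : gridGraph.Adj p (p + d.vec) := by
  cases d <;> simp [gridGraph, Dir.vec]

/-! ### Stability at temperature 1 as connectivity of the binding graph. -/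

namespace Assembly

variable {α β γ : Assembly} {T : Finset TileType}

theorem bond_pos {p : Pos} {d : Dir} :
    0 < α.bond p d ↔ ∃ t u, α.tile p = some t ∧ α.tile (p + d.vec) = some u ∧ t d = u d.opp ∧
      0 < (t d).strength := by
  unfold bond
  cases h : α.tile p <;> cases h' : α.tile (p + d.vec) <;> simp
  split_ifs with h1 <;> simp [h1]

theorem bond_symm {p : Pos} {d : Dir} (h : 0 < α.bond p d) : 0 < α.bond (p + d.vec) d.opp := by
  obtain ⟨t, u, h1, h2, h3, h4⟩ := bond_pos.1 h
  exact bond_pos.2 ⟨u, t, h2, by rwa [Dir.vec_add_opp], by rw [Dir.opp_opp, h3], h3 ▸ h4⟩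

theorem Adj.symm {p q : Pos} (h : α.Adj p q) : α.Adj q p := by
  obtain ⟨d, rfl, h⟩ := h
  exact ⟨d.opp, (Dir.vec_add_opp p d).symm, bond_symm h⟩

theorem Adj.left_mem {p q : Pos} (h : α.Adj p q) : p ∈ α.dom := by
  obtain ⟨d, rfl, h⟩ := h
  obtain ⟨t, u, h1, -⟩ := bond_pos.1 h
  simp [mem_dom, h1]

theorem Adj.right_mem {p q : Pos} (h : α.Adj p q) : q ∈ α.dom := h.symm.left_mem

theorem Link.symm {A : Set Pos} {p q : Pos} (h : α.Link A p q) : α.Link A q p := by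
  obtain ⟨h1, h2, h3⟩ := h
  refine ⟨h2, h1, ?_⟩
  induction h3 with
  | refl => exact .refl
  | tail _ h ih => exact .head ⟨h.1.symm, h.2.2, h.2.1⟩ (ih h.2.1)

theorem Link.trans {A : Set Pos} {p q r : Pos} (h : α.Link A p q) (h' : α.Link A q r) :
    α.Link A p r := ⟨h.1, h'.2.1, h.2.2.trans h'.2.2⟩

theorem Link.refl {A : Set Pos} {p : Pos} (h : p ∉ A) : α.Link A p p := ⟨h, h, .refl⟩

theorem Adj.link {A : Set Pos} {p q : Pos} (h : α.Adj p q) (hp : p ∉ A) (hq : q ∉ A) :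
    α.Link A p q := ⟨hp, hq, .single ⟨h, hp, hq⟩⟩

theorem Link.mono {A B : Set Pos} {p q : Pos} (h : α.Link A p q) (hB : B ⊆ A) :
    α.Link B p q :=
  ⟨fun h' => h.1 (hB h'), fun h' => h.2.1 (hB h'), Relation.ReflTransGen.mono (fun _ _ h =>
    ⟨h.1, fun h' => h.2.1 (hB h'), fun h' => h.2.2 (hB h')⟩) _ _ h.2.2⟩

/-- A set that a path enters is entered by an edge of the path. -/
theorem Link.exists_adj {A : Set Pos} {p q : Pos} (h : α.Link A p q) (S : Set Pos) (hp : p ∉ S)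
    (hq : q ∈ S) : ∃ x y, α.Adj x y ∧ x ∉ S ∧ y ∈ S ∧ x ∉ A := by
  obtain ⟨h1, h2, h3⟩ := h
  induction h3 with
  | refl => exact absurd hq hp
  | @tail b c _ h ih =>
    by_cases hb : b ∈ S
    · exact ih hb h.2.1
    · exact ⟨b, c, h.1, hb, hq, h.2.1⟩

theorem cutWeight_pos {S : Finset Pos} :
    1 ≤ α.cutWeight S ↔ ∃ p ∈ S, ∃ q, q ∈ α.dom ∧ q ∉ S ∧ α.Adj p q := by
  unfold cutWeight
  rw [Nat.one_le_iff_ne_zero, Ne, Finset.sum_eq_zero_iff]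
  push Not
  constructor
  · rintro ⟨p, hp, h⟩
    rw [Ne, Finset.sum_eq_zero_iff] at h
    push Not at h
    obtain ⟨d, -, h⟩ := h
    split_ifs at h with h1
    · rw [Finset.mem_sdiff] at h1
      exact ⟨p, hp, p + d.vec, h1.1, h1.2, d, rfl, Nat.pos_of_ne_zero h⟩
    · exact absurd rfl h
  · rintro ⟨p, hp, _, h1, h2, d, rfl, h3⟩
    refine ⟨p, hp, ?_⟩
    rw [Ne, Finset.sum_eq_zero_iff]
    push Not
    refine ⟨d, Finset.mem_univ _, ?_⟩
    rw [if_pos (Finset.mem_sdiff.2 ⟨h1, h2⟩)]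
    exact h3.ne'

theorem stable_one_iff : α.Stable 1 ↔ ∀ S : Finset Pos, S ⊆ α.dom → S.Nonempty → S ≠ α.dom →
    ∃ p ∈ S, ∃ q, q ∈ α.dom ∧ q ∉ S ∧ α.Adj p q := by
  unfold Stable
  simp only [cutWeight_pos]

/-- Two positions on different sides of a cut are joined by a path through `o`, and some edge of
this path crosses the cut. -/
theorem stable_one_of_link {o : Pos} (h : ∀ q ∈ α.dom, α.Link ∅ o q) : α.Stable 1 := by
  rw [stable_one_iff]
  intro S hS hne hS'
  obtain ⟨q, hq, hqS⟩ : ∃ q ∈ α.dom, q ∉ S := by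
    by_contra! hc
    exact hS' (hS.antisymm hc)
  obtain ⟨p, hp⟩ := hne
  obtain ⟨x, y, h1, h2, h3, -⟩ := ((h p (hS hp)).symm.trans (h q hq)).exists_adj (S : Set Pos)ᶜ
    (by simpa using hp) (by simpa using hqS)
  exact ⟨x, by simpa using h2, y, h1.right_mem, by simpa using h3, h1⟩

theorem Stable.link (h : α.Stable 1) {o q : Pos} (ho : o ∈ α.dom) (hq : q ∈ α.dom) :
    α.Link ∅ o q := by
  classical
  rw [stable_one_iff] at h
  -- This is the component of `o`; were it not the whole domain, it would be a cut without edges.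
  set S := α.dom.filter fun q => α.Link ∅ o q with hS
  by_cases hS' : S = α.dom
  · rw [← hS', hS, Finset.mem_filter] at hq
    exact hq.2
  · obtain ⟨p, hp, r, hr, hrS, hpr⟩ := h S (Finset.filter_subset _ _)
      ⟨o, Finset.mem_filter.2 ⟨ho, .refl (by simp)⟩⟩ hS'
    exact absurd (Finset.mem_filter.2 ⟨hr, (Finset.mem_filter.1 hp).2.trans
      (hpr.link (by simp) (by simp))⟩) hrS

/-- The assembly `α` with the tile `t` added next to position `q`. -/
def attach (α : Assembly) (q : Pos) (d : Dir) (hq : q ∈ α.dom) (t : TileType) : Assembly where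
  tile p := if p = q + d.vec then some t else α.tile p
  finite := (α.finite.union (Set.finite_singleton (q + d.vec))).subset fun p hp => by
    by_cases h : p = q + d.vec
    · exact .inr h
    · exact .inl (by simpa [h] using hp)
  connected := by
    have e : {p | (if p = q + d.vec then some t else α.tile p).isSome} =
        {p | (α.tile p).isSome} ∪ {q, q + d.vec} := by
      have hq' := mem_dom.1 hq
      ext p
      by_cases h : p = q + d.vec
      · simp [h]
      · simp only [Set.mem_ofPred_eq, Set.mem_union, Set.mem_insert_iff,
          Set.mem_singleton_iff, h, or_false]
        exact ⟨.inl, fun h' => h'.elim id fun h' => h' ▸ hq'⟩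
    rw [e]
    exact SimpleGraph.induce_union_connected α.connected.preconnected
      (SimpleGraph.induce_pair_connected_of_adj (gridGraph_adj_vec q d)).preconnected
      ⟨q, mem_dom.1 hq, .inl rfl⟩

theorem dom_attach {q : Pos} {d : Dir} {hq : q ∈ α.dom} {t : TileType} :
    (α.attach q d hq t).dom = insert (q + d.vec) α.dom := by
  ext p
  by_cases h : p = q + d.vec <;> simp [mem_dom, attach, h]

theorem sub_attach {q : Pos} {d : Dir} {hq : q ∈ α.dom} {t : TileType}
    (h : q + d.vec ∉ α.dom) : α.Sub (α.attach q d hq t) := by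
  refine ⟨by simp [dom_attach], fun p hp => ?_⟩
  have : p ≠ q + d.vec := by rintro rfl; exact h hp
  simp [attach, this]

theorem Sub.adj (h : α.Sub β) {p q : Pos} (ha : α.Adj p q) : β.Adj p q := by
  have hp := h.2 p ha.left_mem
  have hq := h.2 q ha.right_mem
  obtain ⟨d, rfl, hb⟩ := ha
  obtain ⟨t, u, h1, h2, h3⟩ := bond_pos.1 hb
  exact ⟨d, rfl, bond_pos.2 ⟨t, u, hp ▸ h1, hq ▸ h2, h3⟩⟩

theorem Sub.refl (α : Assembly) : α.Sub α := ⟨Finset.Subset.refl _, fun _ _ => rfl⟩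

theorem Sub.trans (h : α.Sub β) (h' : β.Sub γ) : α.Sub γ :=
  ⟨h.1.trans h'.1, fun p hp => (h.2 p hp).trans (h'.2 p (h.1 hp))⟩

theorem Sub.eq_of_dom_subset (h : α.Sub β) (h' : β.dom ⊆ α.dom) : α = β := by
  ext1
  funext p
  by_cases hp : p ∈ α.dom
  · exact h.2 p hp
  · have hp' : p ∉ β.dom := fun h1 => hp (h' h1)
    rw [mem_dom, Option.not_isSome_iff_eq_none] at hp hp'
    rw [hp, hp']

theorem exists_tile {p : Pos} (h : p ∈ α.dom) : ∃ t, α.tile p = some t :=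
  Option.isSome_iff_exists.1 (mem_dom.1 h)

end Assembly

/-! ### Growth at temperature 1. -/

namespace SeededTAS

open Assembly

variable {𝒯 : SeededTAS} {α β : Assembly}

/-- The bond with `q` links the new tile to the old assembly, which is already connected, and at
temperature 1 nothing more is required. -/
theorem step_attach (hT : 𝒯.temp = 1) (hO : α.Over 𝒯.tiles) (hS : α.Stable 1) {q : Pos} {d : Dir}
    {t u : TileType} (hq : q ∈ α.dom) (hd : q + d.vec ∉ α.dom) (ht : t ∈ 𝒯.tiles)
    (hu : α.tile q = some u) (hg : u d = t d.opp) (hpos : 0 < (u d).strength) :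
    𝒯.Step α (α.attach q d hq t) := by
  have hsub := sub_attach (hq := hq) (t := t) hd
  refine ⟨hO, ?_, hT ▸ hS, ?_, hsub, ?_⟩
  · intro p t' h
    by_cases hp : p = q + d.vec
    · simp only [attach, hp, if_true, Option.some.injEq] at h
      exact h ▸ ht
    · simp only [attach, hp, if_false] at h
      exact hO p t' h
  · rw [hT]
    have hl : ∀ p ∈ α.dom, (α.attach q d hq t).Link ∅ q p := fun p hp => by
      obtain ⟨-, -, h⟩ := hS.link hq hp
      exact ⟨by simp, by simp, Relation.ReflTransGen.mono (fun _ _ h => ⟨hsub.adj h.1, h.2⟩) _ _ h⟩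
    refine stable_one_of_link (o := q) fun p hp => ?_
    rw [dom_attach, Finset.mem_insert] at hp
    obtain rfl | hp := hp
    · refine Adj.link ⟨d, rfl, bond_pos.2 ⟨u, t, ?_, ?_, hg, hpos⟩⟩ (by simp) (by simp)
      · rw [← hsub.2 q hq, hu]
      · simp [attach]
    · exact hl p hp
  · rw [dom_attach, Finset.insert_sdiff_of_notMem _ hd]
    simp

theorem Step.sub_of_produces (h : 𝒯.Produces α β) : α.Sub β := by
  induction h with
  | refl => exact .refl _
  | tail _ h ih => exact ih.trans h.2.2.2.2.1

theorem Terminal.eq_of_produces (hα : 𝒯.Terminal α) (h : 𝒯.Produces α β) : β = α := by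
  obtain rfl | ⟨γ, h1, -⟩ := Relation.ReflTransGen.cases_head h
  · rfl
  · obtain ⟨p, hp⟩ := Finset.card_pos.1 (h1.2.2.2.2.2.symm ▸ Nat.one_pos : 0 < (γ.dom \ α.dom).card)
    rw [Finset.mem_sdiff] at hp
    have : p ∈ 𝒯.frontier α := ⟨γ, h1, hp⟩
    rw [hα.2] at this
    exact absurd this (Set.notMem_empty p)

theorem over_stable_of_mem_prodAsm (h : α ∈ 𝒯.prodAsm) :
    α.Over 𝒯.tiles ∧ α.Stable 𝒯.temp := by
  obtain rfl | ⟨γ, -, h1⟩ := Relation.ReflTransGen.cases_tail h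
  · exact ⟨𝒯.seed_over, 𝒯.seed_stable⟩
  · exact ⟨h1.2.1, h1.2.2.2.1⟩

/-- At temperature 1, a producible assembly grows to every stable assembly that contains it. -/
theorem produces_of_sub {𝒯 : SeededTAS} {α β : Assembly} (hT : 𝒯.temp = 1) (hO : α.Over 𝒯.tiles) (hS : α.Stable 1)
    (hβO : β.Over 𝒯.tiles) (hβS : β.Stable 1) (h : β.Sub α) (hne : β.dom.Nonempty) :
    𝒯.Produces β α := by
  by_cases hd : β.dom = α.dom
  · rw [h.eq_of_dom_subset hd.symm.subset]
    exact .refl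
  -- The cut of `α` around `dom β` is crossed by a bond, and the tile of `α` at its far end is
  -- attached next.
  · obtain ⟨p, hp, q, hq, hqβ, d, rfl, hb⟩ := stable_one_iff.1 hS β.dom h.1 hne hd
    obtain ⟨u, t, h1, h2, h3, h4⟩ := bond_pos.1 hb
    have hst := step_attach (t := t) hT hβO hβS hp hqβ (hO _ _ h2) (by rw [h.2 p hp, h1]) h3 h4
    have hsub : (β.attach p d hp t).Sub α := by
      refine ⟨?_, fun x hx => ?_⟩
      · rw [dom_attach]
        exact Finset.insert_subset hq h.1
      · by_cases hx' : x = p + d.vec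
        · simp [attach, hx', h2]
        · rw [dom_attach, Finset.mem_insert] at hx
          simp only [attach, hx', if_false]
          exact h.2 x (hx.resolve_left hx')
    have : (α.dom \ insert (p + d.vec) β.dom).card < (α.dom \ β.dom).card :=
      Finset.card_lt_card ⟨Finset.sdiff_subset_sdiff (Finset.Subset.refl _)
        (Finset.subset_insert _ _), fun hs => absurd (hs (Finset.mem_sdiff.2 ⟨hq, hqβ⟩)) (by simp)⟩
    exact .head hst (produces_of_sub (β := β.attach p d hp t) hT hO hS hst.2.1 (hT ▸ hst.2.2.2.1) hsub
      ⟨p, by rw [dom_attach]; simp [hp]⟩)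
termination_by (α.dom \ β.dom).card
decreasing_by rw [dom_attach]; exact this

end SeededTAS

open Assembly SeededTAS

/-- Unique production at temperature 1, in terms of the binding graph. -/
theorem uniquelyProduces_iff (T : Finset TileType) (s : TileType) (hs : s ∈ T) (α : Assembly) :
    (ofTile T s hs 1 one_pos).UniquelyProduces α ↔
      α.tile 0 = some s ∧ α.Over T ∧ (∀ q ∈ α.dom, α.Link ∅ 0 q) ∧
      ∀ q d, α.Conflict T q d → q + d.vec ≠ 0 → ¬ α.Link {q + d.vec} 0 q := by
  set 𝒯 := ofTile T s hs 1 one_pos with h𝒯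
  have hT : 𝒯.temp = 1 := rfl
  have seedTile : (single s).tile 0 = some s := by simp [single]
  have seedDom : (0 : Pos) ∈ (single s).dom := by simp [dom_single]
  have seedSub : ∀ β ∈ 𝒯.prodAsm, β.tile 0 = some s ∧ 0 ∈ β.dom := fun β hβ => by
    have := Step.sub_of_produces hβ
    exact ⟨(this.2 0 seedDom).symm.trans seedTile, this.1 seedDom⟩
  constructor
  · rintro ⟨hdir, hterm⟩
    obtain ⟨hp, ht⟩ : α ∈ 𝒯.termAsm := by rw [hterm]; rfl
    obtain ⟨hO, hS⟩ := over_stable_of_mem_prodAsm hp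
    have h0 := seedSub α hp
    refine ⟨h0.1, hO, fun q hq => hS.link h0.2 hq, ?_⟩
    rintro q d ⟨t, htT, u, hu, hg, hpos, hne⟩ hd0 ⟨-, -, hl⟩
    -- Tiles of `α` are attached along the path from the origin to `q`. Since the path avoids `q +
    -- d.vec`, this position is still empty when `q` is reached.
    have key : ∃ β ∈ 𝒯.prodAsm, β.Sub α ∧ q ∈ β.dom ∧ q + d.vec ∉ β.dom := by
      clear hu hne hg
      generalize q + d.vec = b at hd0 hl
      induction hl with
      | refl => exact ⟨single s, .refl, Step.sub_of_produces hp, seedDom, by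
          simpa [dom_single] using hd0⟩
      | @tail x y _ h ih =>
        obtain ⟨β, h1, h2, h3, h4⟩ := ih
        by_cases hy : y ∈ β.dom
        · exact ⟨β, h1, h2, hy, h4⟩
        have hyb : y ≠ b := by simpa using h.2.2
        have hyα := h.1.right_mem
        obtain ⟨e, rfl, hb⟩ := h.1
        obtain ⟨u', t', e1, e2, e3, e4⟩ := bond_pos.1 hb
        obtain ⟨hβO, hβS⟩ := over_stable_of_mem_prodAsm h1
        have hst := step_attach (t := t') hT hβO hβS h3 hy (hO _ _ e2)
          (by rw [h2.2 _ h3, e1]) e3 e4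
        refine ⟨_, Relation.ReflTransGen.tail h1 hst, ⟨?_, fun z hz => ?_⟩, ?_, ?_⟩
        · rw [dom_attach]
          exact Finset.insert_subset hyα h2.1
        · by_cases hz' : z = x + e.vec
          · simp [attach, hz', e2]
          · rw [dom_attach, Finset.mem_insert] at hz
            simp only [attach, hz', if_false]
            exact h2.2 z (hz.resolve_left hz')
        · simp [dom_attach]
        · rw [dom_attach, Finset.mem_insert]
          rintro (h | h)
          exacts [hyb h.symm, h4 h]
    obtain ⟨β, h1, h2, h3, h4⟩ := key
    obtain ⟨hβO, hβS⟩ := over_stable_of_mem_prodAsm h1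
    have hst := step_attach (t := t) hT hβO hβS h3 h4 htT (by rw [h2.2 _ h3, hu]) hg hpos
    -- A common successor of the deviating assembly and of `α` can only be `α`, which is terminal.
    -- But then `α` would have the tile `t` at `q + d.vec`.
    obtain ⟨γ, -, g1, g2⟩ := hdir _ (Relation.ReflTransGen.tail h1 hst) _ hp
    obtain rfl := ht.eq_of_produces g2
    refine hne ?_
    rw [← (Step.sub_of_produces g1).2 (q + d.vec) (by simp [dom_attach])]
    simp [attach]
  · rintro ⟨h0, hO, hL, hC⟩
    have hS : α.Stable 1 := stable_one_of_link hL
    -- The heart of this direction: no producible assembly ever deviates from `α`.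
    have hsub : ∀ β ∈ 𝒯.prodAsm, β.Sub α := by
      intro β hβ
      change 𝒯.Produces 𝒯.seed β at hβ
      induction hβ with
      | refl =>
        have h0d : (0 : Pos) ∈ α.dom := by simp [mem_dom, h0]
        refine ⟨?_, fun p hp => ?_⟩
        · change (single s).dom ⊆ _
          simpa [dom_single] using h0d
        · change p ∈ (single s).dom at hp
          rw [dom_single, Finset.mem_singleton] at hp
          rw [hp, h0]
          exact seedTile
      | @tail β β' hβ hst ih =>
        obtain ⟨hβO, hβO', hβS, hβS', hs1, hs2⟩ := hst
        obtain ⟨p, hp⟩ := Finset.card_eq_one.1 hs2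
        have hpm : p ∈ β'.dom \ β.dom := by rw [hp]; exact Finset.mem_singleton_self p
        rw [Finset.mem_sdiff] at hpm
        have hdom : ∀ x ∈ β'.dom, x ≠ p → x ∈ β.dom := fun x hx hxp => by
          by_contra hxβ
          have : x ∈ β'.dom \ β.dom := Finset.mem_sdiff.2 ⟨hx, hxβ⟩
          rw [hp, Finset.mem_singleton] at this
          exact hxp this
        have h0β := (seedSub β hβ).2
        obtain ⟨t, ht⟩ := exists_tile hpm.1
        have hαp : α.tile p = some t := by
          by_contra hne
          -- The cut of `β'` around the new position has positive weight, so the new tile is bonded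
          -- to a tile at some `q` of `β`.
          obtain ⟨x, hx, q, hq, hqx, ha⟩ := stable_one_iff.1 hβS' {p}
            (by simpa using hpm.1) ⟨p, by simp⟩ (by
              intro h
              have := hs1.1 h0β
              rw [← h, Finset.mem_singleton] at this
              exact hpm.2 (this ▸ h0β))
          rw [Finset.mem_singleton] at hx hqx
          subst hx
          have hqβ := hdom q hq hqx
          obtain ⟨d, hd, hb⟩ := ha.symm
          obtain ⟨u, t', e1, e2, e3, e4⟩ := bond_pos.1 hb
          rw [← hd, ht, Option.some.injEq] at e2
          subst e2
          refine hC q d ⟨t, hβO' _ _ ht, u, ?_, e3, e4, by rwa [← hd]⟩ ?_ ?_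
          · rw [← ih.2 q hqβ, hs1.2 q hqβ, e1]
          · rw [← hd]
            rintro rfl
            exact hpm.2 h0β
          · rw [← hd]
            -- `β` is connected and does not contain the new position, so its paths are paths of `α`
            -- avoiding it; this is what `hC` excludes.
            have hl := Stable.link hβS h0β hqβ
            refine ⟨?_, by simpa using hqx, Relation.ReflTransGen.mono (fun y z h => ⟨ih.adj h.1, ?_, ?_⟩) _ _ hl.2.2⟩
            · intro h
              rw [Set.mem_singleton_iff] at h
              exact hpm.2 (h ▸ h0β)
            · rintro rfl
              exact hpm.2 h.1.left_mem
            · rintro rfl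
              exact hpm.2 h.1.right_mem
        have hβ'α : ∀ x ∈ β'.dom, β'.tile x = α.tile x := fun x hx => by
          by_cases hxp : x = p
          · rw [hxp, ht, hαp]
          · have := hdom x hx hxp
            rw [← hs1.2 x this, ih.2 x this]
        refine ⟨fun x hx => ?_, hβ'α⟩
        rw [mem_dom, ← hβ'α x hx]
        exact mem_dom.1 hx
    have hprod : ∀ β ∈ 𝒯.prodAsm, 𝒯.Produces β α := fun β hβ => by
      obtain ⟨h1, h2⟩ := over_stable_of_mem_prodAsm hβ
      exact produces_of_sub hT hO hS h1 h2 (hsub β hβ) ⟨0, (seedSub β hβ).2⟩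
    have hα : α ∈ 𝒯.prodAsm := hprod _ .refl
    have hαt : 𝒯.Terminal α := by
      refine ⟨hS, Set.eq_empty_iff_forall_notMem.2 ?_⟩
      rintro p ⟨β, hst, h1, h2⟩
      exact h2 ((hsub β (Relation.ReflTransGen.tail hα hst)).1 h1)
    refine ⟨fun β hβ γ hγ => ⟨α, hα, hprod β hβ, hprod γ hγ⟩, ?_⟩
    ext β
    constructor
    · rintro ⟨h1, h2⟩
      exact (h2.eq_of_produces (hprod β h1)).symm
    · rintro rfl
      exact ⟨hα, hαt⟩

end ATAM

/-! ### Depth-first search for conflicts -/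

namespace ATAM

/-- The direction with a given index. -/
def Dir.ofIndex : ℕ → Dir
  | 0 => .north
  | 1 => .east
  | 2 => .south
  | _ => .west

@[simp] theorem Dir.ofIndex_zero : ofIndex 0 = north := rfl

@[simp] theorem Dir.ofIndex_one : ofIndex 1 = east := rfl

@[simp] theorem Dir.ofIndex_two : ofIndex 2 = south := rfl

@[simp] theorem Dir.ofIndex_three : ofIndex 3 = west := rfl

theorem Dir.exists_ofIndex (d : Dir) : ∃ j < 4, Dir.ofIndex j = d := by
  cases d
  exacts [⟨0, by simp [ofIndex]⟩, ⟨1, by simp [ofIndex]⟩, ⟨2, by simp [ofIndex]⟩, ⟨3, by simp [ofIndex]⟩]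

/-- The status of a position during the search: not yet visited, on the search path at a given
depth, or completed. -/
inductive Mark
  | fresh
  | on (i : ℕ)
  | done

/-- The state of the depth-first search. For each depth `i ≤ k` of the search path, `stk i` is the
vertex, `low i` the least depth known to be reachable by an edge from the part of the tree below it,
`need i` tells whether this part has a conflict with the vertex at depth `i - 1`, and `dir i` is the
next direction to be explored. -/
structure SearchState where
  k : ℕ
  stk : ℕ → Pos
  low : ℕ → ℕ
  need : ℕ → Prop
  dir : ℕ → ℕ
  mark : Pos → Mark
  cnt : ℕ

/-- The result of one step of the search. -/
inductive SearchResult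
  | cont (σ : SearchState)
  | halt (b : Prop)

open Assembly

/-- The search enters the position `w`. -/
def SearchState.push (σ : SearchState) (w : Pos) : SearchState where
  k := σ.k + 1
  stk := Function.update σ.stk (σ.k + 1) w
  low := Function.update σ.low (σ.k + 1) (σ.k + 1)
  need := Function.update σ.need (σ.k + 1) False
  dir := Function.update σ.dir (σ.k + 1) 0
  mark := Function.update σ.mark w (.on (σ.k + 1))
  cnt := σ.cnt + 1

/-- The search leaves the current position, at depth `k' + 1`. -/
def SearchState.pop (σ : SearchState) (k' : ℕ) : SearchState where
  k := k'
  stk := σ.stk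
  low := Function.update σ.low k' (min (σ.low k') (σ.low (k' + 1)))
  need := σ.need
  dir := σ.dir
  mark := Function.update σ.mark (σ.stk (k' + 1)) .done
  cnt := σ.cnt

/-- The search proceeds to the next direction, with updated data. -/
def SearchState.advance (σ : SearchState) (need' : ℕ → Prop) (l : ℕ) : SearchState where
  k := σ.k
  stk := σ.stk
  low := Function.update σ.low σ.k l
  need := need'
  dir := Function.update σ.dir σ.k (σ.dir σ.k + 1)
  mark := σ.mark
  cnt := σ.cnt

/-- The state at the start. -/
def SearchState.start : SearchState where
  k := 0
  stk _ := 0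
  low _ := 0
  need _ := False
  dir _ := 0
  mark := Function.update (fun _ => .fresh) 0 (.on 0)
  cnt := 1

/-- The vertex at the end of the search path. -/
def SearchState.top (σ : SearchState) : Pos := σ.stk σ.k

/-- The direction to be explored next. -/
def SearchState.topDir (σ : SearchState) : Dir := Dir.ofIndex (σ.dir σ.k)

/-- The position to be explored next. -/
def SearchState.next (σ : SearchState) : Pos := σ.top + σ.topDir.vec

/-- One step of the search. -/
inductive SearchStep (α : Assembly) (T : Finset TileType) (σ : SearchState) : SearchResult → Prop
  -- The recorded conflict is with the vertex at depth `k - 1`, and an edge to a smaller depth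
  -- bypasses that vertex. For `k = 1` the vertex is the origin, filled from the start, and the
  -- inequality cannot hold.
  | popReject (h : σ.dir σ.k = 4) (hn : σ.need σ.k) (hl : σ.low σ.k + 1 < σ.k) :
      SearchStep α T σ (.halt False)
  | pop (h : σ.dir σ.k = 4) (hn : ¬ (σ.need σ.k ∧ σ.low σ.k + 1 < σ.k)) (k' : ℕ)
      (hk : σ.k = k' + 1) : SearchStep α T σ (.cont (σ.pop k'))
  | finish (h : σ.dir σ.k = 4) (hk : σ.k = 0) : SearchStep α T σ (.halt (σ.cnt = α.size))
  | pushReject (h : σ.dir σ.k < 4) (hb : 0 < α.bond σ.top σ.topDir)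
      (hm : σ.mark σ.next = .fresh)
      (hc : α.Conflict T σ.top σ.topDir ∨ ∃ t, α.tile σ.next = some t ∧ t ∉ T) :
      SearchStep α T σ (.halt False)
  -- The direction is not advanced here. After the return it leads to a completed position and is
  -- passed by `advance`, so a bond to a child counts as explored only once the child has been left.
  | push (h : σ.dir σ.k < 4) (hb : 0 < α.bond σ.top σ.topDir) (hm : σ.mark σ.next = .fresh)
      (hc : ∀ t, α.tile σ.next = some t → t ∈ T) :
      SearchStep α T σ (.cont (σ.push σ.next))
  | conflictReject (h : σ.dir σ.k < 4) (hc : α.Conflict T σ.top σ.topDir)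
      (hm : ∀ i, σ.mark σ.next ≠ .on i) : SearchStep α T σ (.halt False)
  -- The new data `need'` and `l` are constrained only as far as the invariant needs them: no
  -- conflict and no edge may be lost, and each recorded one must have a cause.
  | advance (h : σ.dir σ.k < 4)
      (hb : 0 < α.bond σ.top σ.topDir → σ.mark σ.next ≠ .fresh)
      (need' : ℕ → Prop) (l : ℕ)
      (hc : α.Conflict T σ.top σ.topDir → ∃ i, σ.mark σ.next = .on i ∧ need' (i + 1))
      (hn : ∀ j, need' j → σ.need j ∨ α.Conflict T σ.top σ.topDir ∧
        ∃ i, σ.mark σ.next = .on i ∧ j = i + 1)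
      (hn' : ∀ j, σ.need j → need' j)
      (hl : l ≤ σ.low σ.k)
      (hl' : ∀ i, 0 < α.bond σ.top σ.topDir → σ.mark σ.next = .on i → l ≤ i)
      (hl'' : l = σ.low σ.k ∨ 0 < α.bond σ.top σ.topDir ∧ σ.mark σ.next = .on l) :
      SearchStep α T σ (.cont (σ.advance need' l))

/-- The set `S` separates `q` from the origin, except through `p`. -/
def Separates (α : Assembly) (S : Set Pos) (q p : Pos) : Prop :=
  q ∈ S ∧ 0 ∉ S ∧ p ∉ S ∧ ∀ u ∈ S, ∀ v, α.Adj u v → v ∈ S ∨ v = p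

/-- A path from the origin to `q` must enter `S` by some edge, whose outer end can only be `p`. -/
theorem Separates.not_link {α : Assembly} {S : Set Pos} {q p : Pos} (h : Separates α S q p) :
    ¬ α.Link {p} 0 q := fun hl => by
  obtain ⟨x, y, h1, h2, h3, h4⟩ := hl.exists_adj S h.2.1 h.1
  exact (h.2.2.2 y h3 x h1.symm).elim h2 h4

/-- The vertices of the search path below depth `i`. -/
def SearchState.below (σ : SearchState) (i : ℕ) : Set Pos := {p | ∃ j < i, p = σ.stk j}

/-- The invariant of the search; `F i` is the part of the search tree that hangs on the search path
at depth `i`. -/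
structure SearchInv (α : Assembly) (T : Finset TileType) (σ : SearchState) (F : ℕ → Set Pos) :
    Prop where
  stk_zero : σ.stk 0 = 0
  mark_stk : ∀ i ≤ σ.k, σ.mark (σ.stk i) = .on i
  stk_mark : ∀ p i, σ.mark p = .on i → i ≤ σ.k ∧ σ.stk i = p
  adj : ∀ i < σ.k, α.Adj (σ.stk i) (σ.stk (i + 1))
  visited : ∀ p, σ.mark p ≠ .fresh ↔ ∃ i ≤ σ.k, p ∈ F i
  self_mem : ∀ i ≤ σ.k, σ.stk i ∈ F i
  disj : ∀ i ≤ σ.k, ∀ j ≤ σ.k, ∀ p, p ∈ F i → p ∈ F j → i = j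
  -- Undirected depth-first search has no cross edges: an explored bond stays in its own tree or
  -- goes up to the search path, where the low point accounts for it. For vertices that are no
  -- longer on the path all four directions count as explored.
  edges : ∀ i ≤ σ.k, ∀ u ∈ F i, ∀ j < 4, (u = σ.stk i → j < σ.dir i) →
    0 < α.bond u (Dir.ofIndex j) → u + (Dir.ofIndex j).vec ∈ F i ∨
      ∃ l < i, u + (Dir.ofIndex j).vec = σ.stk l ∧ σ.low i ≤ l
  low_sound : ∀ i ≤ σ.k, σ.low i < i →
    ∃ u, α.Adj u (σ.stk (σ.low i)) ∧ α.Link (σ.below i) u (σ.stk i)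
  need_sound : ∀ i ≤ σ.k, σ.need i → ∃ l, i = l + 1 ∧ ∃ q d, α.Conflict T q d ∧
    q + d.vec = σ.stk l ∧ α.Link (σ.below i) q (σ.stk i)
  -- A conflict that has been seen is either pending, with its bit kept at the successor `l + 1` of
  -- the path vertex concerned, or settled by a separating set. As the bit sits at an ancestor, it
  -- need not be propagated when vertices are left.
  conflict : ∀ i ≤ σ.k, ∀ q ∈ F i, ∀ j < 4, (q = σ.stk i → j < σ.dir i) →
    α.Conflict T q (Dir.ofIndex j) →
    (∃ l < i, q + (Dir.ofIndex j).vec = σ.stk l ∧ σ.need (l + 1)) ∨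
      ∃ S, Separates α S q (q + (Dir.ofIndex j).vec)
  tile_mem : ∀ i ≤ σ.k, ∀ p ∈ F i, ∃ t ∈ T, α.tile p = some t
  link : ∀ i ≤ σ.k, ∀ p ∈ F i, α.Link ∅ 0 p
  count : ∃ V : Finset Pos, (∀ p, p ∈ V ↔ σ.mark p ≠ .fresh) ∧ V.card = σ.cnt
  dir_le : ∀ i ≤ σ.k, σ.dir i ≤ 4

variable {α : Assembly} {T : Finset TileType} {σ : SearchState} {F : ℕ → Set Pos}

theorem SearchInv.stk_inj (h : SearchInv α T σ F) {i j : ℕ} (hi : i ≤ σ.k) (hj : j ≤ σ.k)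
    (e : σ.stk i = σ.stk j) : i = j := by
  have h1 := h.mark_stk i hi
  rw [e, h.mark_stk j hj] at h1
  exact (Mark.on.inj h1).symm

theorem SearchInv.link_stk (h : SearchInv α T σ F) {A : Set Pos} {i j : ℕ} (hij : i ≤ j)
    (hj : j ≤ σ.k) (hA : ∀ l, i ≤ l → l ≤ j → σ.stk l ∉ A) :
    α.Link A (σ.stk i) (σ.stk j) := by
  induction j, hij using Nat.le_induction with
  | base => exact .refl (hA i le_rfl le_rfl)
  | succ j hij ih =>
    exact (ih (by omega) fun l h1 h2 => hA l h1 (by omega)).trans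
      ((h.adj j (by omega)).link (hA j hij (by omega)) (hA (j + 1) (by omega) le_rfl))

theorem SearchInv.link_below (h : SearchInv α T σ F) {i j : ℕ} (hij : i ≤ j)
    (hj : j ≤ σ.k) : α.Link (σ.below i) (σ.stk i) (σ.stk j) := by
  refine h.link_stk hij hj ?_
  rintro l h1 h2 ⟨m, hm, e⟩
  have := h.stk_inj (by omega) (by omega) e
  omega

/-- A position off the search path does not separate the current vertex from the origin. -/
theorem SearchInv.link_top (h : SearchInv α T σ F) {p : Pos} (hp : ∀ i, σ.mark p ≠ .on i) :
    α.Link {p} 0 σ.top := by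
  have := h.link_stk (A := {p}) (Nat.zero_le σ.k) le_rfl (by
    rintro l - h2 rfl
    exact hp l (h.mark_stk l h2))
  rwa [h.stk_zero] at this

theorem SearchInv.start (hs : ∃ t ∈ T, α.tile 0 = some t) :
    SearchInv α T .start fun _ => {0} where
  stk_zero := rfl
  mark_stk i hi := by
    obtain rfl : i = 0 := Nat.le_zero.1 hi
    simp [SearchState.start]
  stk_mark p i h := by
    by_cases hp : p = 0
    · subst hp
      simp only [SearchState.start, Function.update_self, Mark.on.injEq] at h
      simp [SearchState.start, ← h]
    · simp [SearchState.start, hp] at h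
  adj i hi := by simp [SearchState.start] at hi
  visited p := by
    by_cases hp : p = 0
    · simp [SearchState.start, hp]
    · simp [SearchState.start, hp]
  self_mem i _ := rfl
  disj i hi j hj _ _ _ := by
    simp only [SearchState.start, Nat.le_zero] at hi hj
    rw [hi, hj]
  edges i hi u hu j _ h _ := by
    simp only [SearchState.start] at h
    exact absurd (h hu) (Nat.not_lt_zero _)
  low_sound i _ h := by simp [SearchState.start] at *; omega
  need_sound i _ h := absurd h id
  conflict i hi q hq j _ h _ := by
    simp only [SearchState.start] at h
    exact absurd (h hq) (Nat.not_lt_zero _)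
  tile_mem i _ p hp := by
    obtain rfl : p = 0 := hp
    exact hs
  link i _ p hp := by
    obtain rfl : p = 0 := hp
    exact .refl (by simp)
  count := ⟨{0}, fun p => by by_cases hp : p = 0 <;> simp [SearchState.start, hp], rfl⟩
  dir_le i _ := by simp [SearchState.start]

/-- The new vertex forms a tree of its own with no direction explored, so the conditions on explored
bonds and conflicts are void for it, while the older depths keep their data. -/
theorem SearchInv.push (h : SearchInv α T σ F) (hb : 0 < α.bond σ.top σ.topDir)
    (hm : σ.mark σ.next = .fresh) (hc : ∀ t, α.tile σ.next = some t → t ∈ T) :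
    SearchInv α T (σ.push σ.next) (Function.update F (σ.k + 1) {σ.next}) := by
  set w := σ.next with hw
  have hadj : α.Adj (σ.stk σ.k) w := ⟨σ.topDir, rfl, hb⟩
  have hnew : ∀ i ≤ σ.k, w ∉ F i := fun i hi hF => (h.visited w).2 ⟨i, hi, hF⟩ hm
  have hstk : ∀ i ≤ σ.k, σ.stk i ≠ w := fun i hi e => by
    have := h.mark_stk i hi
    rw [e, hm] at this
    cases this
  have up : ∀ {β : Type} (f : ℕ → β) (x : β) (i : ℕ), i ≤ σ.k →
      Function.update f (σ.k + 1) x i = f i := fun f x i hi =>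
    Function.update_of_ne (by omega) _ _
  have cases : ∀ i, i ≤ σ.k + 1 → i ≤ σ.k ∨ i = σ.k + 1 := fun i hi => by omega
  have hbelow : ∀ i ≤ σ.k + 1, (σ.push w).below i = σ.below i := fun i hi => by
    ext p
    refine exists_congr fun j => and_congr_right fun hj => ?_
    simp only [SearchState.push]
    rw [up _ _ _ (by omega)]
  constructor
  · simp only [SearchState.push]
    rw [up _ _ _ (by omega), h.stk_zero]
  · intro i hi
    simp only [SearchState.push] at hi ⊢
    obtain hi | rfl := cases i hi
    · rw [up _ _ _ hi, Function.update_of_ne (hstk i hi), h.mark_stk i hi]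
    · simp
  · intro p i hp
    simp only [SearchState.push] at hp ⊢
    by_cases hpw : p = w
    · subst hpw
      rw [Function.update_self, Mark.on.injEq] at hp
      simp [← hp]
    · rw [Function.update_of_ne hpw] at hp
      have := h.stk_mark p i hp
      exact ⟨by omega, by rw [up _ _ _ this.1, this.2]⟩
  · intro i hi
    simp only [SearchState.push] at hi ⊢
    rw [up _ _ i (by omega)]
    obtain hi | rfl := Nat.lt_succ_iff_lt_or_eq.1 hi
    · rw [up _ _ _ (by omega)]
      exact h.adj i hi
    · rwa [Function.update_self]
  · intro p
    simp only [SearchState.push]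
    by_cases hpw : p = w
    · subst hpw
      simp only [Function.update_self, ne_eq, reduceCtorEq, not_false_eq_true, true_iff]
      exact ⟨σ.k + 1, le_rfl, by simp⟩
    · rw [Function.update_of_ne hpw, h.visited]
      constructor
      · rintro ⟨i, hi, hp⟩
        exact ⟨i, by omega, by rwa [up _ _ _ hi]⟩
      · rintro ⟨i, hi, hp⟩
        obtain hi | rfl := cases i hi
        · exact ⟨i, hi, by rwa [up _ _ _ hi] at hp⟩
        · rw [Function.update_self] at hp
          exact absurd hp hpw
  · intro i hi
    simp only [SearchState.push] at hi ⊢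
    obtain hi | rfl := cases i hi
    · rw [up _ _ _ hi, up _ _ _ hi]
      exact h.self_mem i hi
    · simp
  · intro i hi j hj p hpi hpj
    simp only [SearchState.push] at hi hj
    obtain hi | rfl := cases i hi <;> obtain hj | rfl := cases j hj
    · rw [up _ _ _ hi] at hpi
      rw [up _ _ _ hj] at hpj
      exact h.disj i hi j hj p hpi hpj
    · rw [up _ _ _ hi] at hpi
      rw [Function.update_self] at hpj
      exact absurd (hpj ▸ hpi) (hnew i hi)
    · rw [up _ _ _ hj] at hpj
      rw [Function.update_self] at hpi
      exact absurd (hpi ▸ hpj) (hnew j hj)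
    · rfl
  · intro i hi u hu j hj4 hj hbd
    simp only [SearchState.push] at hi hu hj ⊢
    obtain hi | rfl := cases i hi
    · rw [up _ _ _ hi] at hu ⊢
      rw [up _ _ _ hi, up _ _ _ hi] at hj
      rw [up _ _ _ hi]
      refine (h.edges i hi u hu j hj4 hj hbd).imp_right ?_
      rintro ⟨l, hl, h1⟩
      exact ⟨l, hl, by rwa [up _ _ _ (by omega)]⟩
    · rw [Function.update_self] at hu hj
      rw [Function.update_self] at hj
      exact absurd (hj hu) (Nat.not_lt_zero _)
  · intro i hi hl
    rw [hbelow i hi]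
    simp only [SearchState.push] at hi hl ⊢
    obtain hi | rfl := cases i hi
    · rw [up _ _ _ hi] at hl ⊢
      rw [up _ _ _ hi, up _ _ _ (by omega)]
      exact h.low_sound i hi hl
    · simp at hl
  · intro i hi hn
    rw [hbelow i hi]
    simp only [SearchState.push] at hi hn ⊢
    obtain hi | rfl := cases i hi
    · rw [up _ _ _ hi] at hn
      obtain ⟨l, rfl, q, d, h1, h2, h3⟩ := h.need_sound i hi hn
      exact ⟨l, rfl, q, d, h1, by rwa [up _ _ _ (by omega)], by rwa [up _ _ _ hi]⟩
    · simp at hn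
  · intro i hi q hq j hj4 hj hcf
    simp only [SearchState.push] at hi hq hj ⊢
    obtain hi | rfl := cases i hi
    · rw [up _ _ _ hi] at hq
      rw [up _ _ _ hi, up _ _ _ hi] at hj
      refine (h.conflict i hi q hq j hj4 hj hcf).imp_left ?_
      rintro ⟨l, hl, h1, h2⟩
      exact ⟨l, hl, by rwa [up _ _ _ (by omega)], by rwa [up _ _ _ (by omega)]⟩
    · rw [Function.update_self] at hq hj
      rw [Function.update_self] at hj
      exact absurd (hj hq) (Nat.not_lt_zero _)
  · intro i hi p hp
    simp only [SearchState.push] at hi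
    obtain hi | rfl := cases i hi
    · rw [up _ _ _ hi] at hp
      exact h.tile_mem i hi p hp
    · rw [Function.update_self] at hp
      obtain rfl : p = w := hp
      obtain ⟨t, ht⟩ := exists_tile hadj.right_mem
      exact ⟨t, hc t ht, ht⟩
  · intro i hi p hp
    simp only [SearchState.push] at hi
    obtain hi | rfl := cases i hi
    · rw [up _ _ _ hi] at hp
      exact h.link i hi p hp
    · rw [Function.update_self] at hp
      obtain rfl : p = w := hp
      exact (h.link σ.k le_rfl _ (h.self_mem _ le_rfl)).trans (hadj.link (by simp) (by simp))
  · obtain ⟨V, h1, h2⟩ := h.count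
    have hwV : w ∉ V := fun hV => (h1 w).1 hV hm
    refine ⟨insert w V, fun p => ?_, ?_⟩
    · simp only [SearchState.push, Finset.mem_insert]
      by_cases hpw : p = w
      · simp [hpw]
      · simp [hpw, h1]
    · simp [SearchState.push, hwV, h2]
  · intro i hi
    simp only [SearchState.push] at hi ⊢
    obtain hi | rfl := cases i hi
    · rw [up _ _ _ hi]
      exact h.dir_le i hi
    · simp

/-- The tree of the vertex that is left is merged into that of its parent. Its conflicts with the
parent must be settled at this moment: if the low point does not lie above the parent, the tree is a
separating set. -/
theorem SearchInv.pop (h : SearchInv α T σ F) (hd : σ.dir σ.k = 4)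
    (hn : ¬ (σ.need σ.k ∧ σ.low σ.k + 1 < σ.k)) {k' : ℕ} (hk : σ.k = k' + 1) :
    SearchInv α T (σ.pop k') (Function.update F k' (F k' ∪ F (k' + 1))) := by
  rw [hk] at hd hn
  -- The map `j ↦ min j k'` identifies the depths `k'` and `k' + 1`, which lets the old and the new
  -- trees be compared uniformly.
  have hmem : ∀ i ≤ k', ∀ p, p ∈ Function.update F k' (F k' ∪ F (k' + 1)) i ↔
      ∃ j ≤ k' + 1, p ∈ F j ∧ min j k' = i := fun i hi p => by
    obtain rfl | hik := eq_or_ne i k'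
    · rw [Function.update_self]
      constructor
      · rintro (hp | hp)
        exacts [⟨i, by omega, hp, by simp⟩, ⟨i + 1, by omega, hp, by simp⟩]
      · rintro ⟨j, hj, hp, e⟩
        obtain rfl | rfl : j = i ∨ j = i + 1 := by omega
        exacts [.inl hp, .inr hp]
    · rw [Function.update_of_ne hik]
      constructor
      · exact fun hp => ⟨i, by omega, hp, by omega⟩
      · rintro ⟨j, hj, hp, e⟩
        obtain rfl : j = i := by omega
        exact hp
  have hsub : ∀ i ≤ k', F i ⊆ Function.update F k' (F k' ∪ F (k' + 1)) i := fun i hi p hp =>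
    (hmem i hi p).2 ⟨i, by omega, hp, by omega⟩
  have hbelow : ∀ i, (σ.pop k').below i = σ.below i := fun i => rfl
  have htop : ∀ i ≤ k', σ.stk i ≠ σ.stk (k' + 1) := fun i hi e => by
    have := h.stk_inj (by omega) (by omega) e
    omega
  constructor
  · exact h.stk_zero
  · intro i hi
    simp only [SearchState.pop] at hi ⊢
    rw [Function.update_of_ne (htop i hi)]
    exact h.mark_stk i (by omega)
  · intro p i hp
    simp only [SearchState.pop] at hp ⊢
    by_cases hpw : p = σ.stk (k' + 1)
    · subst hpw
      simp at hp
    · rw [Function.update_of_ne hpw] at hp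
      have := h.stk_mark p i hp
      refine ⟨?_, this.2⟩
      by_contra hlt
      obtain rfl : i = k' + 1 := by omega
      exact hpw this.2.symm
  · intro i hi
    simp only [SearchState.pop] at hi
    exact h.adj i (by omega)
  · intro p
    have : (σ.pop k').mark p ≠ .fresh ↔ σ.mark p ≠ .fresh := by
      simp only [SearchState.pop]
      by_cases hpw : p = σ.stk (k' + 1)
      · rw [hpw, h.mark_stk _ (by omega)]
        simp
      · rw [Function.update_of_ne hpw]
    rw [this, h.visited]
    constructor
    · rintro ⟨i, hi, hp⟩
      exact ⟨min i k', min_le_right _ _, (hmem _ (min_le_right _ _) p).2 ⟨i, by omega, hp, rfl⟩⟩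
    · rintro ⟨i, hi, hp⟩
      obtain ⟨j, hj, hp, -⟩ := (hmem i hi p).1 hp
      exact ⟨j, by omega, hp⟩
  · intro i hi
    simp only [SearchState.pop] at hi
    exact hsub i hi (h.self_mem i (by omega))
  · intro i hi j hj p hpi hpj
    obtain ⟨i', hi', hpi', rfl⟩ := (hmem i hi p).1 hpi
    obtain ⟨j', hj', hpj', rfl⟩ := (hmem j hj p).1 hpj
    rw [h.disj i' (by omega) j' (by omega) p hpi' hpj']
  · intro i hi u hu j hj4 hj hbd
    simp only [SearchState.pop] at hi hj ⊢
    obtain ⟨m, hm, hum, rfl⟩ := (hmem i hi u).1 hu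
    have hj' : u = σ.stk m → j < σ.dir m := fun e => by
      obtain hm | rfl : m ≤ k' ∨ m = k' + 1 := by omega
      · rw [min_eq_left hm] at hj
        exact hj e
      · rwa [hd]
    obtain h1 | ⟨l, hl, h1, h2⟩ := h.edges m (by omega) u hum j hj4 hj' hbd
    · exact .inl ((hmem _ hi _).2 ⟨m, hm, h1, rfl⟩)
    · obtain hm | rfl : m ≤ k' ∨ m = k' + 1 := by omega
      · rw [min_eq_left hm]
        refine .inr ⟨l, hl, h1, ?_⟩
        obtain rfl | hmk := eq_or_ne m k'
        · rw [Function.update_self]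
          exact (min_le_left _ _).trans h2
        · rwa [Function.update_of_ne hmk]
      · rw [min_eq_right (by omega)]
        obtain rfl | hlk := eq_or_ne l k'
        · left
          rw [h1]
          exact hsub l le_rfl (h.self_mem l (by omega))
        · refine .inr ⟨l, by omega, h1, ?_⟩
          rw [Function.update_self]
          exact (min_le_right _ _).trans h2
  · intro i hi hl
    rw [hbelow]
    simp only [SearchState.pop] at hi hl ⊢
    obtain rfl | hik := eq_or_ne i k'
    · rw [Function.update_self] at hl ⊢
      obtain h1 | h1 : min (σ.low i) (σ.low (i + 1)) = σ.low i ∨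
          min (σ.low i) (σ.low (i + 1)) = σ.low (i + 1) := min_choice _ _
      · rw [h1] at hl ⊢
        exact h.low_sound i (by omega) hl
      · rw [h1] at hl ⊢
        obtain ⟨u, hu, hlk⟩ := h.low_sound (i + 1) (by omega) (by omega)
        have hlk' : α.Link (σ.below i) u (σ.stk (i + 1)) :=
          hlk.mono fun p ⟨j, hj, e⟩ => ⟨j, by omega, e⟩
        -- The low point is inherited from the child, so the path to the child is extended by the
        -- tree edge to the parent.
        exact ⟨u, hu, hlk'.trans (h.link_below (Nat.le_succ i) (by omega)).symm⟩
    · rw [Function.update_of_ne hik] at hl ⊢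
      exact h.low_sound i (by omega) hl
  · intro i hi hni
    simp only [SearchState.pop] at hi
    exact h.need_sound i (by omega) hni
  · intro i hi q hq j hj4 hj hcf
    simp only [SearchState.pop] at hi hj ⊢
    obtain ⟨m, hm, hqm, rfl⟩ := (hmem i hi q).1 hq
    have hj' : q = σ.stk m → j < σ.dir m := fun e => by
      obtain hm | rfl : m ≤ k' ∨ m = k' + 1 := by omega
      · rw [min_eq_left hm] at hj
        exact hj e
      · rwa [hd]
    obtain ⟨l, hl, h1, h2⟩ | h1 := h.conflict m (by omega) q hqm j hj4 hj' hcf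
    · obtain hlk | rfl : l < k' ∨ l = k' := by omega
      · exact .inl ⟨l, by omega, h1, h2⟩
      · obtain rfl : m = l + 1 := by omega
        -- The conflict is with the parent; the whole tree of the child serves as the set that
        -- separates.
        refine .inr ⟨F (l + 1), hqm, fun h0 => ?_, fun hp => ?_, fun u hu v huv => ?_⟩
        · have := h.self_mem 0 (by omega)
          rw [h.stk_zero] at this
          have := h.disj 0 (by omega) (l + 1) (by omega) _ this h0
          omega
        · rw [h1] at hp
          have := h.disj l (by omega) (l + 1) (by omega) _ (h.self_mem l (by omega)) hp
          omega
        · obtain ⟨d, rfl, hb⟩ := huv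
          obtain ⟨e, he, rfl⟩ := d.exists_ofIndex
          refine (h.edges (l + 1) (by omega) u hu e he (fun _ => by rwa [hd]) hb).imp_right ?_
          rintro ⟨l', hl', g1, g2⟩
          -- The bit is set and there was no rejection, so the low point is at least `l`; an edge
          -- leaving the tree can then end only at the parent.
          have : ¬ (σ.low (l + 1) + 1 < l + 1) := fun g => hn ⟨h2, g⟩
          obtain rfl : l' = l := by omega
          rw [g1, h1]
    · exact .inr h1
  · intro i hi p hp
    obtain ⟨m, hm, hp, -⟩ := (hmem i hi p).1 hp
    exact h.tile_mem m (by omega) p hp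
  · intro i hi p hp
    obtain ⟨m, hm, hp, -⟩ := (hmem i hi p).1 hp
    exact h.link m (by omega) p hp
  · obtain ⟨V, h1, h2⟩ := h.count
    refine ⟨V, fun p => ?_, h2⟩
    simp only [SearchState.pop]
    by_cases hpw : p = σ.stk (k' + 1)
    · rw [h1, hpw, h.mark_stk _ (by omega)]
      simp
    · rw [Function.update_of_ne hpw, h1]
  · intro i hi
    simp only [SearchState.pop] at hi
    exact h.dir_le i (by omega)

/-- The essential point is the absence of cross edges for the bond just explored; the rest records
its effect on the low point and on the conflict bits. -/
theorem SearchInv.advance (h : SearchInv α T σ F) (hd : σ.dir σ.k < 4)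
    (hb : 0 < α.bond σ.top σ.topDir → σ.mark σ.next ≠ .fresh)
    {need' : ℕ → Prop} {l : ℕ}
    (hc : α.Conflict T σ.top σ.topDir → ∃ i, σ.mark σ.next = .on i ∧ need' (i + 1))
    (hn : ∀ j, need' j → σ.need j ∨ α.Conflict T σ.top σ.topDir ∧
      ∃ i, σ.mark σ.next = .on i ∧ j = i + 1)
    (hn' : ∀ j, σ.need j → need' j)
    (hl : l ≤ σ.low σ.k)
    (hl' : ∀ i, 0 < α.bond σ.top σ.topDir → σ.mark σ.next = .on i → l ≤ i)
    (hl'' : l = σ.low σ.k ∨ 0 < α.bond σ.top σ.topDir ∧ σ.mark σ.next = .on l) :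
    SearchInv α T (σ.advance need' l) F := by
  have hnext : ∀ i, σ.mark σ.next = .on i → i < σ.k := fun i hi => by
    obtain ⟨h1, h2⟩ := h.stk_mark _ _ hi
    refine lt_of_le_of_ne h1 ?_
    rintro rfl
    exact Dir.add_vec_ne _ _ h2.symm
  have hlow : ∀ i, Function.update σ.low σ.k l i ≤ σ.low i := fun i => by
    obtain rfl | hik := eq_or_ne i σ.k
    · rwa [Function.update_self]
    · rw [Function.update_of_ne hik]
  have hdir : ∀ i, i ≤ σ.k → ∀ u j, (u = σ.stk i → j < (σ.advance need' l).dir i) →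
      (u = σ.stk i → j < σ.dir i) ∨ i = σ.k ∧ u = σ.top ∧ j = σ.dir σ.k := fun i _ u j hj => by
    simp only [SearchState.advance] at hj
    obtain rfl | hik := eq_or_ne i σ.k
    · by_cases hu : u = σ.stk σ.k
      · have := hj hu
        rw [Function.update_self] at this
        by_cases hjd : j = σ.dir σ.k
        · exact .inr ⟨rfl, hu, hjd⟩
        · exact .inl fun _ => by omega
      · exact .inl fun e => absurd e hu
    · rw [Function.update_of_ne hik] at hj
      exact .inl hj
  refine { h with
    edges := ?_, low_sound := ?_, need_sound := ?_, conflict := ?_, dir_le := ?_ }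
  · intro i hi u hu j hj4 hj hbd
    obtain h1 | ⟨rfl, rfl, rfl⟩ := hdir i hi u j hj
    · refine (h.edges i hi u hu j hj4 h1 hbd).imp_right ?_
      rintro ⟨m, hm, g1, g2⟩
      exact ⟨m, hm, g1, (hlow i).trans g2⟩
    · have hv := hb hbd
      change σ.next ∈ _ ∨ ∃ m < _, σ.next = _ ∧ _
      obtain ⟨i, hi', hF⟩ := (h.visited _).1 hv
      by_cases hwi : σ.next = σ.stk i
      · have hm := h.mark_stk i hi'
        rw [← hwi] at hm
        refine .inr ⟨i, hnext i hm, hwi, ?_⟩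
        simp only [SearchState.advance, Function.update_self]
        exact hl' i hbd hm
      · left
        -- The neighbour is visited but is not on the path, so all its directions have been
        -- explored, including the one back. By `edges` its tree contains the current vertex or has
        -- it as a proper ancestor on the path; the latter is impossible for the end of the path.
        have hback := bond_symm hbd
        obtain ⟨e, he, he'⟩ := (Dir.ofIndex (σ.dir σ.k)).opp.exists_ofIndex
        rw [← he'] at hback
        have hvec : σ.next + (Dir.ofIndex e).vec = σ.top := by
          rw [he']
          exact Dir.vec_add_opp _ _
        obtain h1 | ⟨m, hm, h1, -⟩ := h.edges i hi' _ hF e he (fun e => absurd e hwi) hback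
        · have h1' : σ.top ∈ F i := hvec ▸ h1
          have := h.disj _ hi' _ hi _ h1' hu
          exact this ▸ hF
        · have h1' : σ.stk σ.k = σ.stk m := hvec.symm.trans h1
          have := h.stk_inj le_rfl (by omega) h1'
          have : σ.k ≥ i := hi'
          omega
  · intro i hi hli
    change _ < i at hli
    change ∃ u, α.Adj u (σ.stk (Function.update σ.low σ.k l i)) ∧
      α.Link (σ.below i) u (σ.stk i)
    have hli' : Function.update σ.low σ.k l i < i := hli
    obtain rfl | hik := eq_or_ne i σ.k
    · rw [Function.update_self] at hli' ⊢
      obtain e | ⟨h1, h2⟩ := hl''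
      · rw [e] at hli' ⊢
        exact h.low_sound _ hi hli'
      · have := h.stk_mark _ _ h2
        exact ⟨σ.top, ⟨σ.topDir, this.2, h1⟩, h.link_below le_rfl le_rfl⟩
    · rw [Function.update_of_ne hik] at hli' ⊢
      exact h.low_sound i hi hli'
  · intro i hi hni
    obtain h1 | ⟨h1, m, h2, rfl⟩ := hn i hni
    · exact h.need_sound i hi h1
    · refine ⟨m, rfl, σ.top, σ.topDir, h1, (h.stk_mark _ _ h2).2.symm, ?_⟩
      exact (h.link_below hi le_rfl).symm
  · intro i hi q hq j hj4 hj hcf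
    obtain h1 | ⟨rfl, rfl, rfl⟩ := hdir i hi q j hj
    · refine (h.conflict i hi q hq j hj4 h1 hcf).imp_left ?_
      rintro ⟨m, hm, g1, g2⟩
      exact ⟨m, hm, g1, hn' _ g2⟩
    · obtain ⟨m, g1, g2⟩ := hc hcf
      exact .inl ⟨m, hnext m g1, (h.stk_mark _ _ g1).2.symm, g2⟩
  · intro i hi
    change Function.update σ.dir σ.k (σ.dir σ.k + 1) i ≤ 4
    obtain rfl | hik := eq_or_ne i σ.k
    · rw [Function.update_self]
      omega
    · rw [Function.update_of_ne hik]
      exact h.dir_le i hi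

/-! ### Correctness of the answers of the search. -/

/-- What the search decides, in terms of the binding graph. -/
def Good (α : Assembly) (T : Finset TileType) : Prop :=
  α.Over T ∧ (∀ q ∈ α.dom, α.Link ∅ 0 q) ∧
    ∀ q d, α.Conflict T q d → q + d.vec ≠ 0 → ¬ α.Link {q + d.vec} 0 q

/-- The bypass runs along the search path down to the depth `low k`, over the recorded edge, through
the part below depth `k` to `stk k`, and on to `q`. It misses `stk l` because `l = k - 1` lies
strictly between the two depths. -/
theorem SearchInv.popReject (h : SearchInv α T σ F) (hn : σ.need σ.k)
    (hl : σ.low σ.k + 1 < σ.k) : ¬ Good α T := by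
  rintro ⟨-, -, hg⟩
  obtain ⟨l, hk, q, d, hc, hq, hlk⟩ := h.need_sound σ.k le_rfl hn
  obtain ⟨u, hu, hlu⟩ := h.low_sound σ.k le_rfl (by omega)
  have hsub : ({σ.stk l} : Set Pos) ⊆ σ.below σ.k := by
    rintro _ rfl
    exact ⟨l, by omega, rfl⟩
  refine hg q d hc ?_ ?_
  · rw [hq, ← h.stk_zero]
    intro e
    have := h.stk_inj (by omega) (by omega) e
    omega
  · rw [hq]
    have h1 : α.Link {σ.stk l} (σ.stk 0) (σ.stk (σ.low σ.k)) :=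
      h.link_stk (Nat.zero_le _) (by omega) fun m _ hm e => by
        have := h.stk_inj (by omega) (by omega) (Set.mem_singleton_iff.1 e)
        omega
    rw [h.stk_zero] at h1
    exact h1.trans ((hu.symm.link h1.2.1 (hlu.mono hsub).1).trans
      ((hlu.mono hsub).trans (hlk.mono hsub).symm))

theorem SearchInv.conflictReject (h : SearchInv α T σ F) (hc : α.Conflict T σ.top σ.topDir)
    (hm : ∀ i, σ.mark σ.next ≠ .on i) : ¬ Good α T := by
  rintro ⟨-, -, hg⟩
  refine hg _ _ hc (fun e => hm 0 ?_) (h.link_top hm)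
  change σ.next = 0 at e
  rw [e, ← h.stk_zero]
  exact h.mark_stk 0 (Nat.zero_le _)

/-- At the end `F 0` is closed under bonds, hence it is the component of the origin, and counting
tells whether it is the whole domain. No conflict can be pending, as there is no depth below 0, so
all of them have separating sets. -/
theorem SearchInv.finish (h : SearchInv α T σ F) (hd : σ.dir σ.k = 4) (hk : σ.k = 0) :
    σ.cnt = α.size ↔ Good α T := by
  rw [hk] at hd
  have hvis : ∀ p, σ.mark p ≠ .fresh ↔ p ∈ F 0 := fun p => by
    rw [h.visited, hk]
    simp
  obtain ⟨V, hV, hcard⟩ := h.count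
  have h0 : (0 : Pos) ∈ F 0 := by
    have := h.self_mem 0 (Nat.zero_le _)
    rwa [h.stk_zero] at this
  have hVdom : V ⊆ α.dom := fun p hp => by
    obtain ⟨t, -, ht⟩ := h.tile_mem 0 (Nat.zero_le _) p ((hvis p).1 ((hV p).1 hp))
    simp [mem_dom, ht]
  have hclosed : ∀ u ∈ F 0, ∀ v, α.Adj u v → v ∈ F 0 := by
    rintro u hu _ ⟨d, rfl, hb⟩
    obtain ⟨e, he, rfl⟩ := d.exists_ofIndex
    refine (h.edges 0 (Nat.zero_le _) u hu e he (fun _ => by rwa [hd]) hb).resolve_right ?_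
    rintro ⟨l, hl, -⟩
    exact Nat.not_lt_zero _ hl
  constructor
  · intro hc
    have hVe : V = α.dom := Finset.eq_of_subset_of_card_le hVdom (by rw [hcard, hc]; rfl)
    have hdom : ∀ p ∈ α.dom, p ∈ F 0 := fun p hp => (hvis p).1 ((hV p).1 (hVe ▸ hp))
    refine ⟨fun p t hp => ?_, fun q hq => h.link 0 (Nat.zero_le _) q (hdom q hq), ?_⟩
    · obtain ⟨t', h1, h2⟩ := h.tile_mem 0 (Nat.zero_le _) p (hdom p (by simp [mem_dom, hp]))
      rw [hp, Option.some.injEq] at h2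
      exact h2 ▸ h1
    · intro q d hc _
      have hq : q ∈ α.dom := by
        obtain ⟨t, -, u, hu, -⟩ := hc
        simp [mem_dom, hu]
      obtain ⟨e, he, rfl⟩ := d.exists_ofIndex
      obtain ⟨l, hl, -⟩ | ⟨S, hS⟩ :=
        h.conflict 0 (Nat.zero_le _) q (hdom q hq) e he (fun _ => by rwa [hd]) hc
      · exact absurd hl (Nat.not_lt_zero _)
      · exact hS.not_link
  · rintro ⟨-, hL, -⟩
    rw [← hcard]
    refine congrArg Finset.card (hVdom.antisymm fun q hq => ?_)
    rw [hV, hvis]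
    by_contra hq'
    obtain ⟨x, y, h1, h2, h3, -⟩ := (hL q hq).exists_adj (F 0)ᶜ (by simpa using h0) hq'
    exact h3 (hclosed x (by simpa using h2) y h1)

/-! ### Bounds for the time and the depth of the search. -/

/-- The number of steps that are left is at most this number. -/
noncomputable def SearchState.measure (σ : SearchState) (α : Assembly) : ℕ :=
  -- A frame carries 4 units for its directions and 1 for leaving it. Entering a position adds such
  -- a frame of weight 5 and takes 6 from the first term, so every continuing step lowers the sum.
  6 * (α.size - σ.cnt) + ∑ i ∈ Finset.range (σ.k + 1), (5 - σ.dir i)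

theorem SearchInv.cnt_lt (h : SearchInv α T σ F) {w : Pos} (hw : w ∈ α.dom)
    (hm : σ.mark w = .fresh) : σ.cnt < α.size := by
  obtain ⟨V, hV, hcard⟩ := h.count
  rw [← hcard]
  refine Finset.card_lt_card ⟨fun p hp => ?_, fun hs => (hV w).1 (hs hw) hm⟩
  obtain ⟨i, hi, hp⟩ := (h.visited p).1 ((hV p).1 hp)
  obtain ⟨t, -, ht⟩ := h.tile_mem i hi p hp
  simp [mem_dom, ht]

theorem SearchInv.step_cont (h : SearchInv α T σ F) {σ' : SearchState}
    (hs : SearchStep α T σ (.cont σ')) :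
    (∃ F', SearchInv α T σ' F') ∧ σ'.measure α < σ.measure α := by
  cases hs with
  | pop hd hn k' hk =>
    refine ⟨⟨_, h.pop hd hn hk⟩, ?_⟩
    rw [hk] at hd
    simp only [SearchState.measure, SearchState.pop, hk, Finset.sum_range_succ, hd]
    omega
  | push hd hb hm hc =>
    refine ⟨⟨_, h.push hb hm hc⟩, ?_⟩
    have := h.cnt_lt (w := σ.next) (Adj.right_mem ⟨_, rfl, hb⟩) hm
    simp only [SearchState.measure, SearchState.push]
    rw [Finset.sum_range_succ, Function.update_self, Finset.sum_congr rfl fun i hi =>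
      by rw [Function.update_of_ne (Finset.mem_range.1 hi).ne]]
    omega
  | advance hd hb need' l hc hn hn' hl hl' hl'' =>
    refine ⟨⟨_, h.advance hd hb hc hn hn' hl hl' hl''⟩, ?_⟩
    simp only [SearchState.measure, SearchState.advance]
    rw [Finset.sum_range_succ, Finset.sum_range_succ, Function.update_self,
      Finset.sum_congr rfl fun i hi => by
        rw [Function.update_of_ne (Finset.mem_range.1 hi).ne]]
    omega

theorem SearchInv.step_halt (h : SearchInv α T σ F) {b : Prop}
    (hs : SearchStep α T σ (.halt b)) : b ↔ Good α T := by
  cases hs with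
  | popReject hd hn hl => exact iff_of_false id (h.popReject hn hl)
  | finish hd hk => exact h.finish hd hk
  | pushReject hd hb hm hc =>
    refine iff_of_false id ?_
    obtain hc | ⟨t, h1, h2⟩ := hc
    · exact h.conflictReject hc fun i hi => by rw [hm] at hi; cases hi
    · exact fun hg => h2 (hg.1 _ _ h1)
  | conflictReject hd hc hm => exact iff_of_false id (h.conflictReject hc hm)

/-- The vertices of the search path are distinct positions of `α`. This bounds the addresses of the
frames. -/
theorem SearchInv.k_lt (h : SearchInv α T σ F) : σ.k < α.size := by
  have : (Finset.range (σ.k + 1)).card ≤ α.dom.card := by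
    refine Finset.card_le_card_of_injOn σ.stk (fun i hi => ?_) fun i hi j hj e => ?_
    · have hi : i ≤ σ.k := by simpa [Nat.lt_succ_iff] using hi
      obtain ⟨t, -, ht⟩ := h.tile_mem i hi _ (h.self_mem i hi)
      simp [mem_dom, ht]
    · have hi : i ≤ σ.k := by simpa [Nat.lt_succ_iff] using hi
      have hj : j ≤ σ.k := by simpa [Nat.lt_succ_iff] using hj
      exact h.stk_inj hi hj e
  rw [Finset.card_range] at this
  exact this

theorem uniquelyProduces_iff_good (s : TileType) (hs : s ∈ T) :
    (SeededTAS.ofTile T s hs 1 one_pos).UniquelyProduces α ↔ α.tile 0 = some s ∧ Good α T :=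
  uniquelyProduces_iff T s hs α

end ATAM

/-! ### A calculus of weakest preconditions for word random access machines -/

namespace WordRAM

/-- Sequential composition of a list of programs. -/
def block : List Prog → Prog
  | [] => .skip
  | P :: l => .seq P (block l)

/-- A bound for the number of steps of a program without loops. -/
def cost : Prog → ℕ
  | .seq P Q => cost P + cost Q
  | .ite _ P Q => 1 + (cost P + cost Q)
  | _ => 1

/-- The content of the memory cell with an integer address. -/
def State.rd (s : State) (a : ℤ) : ℤ := s.mem a.toNat

/-- The state after writing to the memory cell with an integer address. -/
def State.wr (s : State) (a v : ℤ) : State := s.setMem a.toNat v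

/-- The condition for a program without loops to run with words of absolute value at most `W`, and
to end in a state with property `Q`. -/
def wp (W : ℤ) : Prog → (State → Prop) → State → Prop
  | .skip, Q, s => Q s
  | .move i a, Q, s => |a.val s| ≤ W ∧ Q (s.setReg i (a.val s))
  | .arith i o a b, Q, s =>
    |o.eval (a.val s) (b.val s)| ≤ W ∧ Q (s.setReg i (o.eval (a.val s) (b.val s)))
  | .load i a, Q, s => (0 ≤ a.val s ∧ a.val s ≤ W) ∧ Q (s.setReg i (s.rd (a.val s)))
  | .store a b, Q, s =>
    (0 ≤ a.val s ∧ a.val s ≤ W ∧ |b.val s| ≤ W) ∧ Q (s.wr (a.val s) (b.val s))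
  | .seq P P', Q, s => wp W P (wp W P' Q) s
  | .ite b P P', Q, s => (b.holds s → wp W P Q s) ∧ (¬ b.holds s → wp W P' Q s)
  -- Loops are excluded here and are treated by `exec_loop`.
  | .loop _ _, _, _ => False

theorem wp_mono {W : ℤ} {P : Prog} {Q Q' : State → Prop} (h : ∀ s, Q s → Q' s) {s : State}
    (hw : wp W P Q s) : wp W P Q' s := by
  induction P generalizing Q Q' s with
  | skip => exact h _ hw
  | move | arith | load | store => exact ⟨hw.1, h _ hw.2⟩
  | seq P P' ih ih' => exact ih (fun s hs => ih' h hs) hw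
  | ite b P P' ih ih' => exact ⟨fun hb => ih h (hw.1 hb), fun hb => ih' h (hw.2 hb)⟩
  | loop => exact hw

theorem natAbs_le_iff {x : ℤ} {W : ℕ} : x.natAbs ≤ W ↔ |x| ≤ (W : ℤ) := by
  rw [Int.abs_eq_natAbs]
  exact Int.ofNat_le.symm

theorem exec_of_wp {W : ℕ} {P : Prog} {Q : State → Prop} {s : State} (hw : wp W P Q s) :
    ∃ t s', Exec W P s t s' ∧ t ≤ cost P ∧ Q s' := by
  induction P generalizing Q s with
  | skip => exact ⟨1, s, .skip s, le_rfl, hw⟩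
  | move i a => exact ⟨1, _, .move s i a (natAbs_le_iff.2 hw.1), le_rfl, hw.2⟩
  | arith i o a b => exact ⟨1, _, .arith s i o a b (natAbs_le_iff.2 hw.1), le_rfl, hw.2⟩
  | load i a =>
    obtain ⟨⟨h1, h2⟩, h3⟩ := hw
    exact ⟨1, _, .load s i a (a.val s).toNat (Int.toNat_of_nonneg h1).symm (by omega), le_rfl, h3⟩
  | store a b =>
    obtain ⟨⟨h1, h2, h3⟩, h4⟩ := hw
    exact ⟨1, _, .store s a b (a.val s).toNat (Int.toNat_of_nonneg h1).symm (by omega)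
      (natAbs_le_iff.2 h3), le_rfl, h4⟩
  | seq P P' ih ih' =>
    obtain ⟨t, s', h1, h2, h3⟩ := ih hw
    obtain ⟨t', s'', h4, h5, h6⟩ := ih' h3
    exact ⟨_, _, .seq h1 h4, Nat.add_le_add h2 h5, h6⟩
  | ite b P P' ih ih' =>
    by_cases hb : b.holds s
    · obtain ⟨t, s', h1, h2, h3⟩ := ih (hw.1 hb)
      exact ⟨_, _, .iteTrue hb h1, by simp only [cost]; omega, h3⟩
    · obtain ⟨t, s', h1, h2, h3⟩ := ih' (hw.2 hb)
      exact ⟨_, _, .iteFalse hb h1, by simp only [cost]; omega, h3⟩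
  | loop => exact hw.elim

/-- A loop whose body keeps an invariant and decreases a measure. -/
theorem exec_loop {W : ℕ} {b : Test} {P : Prog} (I : ℕ → State → Prop)
    (h : ∀ m s, I m s → b.holds s → wp W P (fun s' => ∃ m' < m, I m' s') s) {m : ℕ} {s : State}
    (hs : I m s) :
    ∃ t s', Exec W (.loop b P) s t s' ∧ t ≤ (cost P + 1) * m + 1 ∧ ¬ b.holds s' ∧
      ∃ m', I m' s' := by
  induction m using Nat.strong_induction_on generalizing s with
  | _ m ih =>
    by_cases hb : b.holds s
    · obtain ⟨t, s', h1, h2, m', hm, h3⟩ := exec_of_wp (h m s hs hb)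
      obtain ⟨t', s'', h4, h5, h6⟩ := ih m' hm h3
      refine ⟨_, _, .loopTrue hb h1 h4, ?_, h6⟩
      have : (cost P + 1) * (m' + 1) ≤ (cost P + 1) * m := Nat.mul_le_mul_left _ hm
      rw [Nat.mul_add] at this
      omega
    · exact ⟨1, s, .loopFalse hb, by omega, hb, m, hs⟩

section simp_lemmas

variable (s : State) (i j : ℕ) (v w a b : ℤ)

@[simp] theorem reg_setReg : (s.setReg i v).reg j = if j = i then v else s.reg j := by
  simp [State.setReg, Function.update_apply]

@[simp] theorem rd_setReg : (s.setReg i v).rd a = s.rd a := rfl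

@[simp] theorem reg_wr : (s.wr a v).reg j = s.reg j := rfl

theorem rd_wr (ha : 0 ≤ a) (hb : 0 ≤ b) : (s.wr a v).rd b = if b = a then v else s.rd b := by
  simp only [State.rd, State.wr, State.setMem, Function.update_apply]
  congr 1
  rw [eq_iff_iff]
  omega

theorem rd_wr_ne (ha : 0 ≤ a) (hb : 0 ≤ b) (h : b ≠ a) : (s.wr a v).rd b = s.rd b := by
  rw [rd_wr _ _ _ _ ha hb, if_neg h]

@[simp] theorem val_reg : (Operand.reg i).val s = s.reg i := rfl

@[simp] theorem val_const : (Operand.const v).val s = v := rfl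

@[simp] theorem eval_add : Op.add.eval v w = v + w := rfl

@[simp] theorem eval_sub : Op.sub.eval v w = v - w := rfl

@[simp] theorem eval_mul : Op.mul.eval v w = v * w := rfl

@[simp] theorem holds_eq (x y : Operand) : (Test.eq x y).holds s ↔ x.val s = y.val s := Iff.rfl

@[simp] theorem holds_lt (x y : Operand) : (Test.lt x y).holds s ↔ x.val s < y.val s := Iff.rfl

variable {W : ℤ} {P P' : Prog} {l : List Prog} {Q : State → Prop} {x y : Operand} {o : Op}
  {t : Test} {s}

@[simp] theorem wp_block_nil : wp W (block []) Q s ↔ Q s := Iff.rfl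

@[simp] theorem wp_block_cons : wp W (block (P :: l)) Q s ↔ wp W P (wp W (block l) Q) s := Iff.rfl

@[simp] theorem wp_skip : wp W .skip Q s ↔ Q s := Iff.rfl

@[simp] theorem wp_move : wp W (.move i x) Q s ↔ |x.val s| ≤ W ∧ Q (s.setReg i (x.val s)) := Iff.rfl

@[simp] theorem wp_arith : wp W (.arith i o x y) Q s ↔
    |o.eval (x.val s) (y.val s)| ≤ W ∧ Q (s.setReg i (o.eval (x.val s) (y.val s))) := Iff.rfl

@[simp] theorem wp_load : wp W (.load i x) Q s ↔
    (0 ≤ x.val s ∧ x.val s ≤ W) ∧ Q (s.setReg i (s.rd (x.val s))) := Iff.rfl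

@[simp] theorem wp_store : wp W (.store x y) Q s ↔
    (0 ≤ x.val s ∧ x.val s ≤ W ∧ |y.val s| ≤ W) ∧ Q (s.wr (x.val s) (y.val s)) := Iff.rfl

@[simp] theorem wp_ite : wp W (.ite t P P') Q s ↔
    (t.holds s → wp W P Q s) ∧ (¬ t.holds s → wp W P' Q s) := Iff.rfl

end simp_lemmas

end WordRAM

/-! ### Codes of tiles and positions -/

namespace ATAM

/-- The number with leading digit `1` and the given further digits in base `B`. -/
def hashList (B : ℤ) (l : List ℤ) : ℤ := l.foldl (fun h x => h * B + x) 1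

theorem hashList_append (B : ℤ) (l : List ℤ) (x : ℤ) :
    hashList B (l ++ [x]) = hashList B l * B + x := by
  simp [hashList]

/-- The leading digit 1 makes every code positive, so that 0 can stand for an absent tile or glue
and -1 for several tiles. -/
theorem hashList_bounds {B : ℤ} (hB : 0 < B) (l : List ℤ) (hl : ∀ x ∈ l, 0 ≤ x ∧ x < B) :
    0 < hashList B l ∧ hashList B l < 2 * B ^ l.length := by
  induction l using List.reverseRecOn with
  | nil => simp [hashList]
  | append_singleton l x ih =>
    obtain ⟨h1, h2⟩ := ih fun y hy => hl y (by simp [hy])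
    have hx := hl x (by simp)
    rw [hashList_append, List.length_append, List.length_singleton, pow_succ]
    constructor <;> nlinarith

/-- Uniqueness of digits in base `B`; the lengths agree, so the leading 1 plays no role. -/
theorem hashList_inj {B : ℤ} {l l' : List ℤ} (hlen : l.length = l'.length)
    (hl : ∀ x ∈ l, 0 ≤ x ∧ x < B) (hl' : ∀ x ∈ l', 0 ≤ x ∧ x < B)
    (h : hashList B l = hashList B l') : l = l' := by
  -- The fold changes its starting value, so the induction needs arbitrary starting values on both
  -- sides.
  have key : ∀ a b : ℤ, l.foldl (fun h x => h * B + x) a = l'.foldl (fun h x => h * B + x) b →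
      a = b ∧ l = l' := by
    clear h
    induction l generalizing l' with
    | nil =>
      obtain rfl := List.length_eq_zero_iff.1 hlen.symm
      exact fun a b h => ⟨h, rfl⟩
    | cons x l ih =>
      cases l' with
      | nil => simp at hlen
      | cons y l' =>
        intro a b h
        obtain ⟨h1, h2⟩ := ih (l' := l') (by simpa using hlen) (fun z hz => hl z (by simp [hz]))
          (fun z hz => hl' z (by simp [hz])) _ _ h
        have hx := hl x (by simp)
        have hy := hl' y (by simp)
        have hab : a = b := by
          -- Two digits differ by less than `B`, so the multiple of `B` on the left must vanish.
          have : (a - b) * B = y - x := by linarith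
          by_contra hne
          rcases lt_or_gt_of_ne hne with h3 | h3
          · nlinarith
          · nlinarith
        subst hab
        exact ⟨rfl, by rw [h2, (by linarith : x = y)]⟩
  exact (key 1 1 h).2

/-- The two numbers of a glue. -/
def encodeGlue (g : Glue) : List ℤ := [(g.label : ℤ), (g.strength : ℤ)]

theorem encodeTile_eq (t : TileType) : encodeTile t = encodeGlue (t .north) ++
    (encodeGlue (t .east) ++ (encodeGlue (t .south) ++ encodeGlue (t .west))) := rfl

theorem length_encodeTile (t : TileType) : (encodeTile t).length = 8 := rfl

theorem length_encodeGlue (g : Glue) : (encodeGlue g).length = 2 := rfl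

theorem encodeGlue_inj {g g' : Glue} (h : encodeGlue g = encodeGlue g') : g = g' := by
  cases g
  cases g'
  simpa [encodeGlue] using h

theorem encodeTile_inj {t t' : TileType} (h : encodeTile t = encodeTile t') : t = t' := by
  rw [encodeTile_eq, encodeTile_eq] at h
  obtain ⟨h1, h⟩ := List.append_inj h rfl
  obtain ⟨h2, h⟩ := List.append_inj h rfl
  obtain ⟨h3, h4⟩ := List.append_inj h rfl
  funext d
  cases d
  exacts [encodeGlue_inj h1, encodeGlue_inj h2, encodeGlue_inj h3, encodeGlue_inj h4]

/-- All numbers of the tile type are less than `B`. -/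
def TileBound (B : ℤ) (t : TileType) : Prop :=
  ∀ d, ((t d).label : ℤ) < B ∧ ((t d).strength : ℤ) < B

theorem TileBound.glue {B : ℤ} {t : TileType} (h : TileBound B t) (d : Dir) :
    ∀ x ∈ encodeGlue (t d), 0 ≤ x ∧ x < B := by
  have := h d
  simp [encodeGlue, this]

theorem TileBound.tile {B : ℤ} {t : TileType} (h : TileBound B t) :
    ∀ x ∈ encodeTile t, 0 ≤ x ∧ x < B := by
  intro x hx
  rw [encodeTile_eq] at hx
  simp only [List.mem_append] at hx
  obtain hx | hx | hx | hx := hx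
  exacts [h.glue _ x hx, h.glue _ x hx, h.glue _ x hx, h.glue _ x hx]

/-- The code of a tile type. -/
def tileCode (B : ℤ) (t : TileType) : ℤ := hashList B (encodeTile t)

/-- The code of the glue on a side of a tile, `0` if its strength is `0`. -/
def sideCode (B : ℤ) (t : TileType) (d : Dir) : ℤ :=
  if (t d).strength = 0 then 0 else hashList B (encodeGlue (t d))

theorem tileCode_bounds {B : ℤ} (hB : 0 < B) {t : TileType} (h : TileBound B t) :
    0 < tileCode B t ∧ tileCode B t < 2 * B ^ 8 := hashList_bounds hB _ h.tile

theorem sideCode_bounds {B : ℤ} (hB : 0 < B) {t : TileType} (h : TileBound B t) (d : Dir) :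
    0 ≤ sideCode B t d ∧ sideCode B t d < 2 * (B * B) := by
  have := hashList_bounds hB _ (h.glue d)
  rw [length_encodeGlue, pow_two] at this
  unfold sideCode
  split_ifs
  · exact ⟨le_rfl, by positivity⟩
  · exact ⟨this.1.le, this.2⟩

theorem sideCode_ne_zero {B : ℤ} (hB : 0 < B) {t : TileType} (h : TileBound B t) {d : Dir} :
    sideCode B t d ≠ 0 ↔ 0 < (t d).strength := by
  have := hashList_bounds hB _ (h.glue d)
  unfold sideCode
  split_ifs with h0
  · simp [h0]
  · exact iff_of_true this.1.ne' (Nat.pos_of_ne_zero h0)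

theorem tileCode_inj {B : ℤ} {t t' : TileType} (h : TileBound B t) (h' : TileBound B t')
    (e : tileCode B t = tileCode B t') : t = t' :=
  encodeTile_inj (hashList_inj rfl h.tile h'.tile e)

theorem sideCode_eq_iff {B : ℤ} (hB : 0 < B) {t t' : TileType} (h : TileBound B t)
    (h' : TileBound B t') {d d' : Dir} (hs : 0 < (t d).strength) :
    sideCode B t' d' = sideCode B t d ↔ t' d' = t d := by
  constructor
  · intro e
    have h0 := (sideCode_ne_zero hB h).2 hs
    have h0' := (sideCode_ne_zero hB h').1 (e ▸ h0)
    unfold sideCode at e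
    rw [if_neg hs.ne', if_neg h0'.ne'] at e
    exact encodeGlue_inj (hashList_inj rfl (h'.glue d') (h.glue d) e)
  · intro e
    unfold sideCode
    rw [e]

/-- The entry of the table of glues: which tile types of the list have the glue with code `c` on
side `d`. -/
def tableVal (B : ℤ) (l : List TileType) (d : Dir) (c : ℤ) : ℤ :=
  match l.filter fun t => sideCode B t d = c with
  | [] => 0
  | [t] => tileCode B t
  | _ => -1

/-- The new entry depends only on the old entry and the new type, so the table is built in one pass
with constant work per side. -/
theorem tableVal_append (B : ℤ) (hB : 0 < B) (l : List TileType) (hl : ∀ t ∈ l, TileBound B t)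
    (t : TileType) (d : Dir) (c : ℤ) :
    tableVal B (l ++ [t]) d c = if sideCode B t d = c then
      (if tableVal B l d c = 0 then tileCode B t else -1) else tableVal B l d c := by
  unfold tableVal
  rw [List.filter_append]
  have hmem : ∀ u ∈ l.filter fun t => sideCode B t d = c, tileCode B u ≠ 0 := fun u hu =>
    (tileCode_bounds hB (hl u (List.mem_filter.1 hu).1)).1.ne'
  by_cases h : sideCode B t d = c
  · rw [if_pos h, List.filter_cons_of_pos (by simpa using h), List.filter_nil]
    match l.filter fun t => sideCode B t d = c, hmem with
    | [], _ => simp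
    | [u], hmem => simp [hmem u (by simp)]
    | u :: v :: l, _ => simp
  · rw [if_neg h, List.filter_cons_of_neg (by simpa using h), List.filter_nil, List.append_nil]

theorem tableVal_eq_zero {B : ℤ} (hB : 0 < B) {l : List TileType}
    (hl : ∀ t ∈ l, TileBound B t) {d : Dir} {c : ℤ} :
    tableVal B l d c = 0 ↔ ∀ t ∈ l, sideCode B t d ≠ c := by
  have hmem : ∀ u ∈ l.filter fun t => sideCode B t d = c, tileCode B u ≠ 0 := fun u hu =>
    (tileCode_bounds hB (hl u (List.mem_filter.1 hu).1)).1.ne'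
  have : (∀ t ∈ l, sideCode B t d ≠ c) ↔ (l.filter fun t => sideCode B t d = c) = [] := by
    simp [List.filter_eq_nil_iff]
  rw [this]
  unfold tableVal
  match l.filter fun t => sideCode B t d = c, hmem with
  | [], _ => simp
  | [u], hmem => simp [hmem u (by simp)]
  | u :: v :: l, _ => simp

/-- An entry is positive only when exactly one type fits, and codes determine types; equality
therefore says that `u` fits and has no competitor. -/
theorem tableVal_eq_tileCode {B : ℤ} (hB : 0 < B) {l : List TileType} (hn : l.Nodup)
    (hl : ∀ t ∈ l, TileBound B t) {d : Dir} {c : ℤ} {u : TileType} (hu : TileBound B u) :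
    tableVal B l d c = tileCode B u ↔
      (u ∈ l ∧ sideCode B u d = c) ∧ ∀ t ∈ l, sideCode B t d = c → t = u := by
  have hpos := (tileCode_bounds hB hu).1
  have hmem : ∀ t, t ∈ (l.filter fun t => sideCode B t d = c) ↔ t ∈ l ∧ sideCode B t d = c :=
    fun t => by simp
  have hn' := hn.filter fun t => sideCode B t d = c
  have e : ((u ∈ l ∧ sideCode B u d = c) ∧ ∀ t ∈ l, sideCode B t d = c → t = u) ↔
      u ∈ (l.filter fun t => sideCode B t d = c) ∧
      ∀ t ∈ (l.filter fun t => sideCode B t d = c), t = u := by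
    simp only [hmem, and_imp]
  have hb : ∀ t ∈ (l.filter fun t => sideCode B t d = c), TileBound B t := fun t ht =>
    hl t ((hmem t).1 ht).1
  rw [e]
  unfold tableVal
  match l.filter fun t => sideCode B t d = c, hn', hb with
  | [], _, _ => simpa using hpos.ne
  | [v], _, hb =>
    simp only [List.mem_singleton, forall_eq]
    constructor
    · intro h
      have := tileCode_inj (hb v (by simp)) hu h
      exact ⟨this.symm, this⟩
    · rintro ⟨rfl, -⟩
      rfl
  | v :: w :: l, hn', _ =>
    refine iff_of_false (by simp only; omega) ?_
    rintro ⟨-, h⟩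
    have h1 := h v (by simp)
    have h2 := h w (by simp)
    simp [h1, h2] at hn'

/-- The code of the tile of an assembly at a position, `0` if there is none. -/
def codeAt (B : ℤ) : Option TileType → ℤ
  | none => 0
  | some t => tileCode B t

/-- The code of the glue of an assembly at a position and a side, `0` if there is none. -/
def sideAt (B : ℤ) (d : Dir) : Option TileType → ℤ
  | none => 0
  | some t => sideCode B t d

variable {B : ℤ} {α : Assembly}

theorem sideAt_bounds (hB : 0 < B) (hα : ∀ p t, α.tile p = some t → TileBound B t) (p : Pos)
    (d : Dir) : 0 ≤ sideAt B d (α.tile p) ∧ sideAt B d (α.tile p) < 2 * (B * B) := by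
  cases h : α.tile p with
  | none => exact ⟨le_rfl, by simp only [sideAt]; positivity⟩
  | some t => exact sideCode_bounds hB (hα p t h) d

/-- Glues of strength 0 have code 0, so one comparison of codes and one test for 0 detect an
interaction; an empty neighbour also has code 0 and never matches. -/
theorem bond_pos_iff (hB : 0 < B) (hα : ∀ p t, α.tile p = some t → TileBound B t) (p : Pos)
    (d : Dir) : 0 < α.bond p d ↔ sideAt B d (α.tile p) ≠ 0 ∧
      sideAt B d (α.tile p) = sideAt B d.opp (α.tile (p + d.vec)) := by
  rw [Assembly.bond_pos]
  cases h : α.tile p with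
  | none => simp [sideAt]
  | some t =>
    cases h' : α.tile (p + d.vec) with
    | none =>
      refine iff_of_false (by simp) ?_
      rintro ⟨h1, h2⟩
      exact h1 h2
    | some u =>
      simp only [Option.some.injEq, sideAt, sideCode_ne_zero hB (hα _ _ h)]
      constructor
      · rintro ⟨t', u', rfl, rfl, h3, h4⟩
        exact ⟨h4, ((sideCode_eq_iff hB (hα _ _ h) (hα _ _ h') h4).2 h3.symm).symm⟩
      · rintro ⟨h3, h4⟩
        exact ⟨t, u, rfl, rfl, ((sideCode_eq_iff hB (hα _ _ h) (hα _ _ h') h3).1 h4.symm).symm, h3⟩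

variable {T : Finset TileType} {tl : List TileType}

/-- The candidates for the neighbouring position are the types with the matching glue on the
opposite side. All of them agree with `α` only if there are none, or if the one candidate is the
tile present. A vacant position has code 0, so there any candidate is a conflict. -/
theorem conflict_iff (hB : 0 < B) (hα : ∀ p t, α.tile p = some t → TileBound B t)
    (hT : ListsTiles tl T) (htl : ∀ t ∈ tl, TileBound B t) (p : Pos) (d : Dir) :
    α.Conflict T p d ↔ sideAt B d (α.tile p) ≠ 0 ∧
      tableVal B tl d.opp (sideAt B d (α.tile p)) ≠ 0 ∧
      tableVal B tl d.opp (sideAt B d (α.tile p)) ≠ codeAt B (α.tile (p + d.vec)) := by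
  cases h : α.tile p with
  | none => simp [sideAt, Assembly.Conflict, h]
  | some u =>
    simp only [sideAt]
    have e : α.Conflict T p d ↔ 0 < (u d).strength ∧
        ∃ t ∈ tl, sideCode B t d.opp = sideCode B u d ∧ α.tile (p + d.vec) ≠ some t := by
      unfold Assembly.Conflict
      constructor
      · rintro ⟨t, ht, u', hu', h1, h2, h3⟩
        rw [h, Option.some.injEq] at hu'
        subst hu'
        have ht := (hT.2 t).2 ht
        exact ⟨h2, t, ht, (sideCode_eq_iff hB (hα _ _ h) (htl t ht) h2).2 h1.symm, h3⟩
      · rintro ⟨h2, t, ht, h1, h3⟩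
        exact ⟨t, (hT.2 t).1 ht, u, h,
          ((sideCode_eq_iff hB (hα _ _ h) (htl t ht) h2).1 h1).symm, h2, h3⟩
    rw [e, sideCode_ne_zero hB (hα _ _ h)]
    refine and_congr_right fun _ => ?_
    cases h' : α.tile (p + d.vec) with
    | none =>
      simp only [codeAt, and_self]
      rw [Ne, tableVal_eq_zero hB htl]
      push Not
      simp
    | some v =>
      simp only [codeAt]
      rw [Ne, Ne, tableVal_eq_zero hB htl, tableVal_eq_tileCode hB hT.1 htl (hα _ _ h')]
      push Not
      constructor
      · rintro ⟨t, ht, h1, h2⟩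
        exact ⟨⟨t, ht, h1⟩, fun _ => ⟨t, ht, h1, fun e => h2 (by rw [e])⟩⟩
      · rintro ⟨⟨t, ht, h1⟩, h2⟩
        by_cases htv : t = v
        · subst htv
          obtain ⟨t', h3, h4, h5⟩ := h2 ⟨ht, h1⟩
          exact ⟨t', h3, h4, fun e => h5 (Option.some.inj e).symm⟩
        · exact ⟨t, ht, h1, fun e => htv (Option.some.inj e).symm⟩

/-- Along a bond, one comparison checks both that no other type fits and that the tile at the far
end belongs to `T`: this is the test made before a position is entered. -/
theorem tableVal_eq_codeAt_iff (hB : 0 < B) (hα : ∀ p t, α.tile p = some t → TileBound B t)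
    (hT : ListsTiles tl T) (htl : ∀ t ∈ tl, TileBound B t) {p : Pos} {d : Dir}
    (hb : 0 < α.bond p d) :
    tableVal B tl d.opp (sideAt B d (α.tile p)) = codeAt B (α.tile (p + d.vec)) ↔
      ¬ (α.Conflict T p d ∨ ∃ t, α.tile (p + d.vec) = some t ∧ t ∉ T) := by
  have h1 := (bond_pos_iff hB hα p d).1 hb
  obtain ⟨u, v, hu, hv, h3, h4⟩ := Assembly.bond_pos.1 hb
  have hvb := hα _ _ hv
  have hc := tableVal_eq_tileCode hB hT.1 htl (d := d.opp) (c := sideCode B u d) hvb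
  have hpos := (tileCode_bounds hB hvb).1
  have hsc : sideCode B v d.opp = sideCode B u d :=
    (sideCode_eq_iff hB (hα _ _ hu) hvb h4).2 h3.symm
  rw [conflict_iff hB hα hT htl]
  simp only [hu, hv, sideAt, codeAt, Option.some.injEq, exists_eq_left', ← hT.2] at h1 ⊢
  constructor
  · intro e
    have := (hc.1 e).1.1
    rintro (h | h)
    exacts [h.2.2 e, h this]
  · intro h
    by_contra hne
    refine h (or_iff_not_imp_right.2 fun hvT => ⟨h1.1, ?_, hne⟩)
    rw [Ne, tableVal_eq_zero hB htl]
    push Not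
    exact ⟨v, not_not.1 hvT, hsc⟩

/-! Codes of positions. -/

/-- The positions with coordinates of absolute value at most `B`. -/
def InBox (B : ℤ) (p : Pos) : Prop := (-B ≤ p.1 ∧ p.1 ≤ B) ∧ -B ≤ p.2 ∧ p.2 ≤ B

/-- The code of a position. -/
def posCode (B : ℤ) (p : Pos) : ℤ := (p.1 + B) * (4 * B) + (p.2 + B)

/-- The memory address that is used for a position. -/
def node (B L : ℤ) (p : Pos) : ℤ := L + 16 * posCode B p

theorem InBox.posCode_bounds {p : Pos} (h : InBox B p) (hB : 0 < B) :
    0 ≤ posCode B p ∧ posCode B p ≤ 10 * (B * B) := by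
  obtain ⟨⟨h1, h2⟩, h3, h4⟩ := h
  unfold posCode
  constructor <;> nlinarith

/-- Second coordinates in the box differ by at most `2 * B`, which is less than the multiplier `4 *
B` of the first coordinate. -/
theorem InBox.posCode_inj {p q : Pos} (hp : InBox B p) (hq : InBox B q) (hB : 0 < B)
    (h : posCode B p = posCode B q) : p = q := by
  obtain ⟨⟨h1, h2⟩, h3, h4⟩ := hp
  obtain ⟨⟨g1, g2⟩, g3, g4⟩ := hq
  unfold posCode at h
  have hx : p.1 = q.1 := by
    have : (p.1 - q.1) * (4 * B) = q.2 - p.2 := by linarith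
    by_contra hne
    rcases lt_or_gt_of_ne hne with h5 | h5
    · nlinarith
    · nlinarith
  rw [hx] at h
  exact Prod.ext hx (by linarith)

/-- The difference of the addresses of neighbours. -/
def stride (B : ℤ) : Dir → ℤ
  | .north => 16
  | .east => 64 * B
  | .south => -16
  | .west => -(64 * B)

theorem node_add (L : ℤ) (p : Pos) (d : Dir) : node B L (p + d.vec) = node B L p + stride B d := by
  cases d <;> simp only [node, posCode, stride, Dir.vec, Prod.fst_add, Prod.snd_add] <;> ring

/-- The margin of one gives cells of their own to the empty neighbours of tiles as well. -/
theorem InBox.add_vec {B : ℤ} {p : Pos} (h : InBox (B - 1) p) (d : Dir) : InBox B (p + d.vec) := by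
  obtain ⟨⟨h1, h2⟩, h3, h4⟩ := h
  cases d <;>
    exact ⟨⟨by simp [Dir.vec]; omega, by simp [Dir.vec]; omega⟩, by simp [Dir.vec]; omega,
      by simp [Dir.vec]; omega⟩

theorem InBox.mono {B : ℤ} {p : Pos} (h : InBox (B - 1) p) : InBox B p := by
  obtain ⟨⟨h1, h2⟩, h3, h4⟩ := h
  exact ⟨⟨by omega, by omega⟩, by omega, by omega⟩

end ATAM

/-! ### The program: preprocessing -/

namespace WordRAM

open ATAM

/-- Bounds for the input length `L` and the word size `W`, in terms of a number `B` that is larger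
than the input length and all entries of the input. -/
structure Bounds (B L W : ℤ) : Prop where
  L_pos : 0 < L
  L_le : L + 2 ≤ B
  -- The shortest input has `10 + 8 + 10` entries: two lengths and the seed, one tile type, one
  -- placed tile.
  B_ge : 28 ≤ B
  -- The code of a tile type has eight digits after the leading 1.
  pow_le : 2 * B ^ 8 ≤ W
  -- This covers all addresses: codes of positions and of glues are at most `10 * (B * B)`, and they
  -- are multiplied by 16.
  sq_le : 1000 * (B * B) ≤ W

theorem Bounds.B_le {B L W : ℤ} (h : Bounds B L W) : 28 * B ≤ B * B :=
  mul_le_mul_of_nonneg_right h.B_ge (by linarith [h.B_ge])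

/-- The constants that the program keeps in its registers: the base `B` of the codes, the length `L`
of the input, a stride, and the number `N` of placed tiles. -/
structure Consts (B L N : ℤ) (s : State) : Prop where
  reg1 : s.reg 1 = B
  reg2 : s.reg 2 = L
  reg3 : s.reg 3 = 64 * B
  reg4 : s.reg 4 = N

theorem Consts.of_eq {B L N : ℤ} {s s' : State} (h : Consts B L N s)
    (e : ∀ i < 5, s'.reg i = s.reg i) : Consts B L N s' :=
  ⟨(e 1 (by omega)).trans h.1, (e 2 (by omega)).trans h.2, (e 3 (by omega)).trans h.3,
    (e 4 (by omega)).trans h.4⟩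

/-- The list `l` stands in the memory from address `a` on. -/
def Holds (s : State) (a : ℤ) (l : List ℤ) : Prop :=
  ∀ (i : ℕ) (x : ℤ), l[i]? = some x → s.rd (a + i) = x

theorem holds_append {s : State} {a : ℤ} {l l' : List ℤ} :
    Holds s a (l ++ l') ↔ Holds s a l ∧ Holds s (a + l.length) l' := by
  constructor
  · refine fun h => ⟨fun i x hi => h i x ?_, fun i x hi => ?_⟩
    · rw [List.getElem?_append_left (List.getElem?_eq_some_iff.1 hi).1, hi]
    · have := h (l.length + i) x (by rw [List.getElem?_append_right (by omega), ← hi]; congr 1; omega)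
      rw [← this]
      push_cast
      congr 1
      ring
  · rintro ⟨h, h'⟩ i x hi
    by_cases hil : i < l.length
    · rw [List.getElem?_append_left hil] at hi
      exact h i x hi
    · rw [List.getElem?_append_right (by omega)] at hi
      rw [← h' _ _ hi]
      congr 1
      omega

theorem Holds.head {s : State} {a x : ℤ} {l : List ℤ} (h : Holds s a (x :: l)) : s.rd a = x := by
  simpa using h 0 x rfl

theorem Holds.tail {s : State} {a x : ℤ} {l : List ℤ} (h : Holds s a (x :: l)) :
    Holds s (a + 1) l := (holds_append (l := [x]).1 h).2

theorem Holds.congr {s s' : State} {a : ℤ} {l : List ℤ} (h : Holds s a l)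
    (e : ∀ i : ℕ, i < l.length → s'.rd (a + i) = s.rd (a + i)) : Holds s' a l := fun i x hi => by
  rw [e i (List.getElem?_eq_some_iff.1 hi).1, h i x hi]

theorem Holds.glue {s : State} {a : ℤ} {t : TileType} (h : Holds s a (encodeTile t)) {j : ℕ}
    (hj : j < 4) : Holds s (a + 2 * j) (encodeGlue (t (Dir.ofIndex j))) := by
  rw [encodeTile_eq, holds_append, holds_append, holds_append] at h
  simp only [length_encodeGlue] at h
  obtain ⟨h0, h1, h2, h3⟩ := h
  interval_cases j
  · simpa using h0
  · simpa using h1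
  · rw [Dir.ofIndex_two]
    convert h2 using 1
    push_cast
    ring
  · rw [Dir.ofIndex_three]
    convert h3 using 1
    push_cast
    ring

theorem rd_eq_of_mem_eq {s s' : State} (h : s'.mem = s.mem) (a : ℤ) : s'.rd a = s.rd a := by
  rw [State.rd, State.rd, h]

theorem Holds.of_mem_eq {s s' : State} {a : ℤ} {l : List ℤ} (h : Holds s a l)
    (e : s'.mem = s.mem) : Holds s' a l := h.congr fun _ _ => rd_eq_of_mem_eq e _

/-- Register 11 becomes the code of the `n` numbers in the memory from the address in register 10
on. -/
def hashP : ℕ → Prog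
  | 0 => .move 11 (.const 1)
  | n + 1 => block [hashP n, .arith 12 .add (.reg 10) (.const n), .load 12 (.reg 12),
      .arith 11 .mul (.reg 11) (.reg 1), .arith 11 .add (.reg 11) (.reg 12)]

theorem wp_hashP {W B : ℤ} (hB : 0 < B) (l : List ℤ) (hl : ∀ x ∈ l, 0 ≤ x ∧ x < B)
    (hW : 2 * B ^ l.length ≤ W) {s : State} (h1 : s.reg 1 = B) (ha : 0 ≤ s.reg 10)
    (ha' : s.reg 10 + l.length ≤ W) (hs : Holds s (s.reg 10) l) {Q : State → Prop}
    (hQ : ∀ s', s'.mem = s.mem → s'.reg 11 = hashList B l →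
      (∀ i, i ≠ 11 → i ≠ 12 → s'.reg i = s.reg i) → Q s') :
    wp W (hashP l.length) Q s := by
  induction l using List.reverseRecOn generalizing Q with
  | nil =>
    rw [List.length_nil, hashP, wp_move]
    refine ⟨?_, hQ _ rfl (by simp [hashList]) fun i h _ => by simp [h]⟩
    simp only [List.length_nil, pow_zero] at hW
    simp only [val_const, abs_one]
    linarith
  | append_singleton l x ih =>
    have hl' : ∀ y ∈ l, 0 ≤ y ∧ y < B := fun y hy => hl y (by simp [hy])
    have hb := hashList_bounds hB _ hl
    have hb' := hashList_bounds hB _ hl'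
    have hx := hl x (by simp)
    rw [holds_append] at hs
    have hrd := hs.2.head
    rw [hashList_append] at hQ hb
    simp only [List.length_append, List.length_singleton, Nat.cast_add, Nat.cast_one] at *
    have hp : B ^ l.length ≤ B ^ (l.length + 1) := pow_le_pow_right₀ (by linarith) (by omega)
    rw [hashP, wp_block_cons]
    refine ih hl' (by linarith) (by linarith) hs.1 fun s' hm h11 hr => ?_
    have e10 := hr 10 (by decide) (by decide)
    have e1 := hr 1 (by decide) (by decide)
    have hrd' : s'.rd (s.reg 10 + l.length) = x := by rw [rd_eq_of_mem_eq hm, hrd]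
    simp only [wp_block_cons, wp_block_nil, wp_arith, wp_load, val_reg, val_const, eval_add,
      eval_mul, reg_setReg, rd_setReg, Nat.reduceEqDiff,
      OfNat.one_ne_ofNat, ↓reduceIte]
    rw [e10, e1, h11, h1, hrd']
    have hm0 := mul_nonneg hb'.1.le hB.le
    refine ⟨abs_le.2 ⟨by linarith, by linarith⟩, ⟨by linarith, by linarith⟩,
      abs_le.2 ⟨by linarith, by linarith⟩, abs_le.2 ⟨by linarith, by linarith⟩, ?_⟩
    refine hQ _ hm (by simp) fun i h h' => ?_
    simp [h, h', hr i h h']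

/-- Register 11 becomes the code of the glue that stands in the memory at distance `c` from the
address in register 6. -/
def glueP (c : ℕ) : Prog :=
  block [.arith 10 .add (.reg 6) (.const c), hashP 2, .arith 13 .add (.reg 10) (.const 1),
    .load 13 (.reg 13), .ite (.eq (.reg 13) (.const 0)) (.move 11 (.const 0)) .skip]

theorem wp_glueP {B L N W : ℤ} (hb : Bounds B L W) {s : State} (hc : Consts B L N s) {c : ℕ}
    (h6 : 0 ≤ s.reg 6) (h6' : s.reg 6 + c + 2 ≤ L) {t : TileType} (ht : TileBound B t) {d : Dir}
    (hs : Holds s (s.reg 6 + c) (encodeGlue (t d))) {Q : State → Prop}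
    (hQ : ∀ s', s'.mem = s.mem → s'.reg 11 = sideCode B t d →
      (∀ i, i < 10 ∨ 16 ≤ i → s'.reg i = s.reg i) → Q s') :
    wp W (glueP c) Q s := by
  obtain ⟨hL, hLB, hB, hp8, h2⟩ := hb
  have hBB := Bounds.B_le ⟨hL, hLB, hB, hp8, h2⟩
  simp only [glueP, wp_block_cons, wp_arith, val_reg, val_const, eval_add]
  refine ⟨abs_le.2 ⟨by linarith, by linarith⟩, ?_⟩
  refine wp_hashP (B := B) (l := encodeGlue (t d)) (by linarith) (ht.glue d)
    (by rw [length_encodeGlue, pow_two]; nlinarith) (by simp [hc.reg1]) (by simp; linarith)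
    (by simp [length_encodeGlue]; linarith) ?_ fun s' hm h11 hr => ?_
  · simpa using hs.of_mem_eq (s' := s.setReg 10 (s.reg 6 + c)) rfl
  have e10 : s'.reg 10 = s.reg 6 + c := by rw [hr 10 (by decide) (by decide)]; simp
  have hrd : s'.rd (s.reg 6 + c + 1) = (t d).strength := by
    rw [rd_eq_of_mem_eq hm]
    exact hs.tail.head
  simp only [wp_block_cons, wp_block_nil, wp_arith, eval_add, wp_load, wp_ite, holds_eq, wp_move,
    wp_skip, val_reg, val_const, reg_setReg, rd_setReg, if_true]
  rw [e10, hrd]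
  have hm' : s'.mem = s.mem := hm
  have hr' : ∀ i, i < 10 ∨ 16 ≤ i → s'.reg i = s.reg i := fun i hi => by
    rw [hr i (by omega) (by omega), reg_setReg, if_neg (by omega)]
  refine ⟨abs_le.2 ⟨by linarith, by linarith⟩, ⟨by linarith, by linarith⟩, fun h0 => ⟨?_, ?_⟩,
    fun h0 => ?_⟩
  · rw [abs_zero]
    linarith
  · refine hQ _ hm' ?_ fun i hi => ?_
    · have h0 : (t d).strength = 0 := by exact_mod_cast h0
      simp [sideCode, h0]
    · simp [show i ≠ 11 by omega, show i ≠ 13 by omega, hr' i hi]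
  · refine hQ _ hm' ?_ fun i hi => ?_
    · have h0 : (t d).strength ≠ 0 := by exact_mod_cast h0
      simp [sideCode, h0, h11]
    · simp [show i ≠ 13 by omega, hr' i hi]

/-- The table of glues holds the entries for the lists `lst j` of tile types and the sides with
index `j`. -/
def Table (B L : ℤ) (lst : ℕ → List TileType) (s : State) : Prop :=
  ∀ c : ℤ, 0 < c → ∀ j : ℕ, j < 4 → s.rd (L + 16 * c + (12 + j)) =
    tableVal B (lst j) (Dir.ofIndex j) c

/-- The table of glues is updated for side `j` of the tile type that stands in the memory at the
address in register 6 and has its code in register 16. -/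
def sideP (j : ℕ) : Prog :=
  block [glueP (2 * j), .ite (.eq (.reg 11) (.const 0)) .skip
    (block [.arith 14 .mul (.reg 11) (.const 16), .arith 14 .add (.reg 14) (.reg 2),
      .arith 14 .add (.reg 14) (.const (12 + j)), .load 15 (.reg 14),
      .ite (.eq (.reg 15) (.const 0)) (.store (.reg 14) (.reg 16))
        (.store (.reg 14) (.const (-1)))])]

/-- The lists are indexed by the side because, while a tile type is being processed, the tables of
the four sides have absorbed different numbers of types. Only cells of the table are written. -/
theorem wp_sideP {B L N W : ℤ} (hb : Bounds B L W) {s : State} (hc : Consts B L N s) {j : ℕ}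
    (hj : j < 4) (h6 : 0 ≤ s.reg 6) (h6' : s.reg 6 + 8 ≤ L) {t : TileType} (ht : TileBound B t)
    (hs : Holds s (s.reg 6) (encodeTile t)) (h16 : s.reg 16 = tileCode B t)
    {lst : ℕ → List TileType} (hlst : ∀ j, ∀ t ∈ lst j, TileBound B t) (hT : Table B L lst s)
    {Q : State → Prop}
    (hQ : ∀ s', Table B L (Function.update lst j (lst j ++ [t])) s' →
      (∀ x, 0 ≤ x → (∀ c : ℤ, 0 < c → ∀ i : ℕ, i < 4 → x ≠ L + 16 * c + (12 + i)) →
        s'.rd x = s.rd x) →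
      (∀ i, i < 10 ∨ 16 ≤ i → s'.reg i = s.reg i) → Q s') :
    wp W (sideP j) Q s := by
  have hBB := hb.B_le
  obtain ⟨hL, hLB, hB, hp8, h2⟩ := hb
  rw [sideP, wp_block_cons]
  refine wp_glueP (d := Dir.ofIndex j) ⟨hL, hLB, hB, hp8, h2⟩ hc h6 (by push_cast; omega) ht
    (by simpa using hs.glue hj) fun s' hm h11 hr => ?_
  have hB0 : 0 < B := by linarith
  have hcb := sideCode_bounds hB0 ht (Dir.ofIndex j)
  have htb := tileCode_bounds hB0 ht
  set c := sideCode B t (Dir.ofIndex j) with hcdef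
  have hother : ∀ c' : ℤ, 0 < c' → ∀ i < 4, ¬ (c' = c ∧ i = j) →
      tableVal B (Function.update lst j (lst j ++ [t]) i) (Dir.ofIndex i) c' =
        tableVal B (lst i) (Dir.ofIndex i) c' := by
    intro c' _ i _ h
    by_cases hij : i = j
    · subst hij
      rw [Function.update_self, tableVal_append B hB0 _ (hlst i) t, if_neg]
      rw [← hcdef]
      exact fun h' => h ⟨h'.symm, rfl⟩
    · rw [Function.update_of_ne hij]
  have hr2 : s'.reg 2 = L := (hr 2 (by omega)).trans hc.reg2
  have hr16 : s'.reg 16 = tileCode B t := (hr 16 (by omega)).trans h16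
  simp only [wp_block_cons, wp_block_nil, wp_load, wp_ite, holds_eq, wp_arith, wp_store, wp_skip,
    val_reg, val_const, reg_setReg, rd_setReg, eval_add, eval_mul,
    Nat.reduceEqDiff, ↓reduceIte]
  rw [h11, hr2, hr16]
  refine ⟨fun h0 => ?_, fun h0 => ?_⟩
  · refine hQ s' ?_ (fun x _ _ => rd_eq_of_mem_eq hm x) hr
    intro c' hc' i hi
    rw [rd_eq_of_mem_eq hm, hT c' hc' i hi, hother c' hc' i hi (by omega)]
  · have hc0 : 0 < c := by omega
    have hrd : s'.rd (c * 16 + L + (12 + j)) = tableVal B (lst j) (Dir.ofIndex j) c := by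
      rw [rd_eq_of_mem_eq hm, ← hT c hc0 j hj]
      congr 1
      ring
    have htab := tableVal_append B hB0 (lst j) (hlst j) t (Dir.ofIndex j) c
    rw [← hcdef, if_pos rfl] at htab
    have fin : ∀ (s1 : State) (v : ℤ), s1.mem = s'.mem →
        (∀ i, i < 10 ∨ 16 ≤ i → s1.reg i = s'.reg i) →
        v = tableVal B (lst j ++ [t]) (Dir.ofIndex j) c → Q (s1.wr (c * 16 + L + (12 + j)) v) := by
      intro s1 v hm1 hr1 hv
      refine hQ _ ?_ ?_ ?_
      · intro c' hc' i hi
        rw [rd_wr _ _ _ _ (by omega) (by omega)]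
        by_cases hh : c' = c ∧ i = j
        · obtain ⟨rfl, rfl⟩ := hh
          rw [if_pos (by ring), Function.update_self, hv]
        · rw [if_neg (by omega), rd_eq_of_mem_eq hm1, rd_eq_of_mem_eq hm, hT c' hc' i hi,
            hother c' hc' i hi hh]
      · intro x hx hx'
        rw [rd_wr_ne _ _ _ _ (by omega) hx, rd_eq_of_mem_eq hm1, rd_eq_of_mem_eq hm]
        have := hx' c hc0 j hj
        intro e
        exact this (by rw [e]; ring)
      · intro i hi
        rw [reg_wr, hr1 i hi, hr i hi]
    rw [hrd]
    refine ⟨abs_le.2 ⟨by linarith, by linarith⟩, abs_le.2 ⟨by linarith, by linarith⟩,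
      abs_le.2 ⟨by linarith, by omega⟩, ⟨by linarith, by omega⟩, fun h => ⟨⟨by linarith, by omega,
      abs_le.2 ⟨by linarith, by linarith⟩⟩, fin _ _ rfl (fun i hi => ?_) ?_⟩,
      fun h => ⟨⟨by linarith, by omega,
      abs_le.2 ⟨by linarith, by linarith⟩⟩, fin _ _ rfl (fun i hi => ?_) ?_⟩⟩
    · simp [show i ≠ 14 by omega, show i ≠ 15 by omega]
    · rw [htab, if_pos h]
    · simp [show i ≠ 14 by omega, show i ≠ 15 by omega]
    · rw [htab, if_neg h]

/-- The glue table is updated for the tile type in the memory at the address in register 6. -/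
def tileP : Prog :=
  block [.move 10 (.reg 6), hashP 8, .move 16 (.reg 11), sideP 0, sideP 1, sideP 2, sideP 3,
    .arith 6 .add (.reg 6) (.const 8)]

theorem wp_tileP {B L N W : ℤ} (hb : Bounds B L W) {s : State} (hc : Consts B L N s)
    (h6 : 0 ≤ s.reg 6) (h6' : s.reg 6 + 8 ≤ L) {t : TileType} (ht : TileBound B t)
    (hs : Holds s (s.reg 6) (encodeTile t))
    {l : List TileType} (hl : ∀ t ∈ l, TileBound B t) (hT : Table B L (fun _ => l) s)
    {Q : State → Prop}
    (hQ : ∀ s', Table B L (fun _ => l ++ [t]) s' →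
      (∀ x, 0 ≤ x → (∀ c : ℤ, 0 < c → ∀ i : ℕ, i < 4 → x ≠ L + 16 * c + (12 + i)) →
        s'.rd x = s.rd x) →
      (∀ i < 10, i ≠ 6 → s'.reg i = s.reg i) → s'.reg 6 = s.reg 6 + 8 → Q s') :
    wp W tileP Q s := by
  have hBB := hb.B_le
  have hL := hb.L_pos
  have hLB := hb.L_le
  have hB := hb.B_ge
  have hp8 := hb.pow_le
  have h2 := hb.sq_le
  have hB0 : 0 < B := by linarith
  have htb := tileCode_bounds hB0 ht
  rw [tileP, wp_block_cons, wp_move]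
  refine ⟨abs_le.2 ⟨by simp only [val_reg]; linarith, by simp only [val_reg]; linarith⟩, ?_⟩
  rw [wp_block_cons, ← length_encodeTile t]
  refine wp_hashP hB0 _ ht.tile (by rw [length_encodeTile]; exact hp8) (by simp [hc.reg1])
    (by simpa using h6) (by simp [length_encodeTile]; linarith)
    (by simpa using hs.of_mem_eq (s' := s.setReg 10 (s.reg 6)) rfl) fun s' hm h11 hr => ?_
  replace h11 : s'.reg 11 = tileCode B t := h11
  rw [wp_block_cons, wp_move]
  refine ⟨abs_le.2 ⟨?_, ?_⟩, ?_⟩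
  · simp only [val_reg, h11]
    linarith
  · simp only [val_reg, h11]
    linarith
  set s0 := s'.setReg 16 ((Operand.reg 11).val s') with hs0
  have g : ∀ i < 10, s0.reg i = s.reg i := fun i hi => by
    simp [hs0, show i ≠ 16 by omega, hr i (by omega) (by omega), show i ≠ 10 by omega]
  have g16 : s0.reg 16 = tileCode B t := by simp [hs0, h11]
  have gm : s0.mem = s.mem := hm
  clear_value s0
  have hup : ∀ j' (lst : ℕ → List TileType), (∀ j, lst j = l ∨ lst j = l ++ [t]) →
      (lst j' = l) →
      ∀ j, Function.update lst j' (lst j' ++ [t]) j = l ∨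
        Function.update lst j' (lst j' ++ [t]) j = l ++ [t] := by
    intro j' lst h h' j
    by_cases hj : j = j'
    · subst hj
      rw [Function.update_self, h']
      exact .inr rfl
    · rw [Function.update_of_ne hj]
      exact h j
  have hlb : ∀ lst : ℕ → List TileType, (∀ j, lst j = l ∨ lst j = l ++ [t]) →
      ∀ j, ∀ t ∈ lst j, TileBound B t := by
    intro lst h j u hu
    obtain e | e := h j
    · exact hl u (e ▸ hu)
    · rw [e, List.mem_append, List.mem_singleton] at hu
      exact hu.elim (hl u) fun e => e ▸ ht
  -- This packages what the four calls have in common: at each side the list is `l` or `l ++ [t]`,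
  -- and neither the input nor the code in register 16 is disturbed.
  have one : ∀ (s1 : State) (j : ℕ) (lst : ℕ → List TileType) (Q' : State → Prop), j < 4 →
      (∀ j, lst j = l ∨ lst j = l ++ [t]) → Table B L lst s1 →
      (∀ x, 0 ≤ x → (∀ c : ℤ, 0 < c → ∀ i : ℕ, i < 4 → x ≠ L + 16 * c + (12 + i)) →
        s1.rd x = s.rd x) → (∀ i < 10, s1.reg i = s.reg i) → s1.reg 16 = tileCode B t →
      (∀ s', Table B L (Function.update lst j (lst j ++ [t])) s' →
        (∀ x, 0 ≤ x → (∀ c : ℤ, 0 < c → ∀ i : ℕ, i < 4 → x ≠ L + 16 * c + (12 + i)) →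
          s'.rd x = s.rd x) → (∀ i < 10, s'.reg i = s.reg i) → s'.reg 16 = tileCode B t → Q' s') →
      wp W (sideP j) Q' s1 := by
    intro s1 j lst Q' hj hlst hT1 hrd hreg h16 hQ'
    have e6 := hreg 6 (by omega)
    refine wp_sideP hb (hc.of_eq fun i hi => hreg i (by omega)) hj (by rw [e6]; exact h6)
      (by rw [e6]; exact h6') ht ?_ h16 (hlb lst hlst) hT1 fun s2 k1 k2 k3 => ?_
    · rw [e6]
      refine hs.congr fun i hi => hrd _ (by omega) fun c hc i' _ => ?_
      rw [length_encodeTile] at hi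
      omega
    · exact hQ' s2 k1 (fun x hx hx' => (k2 x hx hx').trans (hrd x hx hx'))
        (fun i hi => (k3 i (by omega)).trans (hreg i hi)) ((k3 16 (by omega)).trans h16)
  have T0 : Table B L (fun _ => l) s0 := fun c hc j hj => by
    rw [rd_eq_of_mem_eq gm, hT c hc j hj]
  have hl0 : ∀ j : ℕ, (fun _ : ℕ => l) j = l ∨ (fun _ : ℕ => l) j = l ++ [t] := fun _ => .inl rfl
  rw [wp_block_cons]
  refine one s0 0 _ _ (by omega) hl0 T0 (fun x _ _ => rd_eq_of_mem_eq gm x) g g16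
    fun s1 T1 m1 r1 e1 => ?_
  have hl1 := hup 0 _ hl0 rfl
  rw [wp_block_cons]
  refine one s1 1 _ _ (by omega) hl1 T1 m1 r1 e1 fun s2 T2 m2 r2 e2 => ?_
  have hl2 := hup 1 _ hl1 (by simp)
  rw [wp_block_cons]
  refine one s2 2 _ _ (by omega) hl2 T2 m2 r2 e2 fun s3 T3 m3 r3 e3 => ?_
  have hl3 := hup 2 _ hl2 (by simp)
  rw [wp_block_cons]
  refine one s3 3 _ _ (by omega) hl3 T3 m3 r3 e3 fun s4 T4 m4 r4 e4 => ?_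
  simp only [wp_block_cons, wp_block_nil, wp_arith, val_reg, val_const, eval_add, r4 6 (by omega)]
  refine ⟨abs_le.2 ⟨by linarith, by linarith⟩, hQ _ ?_ m4 (fun i hi hi' => ?_) (by simp)⟩
  · intro c hc j hj
    rw [rd_setReg, T4 c hc j hj]
    congr 1
    interval_cases j <;> simp
  · simp [hi', r4 i hi]

/-- The codes for positions are stored in the memory; `cur j` for `j < 4` are the tiles whose glue
on side `j` has been stored, and `cur 4` those whose code has been stored. -/
def Nodes (B L : ℤ) (cur : ℕ → Pos → Option TileType) (s : State) : Prop :=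
  ∀ p, InBox B p → (∀ j : ℕ, j < 4 → s.rd (node B L p + j) =
    sideAt B (Dir.ofIndex j) (cur j p)) ∧ s.rd (node B L p + 4) = codeAt B (cur 4 p)

/-- The glue code for side `j` of a placed tile is stored. -/
def nodeSideP (j : ℕ) : Prog :=
  block [glueP (2 + 2 * j), .arith 14 .add (.reg 17) (.const j), .store (.reg 14) (.reg 11)]

/-- As with the glue table, `cur` depends on the side because the five cells of a position are
filled one after the other. -/
theorem wp_nodeSideP {B L N W : ℤ} (hb : Bounds B L W) {s : State} (hc : Consts B L N s) {j : ℕ}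
    (hj : j < 4) (h6 : 0 ≤ s.reg 6) (h6' : s.reg 6 + 10 ≤ L) {t : TileType} (ht : TileBound B t)
    (hs : Holds s (s.reg 6 + 2) (encodeTile t)) {p : Pos} (hp : InBox B p)
    (h17 : s.reg 17 = node B L p) {cur : ℕ → Pos → Option TileType} (hN : Nodes B L cur s)
    {Q : State → Prop}
    (hQ : ∀ s', Nodes B L (Function.update cur j (Function.update (cur j) p (some t))) s' →
      (∀ x, 0 ≤ x → (∀ c : ℤ, 0 ≤ c → ∀ i : ℕ, i < 5 → x ≠ L + 16 * c + i) →
        s'.rd x = s.rd x) →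
      (∀ i, i < 10 ∨ 16 ≤ i → s'.reg i = s.reg i) → Q s') :
    wp W (nodeSideP j) Q s := by
  have hBB := hb.B_le
  have hL := hb.L_pos
  have hLB := hb.L_le
  have hB := hb.B_ge
  have h2 := hb.sq_le
  have hB0 : 0 < B := by linarith
  rw [nodeSideP, wp_block_cons]
  refine wp_glueP (d := Dir.ofIndex j) hb hc h6 (by push_cast; omega) ht
    (by convert hs.glue hj using 1; push_cast; ring) fun s' hm h11 hr => ?_
  have hcb := sideCode_bounds hB0 ht (Dir.ofIndex j)
  have hpb := hp.posCode_bounds hB0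
  simp only [wp_block_cons, wp_block_nil, wp_arith, wp_store, val_reg, val_const, eval_add,
    reg_setReg, Nat.reduceEqDiff, ↓reduceIte, hr 17 (by omega), h17, h11]
  have hnode : node B L p = L + 16 * posCode B p := rfl
  refine ⟨abs_le.2 ⟨by omega, by omega⟩, ⟨by omega, by omega, abs_le.2 ⟨by omega, by omega⟩⟩,
    hQ _ ?_ ?_ ?_⟩
  · intro q hq
    have hqb := hq.posCode_bounds hB0
    have hnodeq : node B L q = L + 16 * posCode B q := rfl
    have hpq : posCode B p = posCode B q → q = p := fun e => (hp.posCode_inj hq hB0 e).symm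
    constructor
    · intro i hi
      rw [rd_wr _ _ _ _ (by omega) (by omega)]
      by_cases hij : i = j
      · subst hij
        rw [Function.update_self]
        by_cases hqp : q = p
        · subst hqp
          rw [if_pos rfl, Function.update_self]
          rfl
        · rw [if_neg (fun e => hqp (hpq (by omega))), Function.update_of_ne hqp, rd_setReg,
            rd_eq_of_mem_eq hm]
          exact (hN q hq).1 i hi
      · rw [Function.update_of_ne hij, if_neg (by omega), rd_setReg, rd_eq_of_mem_eq hm]
        exact (hN q hq).1 i hi
    · rw [rd_wr_ne _ _ _ _ (by omega) (by omega) (by omega), rd_setReg, rd_eq_of_mem_eq hm,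
        Function.update_of_ne (by omega)]
      exact (hN q hq).2
  · intro x hx hx'
    have := hx' _ hpb.1 j (by omega)
    rw [rd_wr_ne _ _ _ _ (by omega) hx (by rwa [hnode]), rd_setReg, rd_eq_of_mem_eq hm]
  · intro i hi
    simp [show i ≠ 14 by omega, hr i hi]

/-- The placed tile in the memory at the address in register 6 is processed. -/
def placeP : Prog :=
  block [.load 13 (.reg 6), .arith 13 .add (.reg 13) (.reg 1), .arith 13 .mul (.reg 13) (.reg 3),
    .arith 14 .add (.reg 6) (.const 1), .load 14 (.reg 14), .arith 14 .add (.reg 14) (.reg 1),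
    .arith 14 .mul (.reg 14) (.const 16), .arith 17 .add (.reg 13) (.reg 14),
    .arith 17 .add (.reg 17) (.reg 2), .arith 10 .add (.reg 6) (.const 2), hashP 8,
    .arith 14 .add (.reg 17) (.const 4), .store (.reg 14) (.reg 11), nodeSideP 0, nodeSideP 1,
    nodeSideP 2, nodeSideP 3, .arith 6 .add (.reg 6) (.const 10)]

theorem wp_placeP {B L N W : ℤ} (hb : Bounds B L W) {s : State} (hc : Consts B L N s)
    (h6 : 0 ≤ s.reg 6) (h6' : s.reg 6 + 10 ≤ L) {t : TileType} (ht : TileBound B t) {p : Pos}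
    (hp : InBox B p) (hs : Holds s (s.reg 6) (encodePlacedTile (p, t)))
    {f : Pos → Option TileType} (hN : Nodes B L (fun _ => f) s) {Q : State → Prop}
    (hQ : ∀ s', Nodes B L (fun _ => Function.update f p (some t)) s' →
      (∀ x, 0 ≤ x → (∀ c : ℤ, 0 ≤ c → ∀ i : ℕ, i < 5 → x ≠ L + 16 * c + i) →
        s'.rd x = s.rd x) →
      (∀ i < 10, i ≠ 6 → s'.reg i = s.reg i) → s'.reg 6 = s.reg 6 + 10 → Q s') :
    wp W placeP Q s := by
  have hBB := hb.B_le
  have hL := hb.L_pos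
  have hLB := hb.L_le
  have hB := hb.B_ge
  have hp8 := hb.pow_le
  have h2 := hb.sq_le
  have hB0 : 0 < B := by linarith
  have htb := tileCode_bounds hB0 ht
  have hpb := hp.posCode_bounds hB0
  have hx := hs.head
  have hy := hs.tail.head
  have hs2 : Holds s (s.reg 6 + 2) (encodeTile t) := by
    convert hs.tail.tail using 1
    ring
  simp only at hx hy
  obtain ⟨⟨p1, p2⟩, p3, p4⟩ := hp
  have hp : InBox B p := ⟨⟨p1, p2⟩, p3, p4⟩
  have hm0 : 0 ≤ (p.1 + B) * (64 * B) := mul_nonneg (by linarith) (by linarith)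
  have hm1 : (p.1 + B) * (64 * B) ≤ 128 * (B * B) := by nlinarith
  have hnode : node B L p = L + 16 * posCode B p := rfl
  -- The constant `64 * B` in register 3 is 16 times the multiplier `4 * B` in the code of a
  -- position.
  have hnode' : (p.1 + B) * (64 * B) + (p.2 + B) * 16 + L = node B L p := by
    rw [hnode, posCode]
    ring
  simp only [placeP, wp_block_cons, wp_load, wp_arith, val_reg, val_const, eval_add, eval_mul,
    reg_setReg, rd_setReg, Nat.reduceEqDiff, OfNat.one_ne_ofNat, ↓reduceIte, hc.reg1, hc.reg2,
    hc.reg3, hx, hy, hnode']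
  refine ⟨⟨by omega, by omega⟩, abs_le.2 ⟨by omega, by omega⟩, abs_le.2 ⟨by omega, by omega⟩,
    abs_le.2 ⟨by omega, by omega⟩, ⟨by omega, by omega⟩, abs_le.2 ⟨by omega, by omega⟩,
    abs_le.2 ⟨by omega, by omega⟩, abs_le.2 ⟨by omega, by omega⟩, abs_le.2 ⟨by omega, by omega⟩,
    abs_le.2 ⟨by omega, by omega⟩, ?_⟩
  rw [← length_encodeTile t]
  refine wp_hashP hB0 _ ht.tile (by rw [length_encodeTile]; exact hp8) (by simp [hc.reg1])
    (by simp; linarith) (by simp [length_encodeTile]; linarith)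
    (by simp only [reg_setReg, ↓reduceIte]; exact hs2.of_mem_eq rfl) fun s' hm h11 hr => ?_
  have g17 : s'.reg 17 = node B L p := by
    rw [hr 17 (by omega) (by omega)]
    simp
  have gr : ∀ i < 10, s'.reg i = s.reg i := fun i hi => by
    rw [hr i (by omega) (by omega)]
    simp [show i ≠ 10 by omega, show i ≠ 13 by omega, show i ≠ 14 by omega, show i ≠ 17 by omega]
  have gm : s'.mem = s.mem := hm
  replace h11 : s'.reg 11 = tileCode B t := h11
  simp only [wp_block_cons, wp_arith, wp_store, val_reg, val_const, eval_add, reg_setReg,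
    Nat.reduceEqDiff, ↓reduceIte, g17, h11]
  refine ⟨abs_le.2 ⟨by omega, by omega⟩, ⟨by omega, by omega, abs_le.2 ⟨by omega, by omega⟩⟩, ?_⟩
  set s0 := (s'.setReg 14 (node B L p + 4)).wr (node B L p + 4) (tileCode B t) with hs0
  have r0 : ∀ i < 10, s0.reg i = s.reg i := fun i hi => by
    simp [hs0, show i ≠ 14 by omega, gr i hi]
  have e0 : s0.reg 17 = node B L p := by simp [hs0, g17]
  have m0 : ∀ x, 0 ≤ x → (∀ c : ℤ, 0 ≤ c → ∀ i : ℕ, i < 5 → x ≠ L + 16 * c + i) →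
      s0.rd x = s.rd x := fun x hx hx' => by
    have := hx' _ hpb.1 4 (by omega)
    rw [hs0, rd_wr_ne _ _ _ _ (by omega) hx (by rw [hnode]; exact_mod_cast this), rd_setReg,
      rd_eq_of_mem_eq gm]
  have N0 : Nodes B L (Function.update (fun _ => f) 4 (Function.update f p (some t))) s0 := by
    intro q hq
    have hqb := hq.posCode_bounds hB0
    have hnodeq : node B L q = L + 16 * posCode B q := rfl
    constructor
    · intro i hi
      rw [hs0, rd_wr_ne _ _ _ _ (by omega) (by omega) (by omega), rd_setReg, rd_eq_of_mem_eq gm,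
        Function.update_of_ne (by omega)]
      exact (hN q hq).1 i hi
    · rw [hs0, rd_wr _ _ _ _ (by omega) (by omega), Function.update_self]
      by_cases hqp : q = p
      · subst hqp
        rw [if_pos rfl, Function.update_self]
        rfl
      · rw [if_neg (fun e => hqp (hq.posCode_inj hp hB0 (by omega))), Function.update_of_ne hqp,
          rd_setReg, rd_eq_of_mem_eq gm]
        exact (hN q hq).2
  clear_value s0
  have one : ∀ (s1 : State) (j : ℕ) (cur : ℕ → Pos → Option TileType) (Q' : State → Prop), j < 4 →
      Nodes B L cur s1 →
      (∀ x, 0 ≤ x → (∀ c : ℤ, 0 ≤ c → ∀ i : ℕ, i < 5 → x ≠ L + 16 * c + i) →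
        s1.rd x = s.rd x) → (∀ i < 10, s1.reg i = s.reg i) → s1.reg 17 = node B L p →
      (∀ s', Nodes B L (Function.update cur j (Function.update (cur j) p (some t))) s' →
        (∀ x, 0 ≤ x → (∀ c : ℤ, 0 ≤ c → ∀ i : ℕ, i < 5 → x ≠ L + 16 * c + i) →
          s'.rd x = s.rd x) → (∀ i < 10, s'.reg i = s.reg i) → s'.reg 17 = node B L p → Q' s') →
      wp W (nodeSideP j) Q' s1 := by
    intro s1 j cur Q' hj hN1 hrd hreg h17 hQ'
    have e6 := hreg 6 (by omega)
    refine wp_nodeSideP hb (hc.of_eq fun i hi => hreg i (by omega)) hj (by rw [e6]; exact h6)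
      (by rw [e6]; exact h6') ht ?_ hp h17 hN1 fun s2 k1 k2 k3 => ?_
    · rw [e6]
      refine hs2.congr fun i hi => hrd _ (by omega) fun c hc i' _ => ?_
      rw [length_encodeTile] at hi
      omega
    · exact hQ' s2 k1 (fun x hx hx' => (k2 x hx hx').trans (hrd x hx hx'))
        (fun i hi => (k3 i (by omega)).trans (hreg i hi)) ((k3 17 (by omega)).trans h17)
  refine one s0 0 _ _ (by omega) N0 m0 r0 e0 fun s1 N1 m1 r1 e1 => ?_
  refine one s1 1 _ _ (by omega) N1 m1 r1 e1 fun s2 N2 m2 r2 e2 => ?_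
  refine one s2 2 _ _ (by omega) N2 m2 r2 e2 fun s3 N3 m3 r3 e3 => ?_
  refine one s3 3 _ _ (by omega) N3 m3 r3 e3 fun s4 N4 m4 r4 e4 => ?_
  simp only [wp_block_cons, wp_block_nil, wp_arith, val_reg, val_const, eval_add, r4 6 (by omega)]
  refine ⟨abs_le.2 ⟨by linarith, by linarith⟩, hQ _ ?_ m4 (fun i hi hi' => ?_) (by simp)⟩
  · intro q hq
    refine ⟨fun j hj => ?_, ?_⟩
    · rw [rd_setReg, (N4 q hq).1 j hj]
      congr 1
      interval_cases j <;> simp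
    · rw [rd_setReg, (N4 q hq).2]
      simp
  · simp [hi', r4 i hi]

end WordRAM

/-! ### The program: depth-first search -/

namespace WordRAM

open ATAM

/-- The instance, as far as the search depends on it. -/
structure Context (B L W : ℤ) (α : Assembly) (T : Finset TileType) (tl : List TileType) :
    Prop where
  bounds : Bounds B L W
  assembly : ∀ p t, α.tile p = some t → TileBound B t
  box : ∀ p ∈ α.dom, InBox (B - 1) p
  lists : ListsTiles tl T
  tiles : ∀ t ∈ tl, TileBound B t
  size_le : (α.size : ℤ) ≤ L

/-- The number that represents the status of a position. -/
def markCode (L : ℤ) : Mark → ℤ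
  -- Unvisited positions need no initialisation, since untouched cells hold 0. The mark of a
  -- position on the path is the address of its frame, the only positive kind of mark.
  | .fresh => 0
  | .on i => L + 16 * i
  | .done => -1

/-- The machine is in a state that represents the state `σ` of the search. -/
structure Rep (B L : ℤ) (α : Assembly) (tl : List TileType) (σ : SearchState) (s : State) :
    Prop where
  consts : Consts B L α.size s
  reg6 : s.reg 6 = L + 16 * σ.k
  reg8 : s.reg 8 = σ.cnt
  nodes : Nodes B L (fun _ => α.tile) s
  table : Table B L (fun _ => tl) s
  -- Frame `i` occupies offsets 8 to 11 of block `i`, whose other cells belong to a position and to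
  -- the glue table.
  stk : ∀ i ≤ σ.k, s.rd (L + 16 * i + 8) = node B L (σ.stk i)
  low : ∀ i ≤ σ.k, s.rd (L + 16 * i + 9) = L + 16 * σ.low i
  need : ∀ i ≤ σ.k, s.rd (L + 16 * i + 10) = 1 ↔ σ.need i
  dir : ∀ i ≤ σ.k, s.rd (L + 16 * i + 11) = σ.dir i
  mark : ∀ p, InBox B p → s.rd (node B L p + 5) = markCode L (σ.mark p)
  low_le : ∀ i ≤ σ.k, σ.low i ≤ i

/-- The machine is in a state that represents the result of a step of the search. -/
def Post (B L : ℤ) (α : Assembly) (tl : List TileType) (s : State) : SearchResult → Prop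
  | .cont σ => Rep B L α tl σ s ∧ s.reg 5 = 1
  | .halt b => s.reg 5 = 0 ∧ (s.reg 0 = 1 ∧ b ∨ s.reg 0 = 0 ∧ ¬ b)

theorem node_bounds {B L W : ℤ} (hb : Bounds B L W) {p : Pos} (hp : InBox B p) :
    ∃ c, node B L p = L + 16 * c ∧ 0 ≤ c ∧ c ≤ 10 * (B * B) :=
  ⟨posCode B p, rfl, hp.posCode_bounds (by linarith [hb.B_ge])⟩

theorem node_inj {B L W : ℤ} (hb : Bounds B L W) {p q : Pos} (hp : InBox B p) (hq : InBox B q)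
    (h : node B L p = node B L q) : p = q :=
  hp.posCode_inj hq (by linarith [hb.B_ge]) (by unfold node at h; linarith)

theorem Nodes.congr {B L W : ℤ} (hb : Bounds B L W) {cur : ℕ → Pos → Option TileType}
    {s s' : State} (h : Nodes B L cur s)
    (e : ∀ c : ℤ, 0 ≤ c → ∀ i : ℕ, i < 5 → s'.rd (L + 16 * c + i) = s.rd (L + 16 * c + i)) :
    Nodes B L cur s' := by
  intro p hp
  have hc := hp.posCode_bounds (by linarith [hb.B_ge])
  refine ⟨fun j hj => ?_, ?_⟩
  · rw [← (h p hp).1 j hj]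
    exact e _ hc.1 j (by omega)
  · rw [← (h p hp).2]
    exact e _ hc.1 4 (by omega)

theorem Table.congr {B L : ℤ} {lst : ℕ → List TileType} {s s' : State} (h : Table B L lst s)
    (e : ∀ c : ℤ, 0 < c → ∀ i : ℕ, i < 4 → s'.rd (L + 16 * c + (12 + i)) =
      s.rd (L + 16 * c + (12 + i))) : Table B L lst s' := by
  intro c hc j hj
  rw [← h c hc j hj, e c hc j hj]

/-- The index of the opposite direction. -/
def oppIndex (j : ℕ) : ℕ := if j < 2 then j + 2 else j - 2

theorem oppIndex_lt {j : ℕ} (hj : j < 4) : oppIndex j < 4 := by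
  unfold oppIndex
  split_ifs <;> omega

theorem ofIndex_oppIndex {j : ℕ} (hj : j < 4) :
    Dir.ofIndex (oppIndex j) = (Dir.ofIndex j).opp := by
  interval_cases j <;> rfl

/-- The index of the opposite of the direction with the index in register 21, and the stride of this
direction. -/
def dirP : Prog :=
  .ite (.lt (.reg 21) (.const 2))
    (block [.arith 23 .add (.reg 21) (.const 2),
      .ite (.eq (.reg 21) (.const 0)) (.move 24 (.const 16)) (.move 24 (.reg 3))])
    (block [.arith 23 .sub (.reg 21) (.const 2),
      .ite (.eq (.reg 21) (.const 2)) (.move 24 (.const (-16))) (.arith 24 .sub (.const 0) (.reg 3))])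

theorem wp_dirP {B L N W : ℤ} (hb : Bounds B L W) {s : State} (hc : Consts B L N s) {j : ℕ}
    (hj : j < 4) (h21 : s.reg 21 = j) {Q : State → Prop}
    (hQ : ∀ s', s'.mem = s.mem → s'.reg 23 = (oppIndex j : ℤ) → s'.reg 24 = stride B (Dir.ofIndex j) →
      (∀ i < 23, s'.reg i = s.reg i) → Q s') : wp W dirP Q s := by
  have hBB := hb.B_le
  have hB := hb.B_ge
  have h2 := hb.sq_le
  simp only [dirP, wp_ite, wp_block_cons, wp_block_nil, wp_arith, wp_move, holds_lt, holds_eq,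
    val_reg, val_const, eval_add, eval_sub, reg_setReg, Nat.reduceEqDiff, ↓reduceIte, h21, hc.reg3]
  have fin : ∀ x y : ℤ, x = (oppIndex j : ℤ) → y = stride B (Dir.ofIndex j) →
      Q ((s.setReg 23 x).setReg 24 y) := fun x y hx hy =>
    hQ _ rfl (by simp [hx]) (by simp [hy]) fun i hi => by
      simp [show i ≠ 23 by omega, show i ≠ 24 by omega]
  refine ⟨fun h => ⟨abs_le.2 ⟨by omega, by omega⟩, fun h0 => ⟨abs_le.2 ⟨by omega, by omega⟩,
    fin _ _ ?_ ?_⟩, fun h0 => ⟨abs_le.2 ⟨by omega, by omega⟩, fin _ _ ?_ ?_⟩⟩,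
    fun h => ⟨abs_le.2 ⟨by omega, by omega⟩, fun h0 => ⟨abs_le.2 ⟨by omega, by omega⟩,
    fin _ _ ?_ ?_⟩, fun h0 => ⟨abs_le.2 ⟨by omega, by omega⟩, fin _ _ ?_ ?_⟩⟩⟩
  all_goals interval_cases j <;> simp_all [oppIndex, stride]

/-- The data that are needed to explore a direction. -/
def lookP : Prog :=
  block [.arith 25 .add (.reg 20) (.reg 24),
    .arith 26 .add (.reg 20) (.reg 21), .load 26 (.reg 26),
    .arith 27 .add (.reg 25) (.const 4), .load 27 (.reg 27),
    .arith 28 .add (.reg 25) (.reg 23), .load 28 (.reg 28),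
    .arith 29 .add (.reg 25) (.const 5), .load 29 (.reg 29),
    .arith 30 .mul (.reg 26) (.const 16), .arith 30 .add (.reg 30) (.reg 2),
    .arith 30 .add (.reg 30) (.const 12), .arith 30 .add (.reg 30) (.reg 23), .load 30 (.reg 30),
    .ite (.eq (.reg 26) (.const 0)) (block [.move 31 (.const 0), .move 32 (.const 0)])
      (block [.ite (.eq (.reg 26) (.reg 28)) (.move 31 (.const 1)) (.move 31 (.const 0)),
        .ite (.eq (.reg 30) (.const 0)) (.move 32 (.const 0))
          (.ite (.eq (.reg 30) (.reg 27)) (.move 32 (.const 0)) (.move 32 (.const 1)))])]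

theorem wp_lookP {B L W N : ℤ} {α : Assembly} {T : Finset TileType} {tl : List TileType}
    (hx : Context B L W α T tl) {s : State} (hc : Consts B L N s)
    (hN : Nodes B L (fun _ => α.tile) s) (hT : Table B L (fun _ => tl) s) {p : Pos}
    (hp : p ∈ α.dom) {j : ℕ} (hj : j < 4) (h20 : s.reg 20 = node B L p) (h21 : s.reg 21 = j)
    (h23 : s.reg 23 = (oppIndex j : ℤ)) (h24 : s.reg 24 = stride B (Dir.ofIndex j))
    {Q : State → Prop}
    (hQ : ∀ s', s'.mem = s.mem → (∀ i < 25, s'.reg i = s.reg i) →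
      s'.reg 25 = node B L (p + (Dir.ofIndex j).vec) →
      s'.reg 29 = s.rd (node B L (p + (Dir.ofIndex j).vec) + 5) →
      (s'.reg 31 = 1 ↔ 0 < α.bond p (Dir.ofIndex j)) →
      (s'.reg 32 = 1 ↔ α.Conflict T p (Dir.ofIndex j)) →
      (0 < α.bond p (Dir.ofIndex j) → (s'.reg 30 = s'.reg 27 ↔
        ¬ (α.Conflict T p (Dir.ofIndex j) ∨
          ∃ t, α.tile (p + (Dir.ofIndex j).vec) = some t ∧ t ∉ T))) → Q s') :
    wp W lookP Q s := by
  have hb := hx.bounds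
  have hBB := hb.B_le
  have hL := hb.L_pos
  have hLB := hb.L_le
  have hB := hb.B_ge
  have h2 := hb.sq_le
  have hB0 : 0 < B := by linarith
  have hpb := hx.box p hp
  set w := p + (Dir.ofIndex j).vec with hw
  have hwb : InBox B w := hpb.add_vec _
  obtain ⟨c, hc1, hc2, hc3⟩ := node_bounds hb hpb.mono
  obtain ⟨c', hc1', hc2', hc3'⟩ := node_bounds hb hwb
  have hj' := oppIndex_lt hj
  have hg := (hN p hpb.mono).1 j hj
  have hgb := sideAt_bounds hB0 hx.assembly p (Dir.ofIndex j)
  have hgw := (hN w hwb).1 _ hj'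
  have hcode := (hN w hwb).2
  rw [ofIndex_oppIndex hj] at hgw
  have hnode : node B L p + stride B (Dir.ofIndex j) = node B L w := (node_add L p _).symm
  set g := sideAt B (Dir.ofIndex j) (α.tile p) with hgdef
  simp only [lookP, wp_ite, wp_block_cons, wp_block_nil, wp_arith, wp_load, wp_move, holds_eq,
    val_reg, val_const, eval_add, eval_mul, reg_setReg, rd_setReg, Nat.reduceEqDiff, ↓reduceIte,
    h20, h21, h23, h24, hc.reg2, hnode, hg, hgw, hcode]
  refine ⟨abs_le.2 ⟨by omega, by omega⟩, abs_le.2 ⟨by omega, by omega⟩, ⟨by omega, by omega⟩,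
    abs_le.2 ⟨by omega, by omega⟩, ⟨by omega, by omega⟩, abs_le.2 ⟨by omega, by omega⟩,
    ⟨by omega, by omega⟩, abs_le.2 ⟨by omega, by omega⟩, ⟨by omega, by omega⟩,
    abs_le.2 ⟨by omega, by omega⟩, abs_le.2 ⟨by omega, by omega⟩, abs_le.2 ⟨by omega, by omega⟩,
    abs_le.2 ⟨by omega, by omega⟩, ⟨by omega, by omega⟩, ?_⟩
  have hbond := bond_pos_iff hB0 hx.assembly p (Dir.ofIndex j)
  have hconf := conflict_iff hB0 hx.assembly hx.lists hx.tiles p (Dir.ofIndex j)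
  have hgood := tableVal_eq_codeAt_iff hB0 hx.assembly hx.lists hx.tiles (p := p)
    (d := Dir.ofIndex j)
  rw [← hgdef, ← hw] at hbond hconf hgood
  have hW0 : |(0 : ℤ)| ≤ W := by rw [abs_zero]; linarith
  have hW1 : |(1 : ℤ)| ≤ W := by rw [abs_one]; linarith
  -- A side with code 0 is treated apart: there is no interaction, and `Table` says nothing about
  -- the cell read for code 0.
  refine ⟨fun h0 => ⟨hW0, hW0, hQ _ rfl (fun i hi => ?_) ?_ ?_ ?_ ?_ ?_⟩, fun h0 => ?_⟩
  · simp [show i ≠ 25 by omega, show i ≠ 26 by omega, show i ≠ 27 by omega, show i ≠ 28 by omega,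
      show i ≠ 29 by omega, show i ≠ 30 by omega, show i ≠ 31 by omega, show i ≠ 32 by omega]
  · simp
  · simp
  · rw [hbond]
    simp [h0]
  · rw [hconf]
    simp [h0]
  · intro h
    exact absurd h0 (hbond.1 h).1
  have ht := hT g (by omega) _ hj'
  rw [ofIndex_oppIndex hj] at ht
  have ht' : s.rd (g * 16 + L + 12 + oppIndex j) = tableVal B tl (Dir.ofIndex j).opp g := by
    rw [← ht]
    congr 1
    ring
  rw [ht']
  set r := tableVal B tl (Dir.ofIndex j).opp g with hr
  have fin : ∀ (s1 : State) (x y : ℤ), s1.mem = s.mem → (∀ i < 25, s1.reg i = s.reg i) →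
      s1.reg 25 = node B L w → s1.reg 29 = s.rd (node B L w + 5) →
      s1.reg 30 = r → s1.reg 27 = codeAt B (α.tile w) →
      (x = 1 ↔ g = sideAt B (Dir.ofIndex j).opp (α.tile w)) →
      (y = 1 ↔ r ≠ 0 ∧ r ≠ codeAt B (α.tile w)) → Q ((s1.setReg 31 x).setReg 32 y) := by
    intro s1 x y e1 e2 e3 e4 e5 e6 hx hy
    refine hQ _ e1 (fun i hi => ?_) (by simp [e3]) (by simp [e4]) ?_ ?_ ?_
    · simp [show i ≠ 31 by omega, show i ≠ 32 by omega, e2 i hi]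
    · rw [hbond]
      simp [h0, hx]
    · rw [hconf]
      simp only [reg_setReg, ↓reduceIte, hy]
      exact (and_iff_right h0).symm
    · intro h
      simp only [reg_setReg, Nat.reduceEqDiff, ↓reduceIte, e5, e6]
      exact hgood h
  refine ⟨fun h1 => ⟨hW1, fun h3 => ⟨hW0, fin _ _ _ rfl ?_ ?_ ?_ ?_ ?_ ?_ ?_⟩,
      fun h3 => ⟨fun h4 => ⟨hW0, fin _ _ _ rfl ?_ ?_ ?_ ?_ ?_ ?_ ?_⟩,
        fun h4 => ⟨hW1, fin _ _ _ rfl ?_ ?_ ?_ ?_ ?_ ?_ ?_⟩⟩⟩,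
    fun h1 => ⟨hW0, fun h3 => ⟨hW0, fin _ _ _ rfl ?_ ?_ ?_ ?_ ?_ ?_ ?_⟩,
      fun h3 => ⟨fun h4 => ⟨hW0, fin _ _ _ rfl ?_ ?_ ?_ ?_ ?_ ?_ ?_⟩,
        fun h4 => ⟨hW1, fin _ _ _ rfl ?_ ?_ ?_ ?_ ?_ ?_ ?_⟩⟩⟩⟩
  all_goals first
    | (intro i hi
       simp [show i ≠ 25 by omega, show i ≠ 26 by omega, show i ≠ 27 by omega,
        show i ≠ 28 by omega, show i ≠ 29 by omega, show i ≠ 30 by omega])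
    | (simp only [reg_setReg, Nat.reduceEqDiff, ↓reduceIte]; done)
    | exact iff_of_true rfl h1
    | exact iff_of_false (by norm_num) h1
    | exact iff_of_false (by norm_num) fun h => h.1 h3
    | exact iff_of_false (by norm_num) fun h => h.2 h4
    | exact iff_of_true rfl ⟨h3, h4⟩

/-- The search ends with a negative answer. -/
def rejectP : Prog := block [.move 5 (.const 0), .move 0 (.const 0)]

/-- A new frame is made, at the address in register 6, for the position in register 17. -/
def pushP : Prog :=
  block [.arith 14 .add (.reg 6) (.const 8), .store (.reg 14) (.reg 17),
    .arith 14 .add (.reg 6) (.const 9), .store (.reg 14) (.reg 6),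
    .arith 14 .add (.reg 6) (.const 10), .store (.reg 14) (.const 0),
    .arith 14 .add (.reg 6) (.const 11), .store (.reg 14) (.const 0),
    .arith 14 .add (.reg 17) (.const 5), .store (.reg 14) (.reg 6)]

theorem wp_pushP {W : ℤ} {s : State} {f n : ℤ} (h6 : s.reg 6 = f) (h17 : s.reg 17 = n)
    (hf : 0 ≤ f) (hf' : f + 16 ≤ W) (hn : 0 ≤ n) (hn' : n + 16 ≤ W) {Q : State → Prop}
    (hQ : ∀ s', (∀ x, 0 ≤ x → s'.rd x = if x = n + 5 then f else if x = f + 11 then 0 else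
      if x = f + 10 then 0 else if x = f + 9 then f else if x = f + 8 then n else s.rd x) →
      (∀ i, i ≠ 14 → s'.reg i = s.reg i) → Q s') : wp W pushP Q s := by
  simp only [pushP, wp_block_cons, wp_block_nil, wp_arith, wp_store, val_reg, val_const, eval_add,
    reg_setReg, reg_wr, Nat.reduceEqDiff, ↓reduceIte, h6, h17]
  refine ⟨abs_le.2 ⟨by omega, by omega⟩, ⟨by omega, by omega, abs_le.2 ⟨by omega, by omega⟩⟩,
    abs_le.2 ⟨by omega, by omega⟩, ⟨by omega, by omega, abs_le.2 ⟨by omega, by omega⟩⟩,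
    abs_le.2 ⟨by omega, by omega⟩, ⟨by omega, by omega, abs_le.2 ⟨by omega, by omega⟩⟩,
    abs_le.2 ⟨by omega, by omega⟩, ⟨by omega, by omega, abs_le.2 ⟨by omega, by omega⟩⟩,
    abs_le.2 ⟨by omega, by omega⟩, ⟨by omega, by omega, abs_le.2 ⟨by omega, by omega⟩⟩,
    hQ _ (fun x hx => ?_) fun i hi => by simp [hi]⟩
  rw [rd_wr _ _ _ _ (by omega) hx, rd_setReg, rd_wr _ _ _ _ (by omega) hx, rd_setReg,
    rd_wr _ _ _ _ (by omega) hx, rd_setReg, rd_wr _ _ _ _ (by omega) hx, rd_setReg,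
    rd_wr _ _ _ _ (by omega) hx, rd_setReg]

/-- The search enters the position in register 25. -/
def enterP : Prog :=
  .ite (.eq (.reg 30) (.reg 27))
    (block [.arith 6 .add (.reg 6) (.const 16), .move 17 (.reg 25), pushP,
      .arith 8 .add (.reg 8) (.const 1)])
    rejectP

/-- The least depth in register 22 is updated. -/
def lowP : Prog :=
  .ite (.eq (.reg 31) (.const 1))
    (.ite (.lt (.const 0) (.reg 29))
      (.ite (.lt (.reg 29) (.reg 22)) (.move 22 (.reg 29)) .skip) .skip) .skip

/-- The search proceeds to the next direction. -/
def otherP : Prog :=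
  block [lowP,
    .arith 33 .add (.reg 6) (.const 9), .store (.reg 33) (.reg 22),
    .arith 21 .add (.reg 21) (.const 1),
    .arith 33 .add (.reg 6) (.const 11), .store (.reg 33) (.reg 21),
    .ite (.eq (.reg 32) (.const 1))
      (.ite (.lt (.const 0) (.reg 29))
        -- The mark in register 29 is the address of frame `i`, and `26 = 16 + 10` leads to the
        -- conflict bit of frame `i + 1`.
        (block [.arith 33 .add (.reg 29) (.const 26), .store (.reg 33) (.const 1)]) rejectP)
      .skip]

/-- A direction is explored. -/
def exploreP : Prog :=
  .ite (.eq (.reg 31) (.const 1)) (.ite (.eq (.reg 29) (.const 0)) enterP otherP) otherP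

/-- The search leaves the position at the end of the search path. -/
def leaveP : Prog :=
  block [.arith 35 .add (.reg 20) (.const 5), .store (.reg 35) (.const (-1)),
    -- Frame 0 stands at address `L`, so this tests whether the search path consists of the origin
    -- alone.
    .ite (.eq (.reg 6) (.reg 2))
      (block [.move 5 (.const 0),
        .ite (.eq (.reg 8) (.reg 4)) (.move 0 (.const 1)) (.move 0 (.const 0))])
      (block [.move 6 (.reg 34), .arith 35 .add (.reg 6) (.const 9), .load 36 (.reg 35),
        .ite (.lt (.reg 22) (.reg 36)) (.store (.reg 35) (.reg 22)) .skip])]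

/-- All directions have been explored. -/
def popP : Prog :=
  block [.arith 33 .add (.reg 6) (.const 10), .load 33 (.reg 33),
    .arith 34 .sub (.reg 6) (.const 16),
    .ite (.eq (.reg 33) (.const 1))
      -- Depths are compared through frame addresses: register 34 is the address of the frame at
      -- depth `k - 1`.
      (.ite (.lt (.reg 22) (.reg 34)) rejectP leaveP) leaveP]

/-- One step of the search. -/
def searchP : Prog :=
  block [.arith 20 .add (.reg 6) (.const 8), .load 20 (.reg 20),
    .arith 21 .add (.reg 6) (.const 11), .load 21 (.reg 21),
    .arith 22 .add (.reg 6) (.const 9), .load 22 (.reg 22),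
    .ite (.eq (.reg 21) (.const 4)) popP (block [dirP, lookP, exploreP])]

variable {B L W : ℤ} {α : Assembly} {T : Finset TileType} {tl : List TileType}
  {σ : SearchState} {F : ℕ → Set Pos}

theorem wp_rejectP {s : State} (hW : 0 ≤ W) {Q : State → Prop}
    (hQ : ∀ s', s'.reg 5 = 0 → s'.reg 0 = 0 → Q s') : wp W rejectP Q s := by
  simp only [rejectP, wp_block_cons, wp_block_nil, wp_move, val_const, abs_zero]
  exact ⟨hW, hW, hQ _ (by simp) (by simp)⟩

theorem markCode_eq_zero (hL : 0 < L) (m : Mark) : markCode L m = 0 ↔ m = .fresh := by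
  cases m with
  | fresh => simp [markCode]
  | on i => simp only [markCode, reduceCtorEq, iff_false]; omega
  | done => simp [markCode]

theorem markCode_pos (hL : 0 < L) (m : Mark) : 0 < markCode L m ↔ ∃ i, m = .on i := by
  cases m with
  | fresh => simp [markCode]
  | on i => simp only [markCode, Mark.on.injEq, exists_eq', iff_true]; omega
  | done => simp [markCode]

theorem Rep.of_mem_eq {s s' : State} (h : Rep B L α tl σ s) (hm : s'.mem = s.mem)
    (hr : ∀ i < 10, s'.reg i = s.reg i) : Rep B L α tl σ s' where
  consts := h.consts.of_eq fun i hi => hr i (by omega)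
  reg6 := (hr 6 (by omega)).trans h.reg6
  reg8 := (hr 8 (by omega)).trans h.reg8
  nodes p hp := by simpa only [rd_eq_of_mem_eq hm] using h.nodes p hp
  table c hc j hj := by simpa only [rd_eq_of_mem_eq hm] using h.table c hc j hj
  stk i hi := by simpa only [rd_eq_of_mem_eq hm] using h.stk i hi
  low i hi := by simpa only [rd_eq_of_mem_eq hm] using h.low i hi
  need i hi := by simpa only [rd_eq_of_mem_eq hm] using h.need i hi
  dir i hi := by simpa only [rd_eq_of_mem_eq hm] using h.dir i hi
  mark p hp := by simpa only [rd_eq_of_mem_eq hm] using h.mark p hp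
  low_le := h.low_le

theorem Context.k_le (hx : Context B L W α T tl) (hI : SearchInv α T σ F) : (σ.k : ℤ) + 1 ≤ B := by
  have h1 := hI.k_lt
  have h2 := hx.size_le
  have h3 := hx.bounds.L_le
  omega

theorem Context.stk_mem (hI : SearchInv α T σ F) {i : ℕ}
    (hi : i ≤ σ.k) : σ.stk i ∈ α.dom := by
  obtain ⟨t, -, ht⟩ := hI.tile_mem i hi _ (hI.self_mem i hi)
  simp [Assembly.mem_dom, ht]

end WordRAM

/-! ### The routines of the search carry out the abstract steps. -/

namespace WordRAM

open ATAM

variable {B L W : ℤ} {α : Assembly} {T : Finset TileType} {tl : List TileType}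
  {σ : SearchState} {F : ℕ → Set Pos}

theorem Rep.push {s s' : State} (hx : Context B L W α T tl) (h : Rep B L α tl σ s) {w : Pos}
    (hw : InBox B w)
    (hrd : ∀ x, 0 ≤ x → s'.rd x = if x = node B L w + 5 then L + 16 * (σ.k + 1) else
      if x = L + 16 * (σ.k + 1) + 11 then 0 else if x = L + 16 * (σ.k + 1) + 10 then 0 else
      if x = L + 16 * (σ.k + 1) + 9 then L + 16 * (σ.k + 1) else
      if x = L + 16 * (σ.k + 1) + 8 then node B L w else s.rd x)
    (hc : Consts B L α.size s') (h6 : s'.reg 6 = L + 16 * (σ.k + 1)) (h8 : s'.reg 8 = σ.cnt + 1) :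
    Rep B L α tl (σ.push w) s' := by
  have hb := hx.bounds
  have hL := hb.L_pos
  obtain ⟨c, hc1, hc2, hc3⟩ := node_bounds hb hw
  -- The cells written have offsets 5 and 8 to 11 modulo 16, so the codes of positions and the glue
  -- table are untouched.
  have key : ∀ (a : ℤ) (i : ℕ), 0 ≤ a → (i < 5 ∨ 12 ≤ i) → i < 16 →
      s'.rd (L + 16 * a + i) = s.rd (L + 16 * a + i) := fun a i ha hi hi' => by
    rw [hrd _ (by omega), if_neg (by omega), if_neg (by omega), if_neg (by omega),
      if_neg (by omega), if_neg (by omega)]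
  have frame : ∀ (i j : ℕ), i ≤ σ.k → 8 ≤ j → j < 12 →
      s'.rd (L + 16 * i + j) = s.rd (L + 16 * i + j) := fun i j hi hj hj' => by
    rw [hrd _ (by omega), if_neg (by omega), if_neg (by omega), if_neg (by omega),
      if_neg (by omega), if_neg (by omega)]
  have cases : ∀ i, i ≤ σ.k + 1 → i ≤ σ.k ∨ i = σ.k + 1 := fun i hi => by omega
  constructor
  · exact hc
  · simp only [SearchState.push]
    rw [h6]
    push_cast
    ring
  · simp only [SearchState.push]
    rw [h8]
    push_cast
    ring
  · exact h.nodes.congr hb fun a ha i hi => key a i ha (.inl hi) (by omega)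
  · refine h.table.congr fun a ha i hi => ?_
    have := key a (12 + i) ha.le (.inr (by omega)) (by omega)
    push_cast at this
    exact this
  · intro i hi
    simp only [SearchState.push] at hi ⊢
    obtain hi | rfl := cases i hi
    · rw [Function.update_of_ne (by omega), ← h.stk i hi]
      exact frame i 8 hi (by omega) (by omega)
    · rw [Function.update_self, hrd _ (by omega), if_neg (by omega), if_neg (by omega),
        if_neg (by omega), if_neg (by omega), if_pos (by omega)]
  · intro i hi
    simp only [SearchState.push] at hi ⊢
    obtain hi | rfl := cases i hi
    · rw [Function.update_of_ne (by omega), ← h.low i hi]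
      exact frame i 9 hi (by omega) (by omega)
    · rw [Function.update_self, hrd _ (by omega), if_neg (by omega), if_neg (by omega),
        if_neg (by omega), if_pos (by omega)]
      push_cast
      rfl
  · intro i hi
    simp only [SearchState.push] at hi ⊢
    obtain hi | rfl := cases i hi
    · rw [Function.update_of_ne (by omega), ← h.need i hi]
      exact Eq.congr_left (frame i 10 hi (by omega) (by omega))
    · rw [Function.update_self, hrd _ (by omega), if_neg (by omega), if_neg (by omega),
        if_pos (by omega)]
      simp
  · intro i hi
    simp only [SearchState.push] at hi ⊢
    obtain hi | rfl := cases i hi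
    · rw [Function.update_of_ne (by omega), ← h.dir i hi]
      exact frame i 11 hi (by omega) (by omega)
    · rw [Function.update_self, hrd _ (by omega), if_neg (by omega), if_pos (by omega)]
      simp
  · intro p hp
    simp only [SearchState.push]
    obtain ⟨c', hc1', hc2', hc3'⟩ := node_bounds hb hp
    by_cases hpw : p = w
    · subst hpw
      rw [Function.update_self, hrd _ (by omega), if_pos rfl]
      simp [markCode]
    · rw [Function.update_of_ne hpw, ← h.mark p hp, hrd _ (by omega),
        if_neg fun e => hpw (node_inj hb hp hw (by omega)), if_neg (by omega), if_neg (by omega),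
        if_neg (by omega), if_neg (by omega)]
  · intro i hi
    simp only [SearchState.push] at hi ⊢
    obtain hi | rfl := cases i hi
    · rw [Function.update_of_ne (by omega)]
      exact h.low_le i hi
    · simp

theorem wp_enterP (hx : Context B L W α T tl) (hI : SearchInv α T σ F) {s : State}
    (h : Rep B L α tl σ s) (h5 : s.reg 5 = 1) (hd : σ.dir σ.k < 4)
    (hbd : 0 < α.bond σ.top σ.topDir) (hm : σ.mark σ.next = .fresh)
    (h25 : s.reg 25 = node B L σ.next)
    (hgood : s.reg 30 = s.reg 27 ↔ ¬ (α.Conflict T σ.top σ.topDir ∨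
      ∃ t, α.tile σ.next = some t ∧ t ∉ T)) :
    wp W enterP (fun s' => ∃ r, SearchStep α T σ r ∧ Post B L α tl s' r) s := by
  have hb := hx.bounds
  have hBB := hb.B_le
  have hL := hb.L_pos
  have hLB := hb.L_le
  have hB := hb.B_ge
  have h2 := hb.sq_le
  have hk := hx.k_le hI
  have hwdom : σ.next ∈ α.dom := Assembly.Adj.right_mem ⟨_, rfl, hbd⟩
  have hw : InBox B σ.next := (hx.box _ hwdom).mono
  have hcnt := hI.cnt_lt hwdom hm
  have hsz := hx.size_le
  obtain ⟨c, hc1, hc2, hc3⟩ := node_bounds hb hw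
  simp only [enterP, wp_ite, wp_block_cons, wp_arith, wp_move, holds_eq, val_reg,
    val_const, eval_add, reg_setReg, Nat.reduceEqDiff, ↓reduceIte, h25, h.reg6]
  refine ⟨fun hg => ⟨abs_le.2 ⟨by omega, by omega⟩, abs_le.2 ⟨by omega, by omega⟩, ?_⟩,
    fun hg => wp_rejectP (by omega) fun s' e5 e0 =>
      ⟨_, .pushReject hd hbd hm (not_not.1 fun hc => hg (hgood.2 hc)), e5, .inr ⟨e0, id⟩⟩⟩
  refine wp_pushP (f := L + 16 * (σ.k + 1)) (n := node B L σ.next) (by simp; ring) (by simp)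
    (by omega) (by omega) (by omega) (by omega) fun s' hrd hr => ?_
  have e8 : s'.reg 8 = σ.cnt := by rw [hr 8 (by omega)]; simp [h.reg8]
  simp only [wp_block_cons, wp_block_nil, wp_arith, val_reg, val_const, eval_add, e8]
  refine ⟨abs_le.2 ⟨by omega, by omega⟩, _, .push hd hbd hm fun t ht => ?_,
    h.push hx hw (fun x hx => (rd_setReg _ _ _ _).trans (hrd x hx)) (h.consts.of_eq fun i hi => ?_)
      ?_ (by simp), ?_⟩
  · by_contra htT
    exact hgood.1 hg (.inr ⟨t, ht, htT⟩)
  · simp [show i ≠ 8 by omega, hr i (by omega), show i ≠ 6 by omega, show i ≠ 17 by omega]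
  · simp [hr 6 (by omega)]
    ring
  · simp [hr 5 (by omega), h5]

/-- Low points are stored as frame addresses, like the marks of path vertices, so comparing these
numbers compares depths. -/
theorem wp_lowP {s : State} (hL : 0 < L) {b : Prop} {m : Mark} {l : ℕ} (h31 : s.reg 31 = 1 ↔ b)
    (h29 : s.reg 29 = markCode L m) (h22 : s.reg 22 = L + 16 * l) (hl : L + 16 * l ≤ W)
    {Q : State → Prop}
    (hQ : ∀ s' l', s'.mem = s.mem → (∀ i, i ≠ 22 → s'.reg i = s.reg i) →
      s'.reg 22 = L + 16 * (l' : ℕ) → l' ≤ l → (∀ i, b → m = .on i → l' ≤ i) →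
      (l' = l ∨ b ∧ m = .on l') → Q s') : wp W lowP Q s := by
  simp only [lowP, wp_ite, wp_move, wp_skip, holds_eq, holds_lt, val_reg, val_const, h31, h29, h22,
    markCode_pos hL]
  refine ⟨fun hb => ⟨fun ⟨i, hi⟩ => ⟨fun hlt => ?_, fun hlt => ?_⟩, fun hi => ?_⟩, fun hb => ?_⟩
  · rw [hi, markCode] at hlt ⊢
    refine ⟨abs_le.2 ⟨by omega, by omega⟩, hQ _ i rfl (fun j hj => by simp [hj]) (by simp)
      (by omega) (fun j _ hj => ?_) (.inr ⟨hb, hi⟩)⟩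
    rw [hi, Mark.on.injEq] at hj
    exact hj.le
  · rw [hi, markCode] at hlt
    refine hQ s l rfl (fun _ _ => rfl) h22 le_rfl (fun j _ hj => ?_) (.inl rfl)
    rw [hi, Mark.on.injEq] at hj
    omega
  · exact hQ s l rfl (fun _ _ => rfl) h22 le_rfl (fun j _ hj => absurd ⟨j, hj⟩ hi) (.inl rfl)
  · exact hQ s l rfl (fun _ _ => rfl) h22 le_rfl (fun j hb' _ => absurd hb' hb) (.inl rfl)

theorem Rep.advance {s s' : State} (hx : Context B L W α T tl) (h : Rep B L α tl σ s) {l : ℕ}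
    (hl : l ≤ σ.low σ.k) {need' : ℕ → Prop}
    (hrd : ∀ x, 0 ≤ x → (∀ i : ℕ, x ≠ L + 16 * i + 10) →
      s'.rd x = if x = L + 16 * σ.k + 11 then (σ.dir σ.k : ℤ) + 1 else
        if x = L + 16 * σ.k + 9 then L + 16 * (l : ℤ) else s.rd x)
    (hn : ∀ i ≤ σ.k, s'.rd (L + 16 * i + 10) = 1 ↔ need' i)
    (hr : ∀ i < 10, s'.reg i = s.reg i) :
    Rep B L α tl (σ.advance need' l) s' := by
  have hb := hx.bounds
  have hL := hb.L_pos
  have key : ∀ (a : ℤ) (i : ℕ), 0 ≤ a → (i < 9 ∨ 12 ≤ i) → i < 16 →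
      s'.rd (L + 16 * a + i) = s.rd (L + 16 * a + i) := fun a i ha hi hi' => by
    rw [hrd _ (by omega) (by omega), if_neg (by omega), if_neg (by omega)]
  constructor
  · exact h.consts.of_eq fun i hi => hr i (by omega)
  · exact (hr 6 (by omega)).trans h.reg6
  · exact (hr 8 (by omega)).trans h.reg8
  · exact h.nodes.congr hb fun a ha i hi => key a i ha (by omega) (by omega)
  · refine h.table.congr fun a ha i hi => ?_
    have := key a (12 + i) ha.le (.inr (by omega)) (by omega)
    push_cast at this
    exact this
  · intro i hi
    exact (key i 8 (by omega) (by omega) (by omega)).trans (h.stk i hi)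
  · intro i hi
    simp only [SearchState.advance] at hi ⊢
    rw [hrd _ (by omega) (by omega), if_neg (by omega)]
    by_cases hik : i = σ.k
    · subst hik
      rw [if_pos rfl, Function.update_self]
    · rw [if_neg (by omega), Function.update_of_ne hik, h.low i hi]
  · exact hn
  · intro i hi
    simp only [SearchState.advance] at hi ⊢
    rw [hrd _ (by omega) (by omega)]
    by_cases hik : i = σ.k
    · subst hik
      rw [if_pos rfl, Function.update_self]
      push_cast
      rfl
    · rw [if_neg (by omega), if_neg (by omega), Function.update_of_ne hik, h.dir i hi]
  · intro p hp
    have hc := hp.posCode_bounds (by linarith [hb.B_ge])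
    exact (key _ 5 hc.1 (by omega) (by omega)).trans (h.mark p hp)
  · intro i hi
    simp only [SearchState.advance] at hi ⊢
    by_cases hik : i = σ.k
    · subst hik
      rw [Function.update_self]
      exact hl.trans (h.low_le _ hi)
    · rw [Function.update_of_ne hik]
      exact h.low_le i hi

theorem wp_otherP (hx : Context B L W α T tl) (hI : SearchInv α T σ F) {s : State}
    (h : Rep B L α tl σ s) (h5 : s.reg 5 = 1) (hd : σ.dir σ.k < 4)
    (hbm : 0 < α.bond σ.top σ.topDir → σ.mark σ.next ≠ .fresh)
    (h21 : s.reg 21 = σ.dir σ.k) (h22 : s.reg 22 = L + 16 * σ.low σ.k)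
    (h29 : s.reg 29 = markCode L (σ.mark σ.next))
    (h31 : s.reg 31 = 1 ↔ 0 < α.bond σ.top σ.topDir)
    (h32 : s.reg 32 = 1 ↔ α.Conflict T σ.top σ.topDir) :
    wp W otherP (fun s' => ∃ r, SearchStep α T σ r ∧ Post B L α tl s' r) s := by
  have hb := hx.bounds
  have hBB := hb.B_le
  have hL := hb.L_pos
  have hLB := hb.L_le
  have hB := hb.B_ge
  have h2 := hb.sq_le
  have hk := hx.k_le hI
  have hlk := h.low_le _ le_rfl
  rw [otherP, wp_block_cons]
  refine wp_lowP hL h31 h29 h22 (by omega) fun s1 l hm1 hr1 e22 hl hl' hl'' => ?_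
  simp only [wp_block_cons, wp_block_nil, wp_arith, wp_store, wp_ite, wp_skip, holds_eq, holds_lt,
    val_reg, val_const, eval_add, reg_setReg, reg_wr, Nat.reduceEqDiff, ↓reduceIte, e22,
    hr1 6 (by omega), hr1 21 (by omega), hr1 29 (by omega), hr1 32 (by omega), h.reg6, h21, h29,
    h32, markCode_pos hL]
  refine ⟨abs_le.2 ⟨by omega, by omega⟩, ⟨by omega, by omega, abs_le.2 ⟨by omega, by omega⟩⟩,
    abs_le.2 ⟨by omega, by omega⟩, abs_le.2 ⟨by omega, by omega⟩,
    ⟨by omega, by omega, abs_le.2 ⟨by omega, by omega⟩⟩, ?_⟩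
  set s2 := (((((s1.setReg 33 (L + 16 * σ.k + 9)).wr (L + 16 * σ.k + 9) (L + 16 * l)).setReg 21
    (σ.dir σ.k + 1)).setReg 33 (L + 16 * σ.k + 11)).wr (L + 16 * σ.k + 11) (σ.dir σ.k + 1))
    with hs2
  have hrd2 : ∀ x, 0 ≤ x → s2.rd x = if x = L + 16 * σ.k + 11 then (σ.dir σ.k : ℤ) + 1 else
      if x = L + 16 * σ.k + 9 then L + 16 * (l : ℤ) else s.rd x := fun x hx => by
    rw [hs2, rd_wr _ _ _ _ (by omega) hx, rd_setReg, rd_setReg, rd_wr _ _ _ _ (by omega) hx,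
      rd_setReg, rd_eq_of_mem_eq hm1]
  have hr2 : ∀ i < 10, s2.reg i = s.reg i := fun i hi => by
    simp [hs2, show i ≠ 33 by omega, show i ≠ 21 by omega, hr1 i (by omega)]
  clear_value s2
  have hneed : ∀ i : ℕ, s2.rd (L + 16 * i + 10) = s.rd (L + 16 * i + 10) := fun i => by
    rw [hrd2 _ (by omega), if_neg (by omega), if_neg (by omega)]
  refine ⟨fun hc => ⟨fun ⟨i, hi⟩ => ?_, fun hno => ?_⟩, fun hc => ?_⟩
  -- The conflict is with a vertex of the path: besides the low point and the direction, the
  -- conflict bit of the next frame is set.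
  · have hik := (hI.stk_mark _ _ hi).1
    rw [hi, markCode]
    refine ⟨abs_le.2 ⟨by omega, by omega⟩,
      ⟨by omega, by omega, by rw [abs_one]; omega⟩, _, .advance hd hbm
        (fun j => σ.need j ∨ j = i + 1) l (fun _ => ⟨i, hi, .inr rfl⟩)
        (fun j hj => hj.imp_right fun e => ⟨hc, i, hi, e⟩) (fun j hj => .inl hj) hl hl' hl'',
      h.advance hx hl (fun x hx hx' => ?_) (fun j hj => ?_) (fun j hj => ?_), ?_⟩
    · have := hx' (i + 1)
      push_cast at this
      rw [rd_wr_ne _ _ _ _ (by omega) hx (by omega), rd_setReg, hrd2 x hx]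
    · rw [rd_wr _ _ _ _ (by omega) (by omega), rd_setReg, hneed, ← h.need j hj]
      by_cases hji : j = i + 1
      · subst hji
        rw [if_pos (by push_cast; ring)]
        simp
      · rw [if_neg (by omega)]
        simp [hji]
    · simp [show j ≠ 33 by omega, hr2 j hj]
    · simp [hr2 5 (by omega), h5]
  · exact wp_rejectP (by omega) fun s' e5 e0 =>
      ⟨_, .conflictReject hd hc fun i hi => hno ⟨i, hi⟩, e5, .inr ⟨e0, id⟩⟩
  · refine ⟨_, .advance hd hbm σ.need l (fun hc' => absurd hc' hc) (fun _ hj => .inl hj)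
      (fun _ hj => hj) hl hl' hl'', h.advance hx hl (fun x hx _ => hrd2 x hx) (fun j hj => ?_) hr2,
      (hr2 5 (by omega)).trans h5⟩
    rw [hneed, h.need j hj]

theorem Rep.pop {s s' : State} (hx : Context B L W α T tl) (h : Rep B L α tl σ s)
    (hI : SearchInv α T σ F) {k' : ℕ} (hk : σ.k = k' + 1)
    (hrd : ∀ x, 0 ≤ x → s'.rd x = if x = L + 16 * k' + 9 then
        L + 16 * (min (σ.low k') (σ.low (k' + 1)) : ℕ) else
      if x = node B L σ.top + 5 then -1 else s.rd x)
    (hc : Consts B L α.size s') (h6 : s'.reg 6 = L + 16 * k') (h8 : s'.reg 8 = σ.cnt) :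
    Rep B L α tl (σ.pop k') s' := by
  have hb := hx.bounds
  have hL := hb.L_pos
  have htop : InBox B σ.top := (hx.box _ (Context.stk_mem hI le_rfl)).mono
  obtain ⟨c, hc1, hc2, hc3⟩ := node_bounds hb htop
  have key : ∀ (a : ℤ) (i : ℕ), 0 ≤ a → i ≠ 5 → i ≠ 9 → i < 16 →
      s'.rd (L + 16 * a + i) = s.rd (L + 16 * a + i) := fun a i ha hi hi' hi'' => by
    rw [hrd _ (by omega), if_neg (by omega), if_neg (by omega)]
  have hle : ∀ i, i ≤ (σ.pop k').k → i ≤ σ.k := fun i hi => by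
    have : i ≤ k' := hi
    omega
  have hmin : min (σ.low k') (σ.low (k' + 1)) ≤ k' :=
    (min_le_left _ _).trans (h.low_le k' (by omega))
  constructor
  · exact hc
  · exact h6
  · exact h8
  · exact h.nodes.congr hb fun a ha i hi => by
      by_cases hi5 : i < 5
      · exact key a i ha (by omega) (by omega) (by omega)
      · omega
  · refine h.table.congr fun a ha i hi => ?_
    have := key a (12 + i) ha.le (by omega) (by omega) (by omega)
    push_cast at this
    exact this
  · intro i hi
    exact (key i 8 (by omega) (by omega) (by omega) (by omega)).trans (h.stk i (hle i hi))
  · intro i hi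
    have hi' := hle i hi
    simp only [SearchState.pop]
    rw [hrd _ (by omega)]
    by_cases hik : i = k'
    · subst hik
      rw [if_pos rfl, Function.update_self]
    · rw [if_neg (by omega), if_neg (by omega), Function.update_of_ne hik, h.low i hi']
  · intro i hi
    have := key i 10 (by omega) (by omega) (by omega) (by omega)
    exact (Eq.congr_left this).trans (h.need i (hle i hi))
  · intro i hi
    exact (key i 11 (by omega) (by omega) (by omega) (by omega)).trans (h.dir i (hle i hi))
  · intro p hp
    simp only [SearchState.pop]
    obtain ⟨c', hc1', hc2', hc3'⟩ := node_bounds hb hp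
    rw [hrd _ (by omega), if_neg (by omega), ← hk]
    change _ = markCode L (Function.update σ.mark σ.top .done p)
    by_cases hpw : p = σ.top
    · subst hpw
      rw [Function.update_self, if_pos rfl]
      rfl
    · rw [Function.update_of_ne hpw, ← h.mark p hp,
        if_neg fun e => hpw (node_inj hb hp htop (by omega))]
  · intro i hi
    simp only [SearchState.pop]
    by_cases hik : i = k'
    · subst hik
      rw [Function.update_self]
      exact hmin
    · rw [Function.update_of_ne hik]
      exact h.low_le i (hle i hi)

theorem wp_leaveP (hx : Context B L W α T tl) (hI : SearchInv α T σ F) {s : State}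
    (h : Rep B L α tl σ s) (h5 : s.reg 5 = 1) (hd : σ.dir σ.k = 4)
    (hn : ¬ (σ.need σ.k ∧ σ.low σ.k + 1 < σ.k)) (h20 : s.reg 20 = node B L σ.top)
    (h22 : s.reg 22 = L + 16 * σ.low σ.k) (h34 : s.reg 34 = L + 16 * σ.k - 16) :
    wp W leaveP (fun s' => ∃ r, SearchStep α T σ r ∧ Post B L α tl s' r) s := by
  have hb := hx.bounds
  have hBB := hb.B_le
  have hL := hb.L_pos
  have hLB := hb.L_le
  have hB := hb.B_ge
  have h2 := hb.sq_le
  have hk := hx.k_le hI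
  have hlk := h.low_le _ le_rfl
  have htop : InBox B σ.top := (hx.box _ (Context.stk_mem hI le_rfl)).mono
  obtain ⟨c, hc1, hc2, hc3⟩ := node_bounds hb htop
  have hW1 : |(1 : ℤ)| ≤ W := by rw [abs_one]; linarith
  have hW0 : |(0 : ℤ)| ≤ W := by rw [abs_zero]; linarith
  simp only [leaveP, wp_block_cons, wp_block_nil, wp_arith, wp_store, wp_load, wp_move, wp_ite,
    wp_skip, holds_eq, holds_lt, val_reg, val_const, eval_add, reg_setReg, rd_setReg, reg_wr,
    Nat.reduceEqDiff, ↓reduceIte, h.reg6, h.reg8, h20, h22, h34, h.consts.reg2,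
    h.consts.reg4]
  refine ⟨abs_le.2 ⟨by omega, by omega⟩,
    ⟨by omega, by omega, abs_le.2 ⟨by omega, by omega⟩⟩, fun h0 => ⟨hW0, fun hc => ⟨hW1, _,
      .finish hd (by omega), by simp, .inl ⟨by simp, by exact_mod_cast hc⟩⟩, fun hc => ⟨hW0, _,
      .finish hd (by omega), by simp, .inr ⟨by simp, by exact_mod_cast hc⟩⟩⟩, fun h0 => ?_⟩
  -- The frame is not the one at address `L`, so a parent exists; its low point is lowered to that
  -- of the child if the latter is smaller.
  obtain ⟨k', hk'⟩ : ∃ k', σ.k = k' + 1 := ⟨σ.k - 1, by omega⟩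
  have ek : L + 16 * (σ.k : ℤ) - 16 = L + 16 * k' := by rw [hk']; push_cast; ring
  rw [ek]
  have hlk' := h.low_le k' (by omega)
  have elow : ((s.setReg 35 (node B L σ.top + 5)).wr (node B L σ.top + 5) (-1)).rd
      (L + 16 * k' + 9) = L + 16 * σ.low k' := by
    rw [rd_wr_ne _ _ _ _ (by omega) (by omega) (by omega), rd_setReg, h.low k' (by omega)]
  rw [elow]
  refine ⟨abs_le.2 ⟨by omega, by omega⟩, abs_le.2 ⟨by omega, by omega⟩, ⟨by omega, by omega⟩,
    fun hlt => ⟨⟨by omega, by omega, abs_le.2 ⟨by omega, by omega⟩⟩, _, .pop hd hn k' hk',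
      h.pop hx hI hk' (fun x hx => ?_) (h.consts.of_eq fun i hi => ?_) ?_ ?_, ?_⟩,
    fun hlt => ⟨_, .pop hd hn k' hk', h.pop hx hI hk' (fun x hx => ?_)
      (h.consts.of_eq fun i hi => ?_) ?_ ?_, ?_⟩⟩
  · rw [hk'] at hlt ⊢
    rw [rd_wr _ _ _ _ (by omega) hx, rd_setReg, rd_setReg, rd_setReg,
      rd_wr _ _ _ _ (by omega) hx, rd_setReg, min_eq_right (by omega)]
  · simp [show i ≠ 36 by omega, show i ≠ 35 by omega, show i ≠ 6 by omega]
  · simp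
  · simp [h.reg8]
  · simp [h5]
  · rw [hk'] at hlt
    rw [rd_setReg, rd_setReg, rd_setReg,
      rd_wr _ _ _ _ (by omega) hx, rd_setReg, min_eq_left (by omega)]
    by_cases hx9 : x = L + 16 * k' + 9
    · rw [if_pos hx9, hx9, if_neg (by omega), h.low k' (by omega)]
    · rw [if_neg hx9]
  · simp [show i ≠ 36 by omega, show i ≠ 35 by omega, show i ≠ 6 by omega]
  · simp
  · simp [h.reg8]
  · simp [h5]

theorem wp_popP (hx : Context B L W α T tl) (hI : SearchInv α T σ F) {s : State}
    (h : Rep B L α tl σ s) (h5 : s.reg 5 = 1) (hd : σ.dir σ.k = 4)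
    (h20 : s.reg 20 = node B L σ.top) (h22 : s.reg 22 = L + 16 * σ.low σ.k) :
    wp W popP (fun s' => ∃ r, SearchStep α T σ r ∧ Post B L α tl s' r) s := by
  have hb := hx.bounds
  have hBB := hb.B_le
  have hL := hb.L_pos
  have hLB := hb.L_le
  have hB := hb.B_ge
  have h2 := hb.sq_le
  have hk := hx.k_le hI
  simp only [popP, wp_block_cons, wp_arith, wp_load, wp_ite, holds_eq, holds_lt,
    val_reg, val_const, eval_add, eval_sub, reg_setReg, rd_setReg, Nat.reduceEqDiff, ↓reduceIte,
    h.reg6, h22, h.need _ le_rfl]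
  have hleave : ¬ (σ.need σ.k ∧ σ.low σ.k + 1 < σ.k) →
      ∀ x y, wp W leaveP (fun s' => ∃ r, SearchStep α T σ r ∧ Post B L α tl s' r)
        (((s.setReg 33 x).setReg 33 y).setReg 34 (L + 16 * σ.k - 16)) := fun hn x y => by
    refine wp_leaveP hx hI (h.of_mem_eq rfl fun i hi => ?_) (by simp [h5]) hd hn (by simp [h20])
      (by simp [h22]) (by simp)
    simp [show i ≠ 33 by omega, show i ≠ 34 by omega]
  refine ⟨abs_le.2 ⟨by omega, by omega⟩, ⟨by omega, by omega⟩, abs_le.2 ⟨by omega, by omega⟩,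
    fun hn => ⟨fun hl => wp_rejectP (by omega) fun s' e5 e0 =>
      ⟨_, .popReject hd hn (by omega), e5, .inr ⟨e0, id⟩⟩,
      fun hl => hleave (fun hh => hl (by omega)) _ _⟩, fun hn => hleave (fun hh => hn hh.1) _ _⟩

theorem wp_searchP (hx : Context B L W α T tl) (hI : SearchInv α T σ F) {s : State}
    (h : Rep B L α tl σ s) (h5 : s.reg 5 = 1) :
    wp W searchP (fun s' => ∃ r, SearchStep α T σ r ∧ Post B L α tl s' r) s := by
  have hb := hx.bounds
  have hBB := hb.B_le
  have hL := hb.L_pos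
  have hLB := hb.L_le
  have hB := hb.B_ge
  have h2 := hb.sq_le
  have hk := hx.k_le hI
  have htopdom : σ.top ∈ α.dom := Context.stk_mem hI le_rfl
  have hnext : InBox B σ.next := (hx.box _ htopdom).add_vec _
  simp only [searchP, wp_block_cons, wp_arith, wp_load, wp_ite, holds_eq,
    val_reg, val_const, eval_add, reg_setReg, rd_setReg, Nat.reduceEqDiff, ↓reduceIte,
    h.reg6, h.stk _ le_rfl, h.low _ le_rfl, h.dir _ le_rfl]
  refine ⟨abs_le.2 ⟨by omega, by omega⟩, ⟨by omega, by omega⟩, abs_le.2 ⟨by omega, by omega⟩,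
    ⟨by omega, by omega⟩, abs_le.2 ⟨by omega, by omega⟩, ⟨by omega, by omega⟩, ?_⟩
  set s0 := (((((s.setReg 20 (L + 16 * σ.k + 8)).setReg 20 (node B L (σ.stk σ.k))).setReg 21
    (L + 16 * σ.k + 11)).setReg 21 (σ.dir σ.k)).setReg 22 (L + 16 * σ.k + 9)).setReg 22
    (L + 16 * σ.low σ.k) with hs0
  have r0 : ∀ i < 10, s0.reg i = s.reg i := fun i hi => by
    simp [hs0, show i ≠ 20 by omega, show i ≠ 21 by omega, show i ≠ 22 by omega]
  have R0 : Rep B L α tl σ s0 := h.of_mem_eq rfl r0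
  have e20 : s0.reg 20 = node B L σ.top := by simp [hs0]; rfl
  have e21 : s0.reg 21 = σ.dir σ.k := by simp [hs0]
  have e22 : s0.reg 22 = L + 16 * σ.low σ.k := by simp [hs0]
  clear_value s0
  refine ⟨fun hd => wp_popP hx hI R0 ((r0 5 (by omega)).trans h5) (by exact_mod_cast hd) e20 e22,
    fun hd => ?_⟩
  have hd4 : σ.dir σ.k < 4 := lt_of_le_of_ne (hI.dir_le _ le_rfl) (by exact_mod_cast hd)
  refine wp_dirP hb R0.consts hd4 e21 fun s1 m1 e23 e24 r1 => ?_
  have R1 : Rep B L α tl σ s1 := R0.of_mem_eq m1 fun i hi => r1 i (by omega)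
  rw [wp_block_cons]
  refine wp_lookP hx R1.consts R1.nodes R1.table htopdom hd4 ((r1 20 (by omega)).trans e20)
    ((r1 21 (by omega)).trans e21) e23 e24 fun s2 m2 r2 e25 e29 e31 e32 e30 => ?_
  have R2 : Rep B L α tl σ s2 := R1.of_mem_eq m2 fun i hi => r2 i (by omega)
  have f5 : s2.reg 5 = 1 :=
    ((r2 5 (by omega)).trans (r1 5 (by omega))).trans ((r0 5 (by omega)).trans h5)
  have f21 := ((r2 21 (by omega)).trans (r1 21 (by omega))).trans e21
  have f22 := ((r2 22 (by omega)).trans (r1 22 (by omega))).trans e22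
  have f29 : s2.reg 29 = markCode L (σ.mark σ.next) := e29.trans (R1.mark _ hnext)
  have hother := wp_otherP hx hI R2 f5 hd4 (h21 := f21) (h22 := f22) (h29 := f29) (h31 := e31)
    (h32 := e32)
  simp only [wp_block_cons, exploreP, wp_ite, holds_eq, val_reg, val_const, e31, f29,
    markCode_eq_zero hL]
  exact ⟨fun hbd => ⟨fun hm => wp_enterP hx hI R2 f5 hd4 hbd hm e25 (e30 hbd),
    fun hm => hother fun _ => hm⟩, fun hbd => hother fun hbd' => absurd hbd' hbd⟩

end WordRAM

/-! ### The whole program -/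

namespace WordRAM

open ATAM

/-- The numbers of tile types and of placed tiles and the length of the input are determined. -/
def headP : Prog :=
  block [.load 13 (.const 0), .load 4 (.const 1), .arith 14 .mul (.reg 13) (.const 8),
    .arith 15 .mul (.reg 4) (.const 10), .arith 2 .add (.reg 14) (.reg 15),
    .arith 2 .add (.reg 2) (.const 10), .arith 7 .add (.reg 14) (.const 10),
    .move 1 (.const 0), .move 6 (.const 0)]

/-- The largest absolute value of an entry is updated. -/
def scanP : Prog :=
  block [.load 13 (.reg 6),
    .ite (.lt (.reg 13) (.const 0)) (.arith 13 .sub (.const 0) (.reg 13)) .skip,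
    .ite (.lt (.reg 1) (.reg 13)) (.move 1 (.reg 13)) .skip,
    .arith 6 .add (.reg 6) (.const 1)]

/-- The constants are determined. -/
def constP : Prog :=
  block [.arith 1 .add (.reg 1) (.reg 2), .arith 1 .add (.reg 1) (.const 2),
    .arith 3 .mul (.reg 1) (.const 64), .move 6 (.const 10)]

/-- The tile at the origin is compared with the seed, and the search is started. -/
def seedP : Prog :=
  block [.arith 13 .mul (.reg 1) (.reg 3), .arith 14 .mul (.reg 1) (.const 16),
    .arith 17 .add (.reg 13) (.reg 14), .arith 17 .add (.reg 17) (.reg 2),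
    .move 10 (.const 2), hashP 8, .arith 14 .add (.reg 17) (.const 4), .load 14 (.reg 14),
    .ite (.eq (.reg 14) (.reg 11))
      (block [.move 6 (.reg 2), pushP, .move 8 (.const 1), .move 5 (.const 1)]) rejectP]

/-- The program that decides unique production at temperature 1. -/
def mainP : Prog :=
  .seq headP (.seq (.loop (.lt (.reg 6) (.reg 2)) scanP) (.seq constP
    (.seq (.loop (.lt (.reg 6) (.reg 7)) tileP) (.seq (.loop (.lt (.reg 6) (.reg 2)) placeP)
      (.seq seedP (.loop (.eq (.reg 5) (.const 1)) searchP))))))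

theorem length_flatMap_encodeTile (l : List TileType) :
    (l.flatMap encodeTile).length = 8 * l.length := by
  induction l with
  | nil => rfl
  | cons t l ih =>
    rw [List.flatMap_cons, List.length_append, ih, length_encodeTile, List.length_cons]
    ring

theorem length_flatMap_encodePlacedTile (l : List (Pos × TileType)) :
    (l.flatMap encodePlacedTile).length = 10 * l.length := by
  induction l with
  | nil => rfl
  | cons t l ih =>
    rw [List.flatMap_cons, List.length_append, ih, List.length_cons,
      show (encodePlacedTile t).length = 10 from rfl]
    ring

section instances

variable {tl : List TileType} {sd : TileType} {al : List (Pos × TileType)}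

theorem length_encodeInstance :
    (encodeInstance tl sd al).length = 10 + 8 * tl.length + 10 * al.length := by
  simp only [encodeInstance, List.length_append, length_flatMap_encodeTile,
    length_flatMap_encodePlacedTile, length_encodeTile, List.length_cons, List.length_nil]

theorem Holds.parts {s : State} (h : Holds s 0 (encodeInstance tl sd al)) :
    (s.rd 0 = tl.length ∧ s.rd 1 = al.length) ∧ Holds s 2 (encodeTile sd) ∧
      Holds s 10 (tl.flatMap encodeTile) ∧
      Holds s (10 + 8 * tl.length) (al.flatMap encodePlacedTile) := by
  unfold encodeInstance at h
  rw [holds_append, holds_append, holds_append] at h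
  obtain ⟨⟨⟨h1, h2⟩, h3⟩, h4⟩ := h
  simp only [List.length_append, length_encodeTile, length_flatMap_encodeTile, List.length_cons,
    List.length_nil, zero_add] at h2 h3 h4
  refine ⟨⟨h1.head, h1.tail.head⟩, h2, h3, ?_⟩
  push_cast at h4
  convert h4 using 1

theorem Holds.tileType {s : State} (h : Holds s 0 (encodeInstance tl sd al))
    {l l' : List TileType} {t : TileType} (e : tl = l ++ t :: l') :
    Holds s (10 + 8 * l.length) (encodeTile t) := by
  have h3 := h.parts.2.2.1
  rw [e, List.flatMap_append, List.flatMap_cons, holds_append, holds_append,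
    length_flatMap_encodeTile] at h3
  exact_mod_cast h3.2.1

theorem Holds.placedTile {s : State} (h : Holds s 0 (encodeInstance tl sd al))
    {l l' : List (Pos × TileType)} {q : Pos × TileType} (e : al = l ++ q :: l') :
    Holds s (10 + 8 * tl.length + 10 * l.length) (encodePlacedTile q) := by
  have h3 := h.parts.2.2.2
  rw [e, List.flatMap_append, List.flatMap_cons, holds_append, holds_append,
    length_flatMap_encodePlacedTile] at h3
  exact_mod_cast h3.2.1

/-- With exponent 12 the spare factor `n ^ 4` absorbs the constant. -/
theorem two_mul_pow_eight_le {b n : ℤ} (hn : 2 ≤ n) (hb : 0 ≤ b) (h : b ≤ n) :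
    2 * b ^ 8 ≤ n ^ 12 := by
  have h1 : b ^ 8 ≤ n ^ 8 := pow_le_pow_left₀ hb h 8
  have h2 : (2 : ℤ) ^ 4 ≤ n ^ 4 := pow_le_pow_left₀ (by omega) hn 4
  have h3 : 2 * n ^ 8 ≤ n ^ 4 * n ^ 8 := mul_le_mul_of_nonneg_right (by omega) (by positivity)
  rw [show n ^ 12 = n ^ 4 * n ^ 8 by ring]
  omega

/-- Here the spare factor is `n ^ 10`, which is at least 1024. -/
theorem thousand_mul_sq_le {b n : ℤ} (hn : 2 ≤ n) (hb : 0 ≤ b) (h : b ≤ n) :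
    1000 * (b * b) ≤ n ^ 12 := by
  have h1 : b * b ≤ n * n := mul_le_mul h h hb (by omega)
  have h2 : (2 : ℤ) ^ 10 ≤ n ^ 10 := pow_le_pow_left₀ (by omega) hn 10
  have h3 : 1000 * (n * n) ≤ n ^ 10 * (n * n) :=
    mul_le_mul_of_nonneg_right (by omega) (mul_self_nonneg n)
  rw [show n ^ 12 = n ^ 10 * (n * n) by ring]
  omega

theorem rd_init (x : List ℤ) (a : ℤ) : (init x).rd a = x.getD a.toNat 0 := rfl

theorem holds_init (x : List ℤ) : Holds (init x) 0 x := by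
  intro i y hi
  rw [rd_init]
  simp [hi]

theorem rd_init_of_le (x : List ℤ) {a : ℤ} (ha : x.length ≤ a) : (init x).rd a = 0 := by
  rw [rd_init, List.getD_eq_getElem?_getD, List.getElem?_eq_none (by omega)]
  rfl

theorem tileBound_of {B : ℤ} {t : TileType} (h : ∀ y ∈ encodeTile t, |y| < B) : TileBound B t := by
  intro d
  have key : ∀ y ∈ encodeGlue (t d), |y| < B := fun y hy => h y (by
    rw [encodeTile_eq]
    cases d <;> simp [hy])
  exact ⟨(le_abs_self _).trans_lt (key _ (by simp [encodeGlue])),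
    (le_abs_self _).trans_lt (key _ (by simp [encodeGlue]))⟩

end instances

/-- The assembly of a list of placed tiles. -/
def placed (l : List (Pos × TileType)) : Pos → Option TileType :=
  l.foldl (fun f q => Function.update f q.1 (some q.2)) fun _ => none

theorem placed_append (l : List (Pos × TileType)) (q : Pos × TileType) :
    placed (l ++ [q]) = Function.update (placed l) q.1 (some q.2) := by
  simp [placed]

theorem placed_mem {l : List (Pos × TileType)} {p : Pos} :
    (∀ t, placed l p = some t → (p, t) ∈ l) ∧ (placed l p = none → ∀ t, (p, t) ∉ l) := by
  induction l using List.reverseRecOn with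
  | nil => simp [placed]
  | append_singleton l q ih =>
    rw [placed_append]
    by_cases hpq : p = q.1
    · subst hpq
      simp
    · rw [Function.update_of_ne hpq]
      refine ⟨fun t ht => List.mem_append_left _ (ih.1 t ht), fun h t ht => ?_⟩
      rw [List.mem_append, List.mem_singleton] at ht
      obtain ht | rfl := ht
      exacts [ih.2 h t ht, hpq rfl]

theorem placed_eq {α : Assembly} {al : List (Pos × TileType)} (h : ListsAssembly al α) :
    placed al = α.tile := by
  funext p
  obtain ⟨h1, h2⟩ := placed_mem (l := al) (p := p)
  cases hp : placed al p with
  | none =>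
    cases hα : α.tile p with
    | none => rfl
    | some t => exact absurd ((h.2 p t).2 hα) (h2 hp t)
  | some t => exact ((h.2 p t).1 (h1 t hp)).symm

theorem length_eq_size {α : Assembly} {al : List (Pos × TileType)} (h : ListsAssembly al α) :
    al.length = α.size := by
  have hn : (al.map Prod.fst).Nodup := by
    refine List.Nodup.map_on ?_ h.1
    rintro ⟨p, t⟩ h1 ⟨q, u⟩ h2 e
    obtain rfl : p = q := e
    have h1 := (h.2 _ _).1 h1
    rw [(h.2 _ _).1 h2, Option.some.injEq] at h1
    rw [h1]
  have hd : (al.map Prod.fst).toFinset = α.dom := by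
    ext p
    simp only [List.mem_toFinset, List.mem_map, Prod.exists, exists_and_right, exists_eq_right,
      Assembly.mem_dom, h.2, Option.isSome_iff_exists]
  rw [Assembly.size, ← hd, List.toFinset_card_of_nodup hn, List.length_map]

theorem length_eq_card {T : Finset TileType} {tl : List TileType} (h : ListsTiles tl T) :
    tl.length = T.card := by
  rw [← List.toFinset_card_of_nodup h.1]
  congr 1
  ext t
  simp [h.2]

/-- The largest absolute value of an entry of a list. -/
def maxAbs (x : List ℤ) : ℕ := (x.map Int.natAbs).foldr max 0

theorem le_maxAbs {x : List ℤ} {y : ℤ} (hy : y ∈ x) : |y| ≤ maxAbs x := by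
  rw [Int.abs_eq_natAbs, maxAbs]
  norm_cast
  induction x with
  | nil => simp at hy
  | cons z x ih =>
    simp only [List.map_cons, List.foldr_cons]
    obtain rfl | hy := List.mem_cons.1 hy
    · exact le_max_left _ _
    · exact (ih hy).trans (le_max_right _ _)

/-! ### The phases of the program before and after the search. -/

theorem exec_headP {tl : List TileType} {sd : TileType} {al : List (Pos × TileType)} {W : ℕ}
    (hW : 10 + 8 * tl.length + 10 * al.length ≤ W) :
    ∃ t s', Exec W headP (init (encodeInstance tl sd al)) t s' ∧ t ≤ cost headP ∧
      s'.mem = (init (encodeInstance tl sd al)).mem ∧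
      s'.reg 2 = 10 + 8 * tl.length + 10 * al.length ∧ s'.reg 4 = al.length ∧
      s'.reg 7 = 10 + 8 * tl.length ∧ s'.reg 1 = 0 ∧ s'.reg 6 = 0 := by
  refine exec_of_wp ?_
  obtain ⟨⟨h0, h1⟩, -⟩ := (holds_init (encodeInstance tl sd al)).parts
  simp only [headP, wp_block_cons, wp_block_nil, wp_load, wp_arith, wp_move, val_reg, val_const,
    eval_add, eval_mul, reg_setReg, rd_setReg, Nat.reduceEqDiff, ↓reduceIte, h0, h1]
  refine ⟨⟨by omega, by omega⟩, ⟨by omega, by omega⟩, abs_le.2 ⟨by omega, by omega⟩,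
    abs_le.2 ⟨by omega, by omega⟩, abs_le.2 ⟨by omega, by omega⟩, abs_le.2 ⟨by omega, by omega⟩,
    abs_le.2 ⟨by omega, by omega⟩, by rw [abs_zero]; omega, by rw [abs_zero]; omega, rfl, ?_⟩
  simp
  refine ⟨?_, ?_⟩ <;> ring

/-- Both bounds on register 1 matter: the entries must be at most its value to become digits, and
its value must be at most the true maximum to keep the codes within the word size. -/
theorem exec_scan {x : List ℤ} {W : ℕ} (hW : x.length + maxAbs x + 2 ≤ W) {s : State}
    (hm : s.mem = (init x).mem) (h2 : s.reg 2 = x.length) (h1 : s.reg 1 = 0) (h6 : s.reg 6 = 0) :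
    ∃ t s', Exec W (.loop (.lt (.reg 6) (.reg 2)) scanP) s t s' ∧
      t ≤ (cost scanP + 1) * x.length + 1 ∧ s'.mem = (init x).mem ∧
      (∀ i < 10, i ≠ 1 → i ≠ 6 → s'.reg i = s.reg i) ∧
      0 ≤ s'.reg 1 ∧ s'.reg 1 ≤ maxAbs x ∧ ∀ y ∈ x, |y| ≤ s'.reg 1 := by
  let I : ℕ → State → Prop := fun m s' => s'.mem = (init x).mem ∧
    (∀ i < 10, i ≠ 1 → i ≠ 6 → s'.reg i = s.reg i) ∧ 0 ≤ s'.reg 1 ∧ s'.reg 1 ≤ maxAbs x ∧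
    ∃ i : ℕ, i + m = x.length ∧ s'.reg 6 = i ∧
      ∀ (j : ℕ) (y : ℤ), j < i → x[j]? = some y → |y| ≤ s'.reg 1
  have hl := exec_loop (W := W) (b := .lt (.reg 6) (.reg 2)) (P := scanP)
    I ?_ (m := x.length) (s := s) ?_
  · obtain ⟨t, s', h3, h4, h5, m, hI⟩ := hl
    obtain ⟨i1, i2, i3, i4, i, i5, i6, i7⟩ := hI
    refine ⟨t, s', h3, h4, i1, i2, i3, i4, fun y hy => ?_⟩
    rw [holds_lt, val_reg, val_reg, i2 2 (by omega) (by omega) (by omega), h2, i6] at h5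
    obtain ⟨j, hj, e⟩ := List.mem_iff_getElem.1 hy
    exact i7 j y (by omega) (by rw [List.getElem?_eq_getElem hj, e])
  · rintro m s1 ⟨i1, i2, i3, i4, i, i5, i6, i7⟩ hb
    have e2 := i2 2 (by omega) (by omega) (by omega)
    rw [holds_lt, val_reg, val_reg, e2, h2, i6] at hb
    have hi : i < x.length := by omega
    have hrd : s1.rd i = x[i] := by
      have := (holds_init x).of_mem_eq i1 i x[i] (by simp)
      simpa using this
    have hx := le_maxAbs (List.getElem_mem hi)
    have hax := abs_le.1 hx
    simp only [scanP, wp_block_cons, wp_block_nil, wp_load, wp_arith, wp_ite, wp_skip, wp_move,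
      holds_lt, val_reg, val_const, eval_add, eval_sub, reg_setReg, Nat.reduceEqDiff,
      OfNat.ofNat_ne_one, OfNat.one_ne_ofNat, ↓reduceIte, i6, hrd, zero_sub, abs_neg]
    have fin : ∀ (s2 : State) (v : ℤ), s2.mem = s1.mem →
        (∀ i < 10, i ≠ 1 → i ≠ 6 → s2.reg i = s1.reg i) → s2.reg 1 = max (s1.reg 1) |x[i]| →
        ∃ m' < m, I m' (s2.setReg 6 (i + 1)) := by
      intro s2 v g1 g2 g3
      refine ⟨m - 1, by omega, g1.trans i1, fun j hj hj1 hj6 => ?_, ?_, ?_, i + 1, by omega, ?_, ?_⟩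
      · simp [hj6, g2 j hj hj1 hj6, i2 j hj hj1 hj6]
      · simp [g3, i3]
      · simp [g3, i4, hx]
      · simp
      · intro j y hj hy
        simp only [reg_setReg, OfNat.one_ne_ofNat, ↓reduceIte, g3]
        by_cases hji : j = i
        · subst hji
          rw [List.getElem?_eq_getElem hi, Option.some.injEq] at hy
          rw [hy]
          exact le_max_right _ _
        · exact (i7 j y (by omega) hy).trans (le_max_left _ _)
    refine ⟨⟨by omega, by omega⟩, fun hneg => ⟨by omega, fun hlt => ⟨by omega,
      abs_le.2 ⟨by omega, by omega⟩, fin _ 0 rfl (fun j hj h1 h6 => ?_) ?_⟩,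
      fun hlt => ⟨abs_le.2 ⟨by omega, by omega⟩, fin _ 0 rfl (fun j hj h1 h6 => ?_) ?_⟩⟩,
      fun hneg => ⟨fun hlt => ⟨by omega, abs_le.2 ⟨by omega, by omega⟩,
        fin _ 0 rfl (fun j hj h1 h6 => ?_) ?_⟩,
        fun hlt => ⟨abs_le.2 ⟨by omega, by omega⟩, fin _ 0 rfl (fun j hj h1 h6 => ?_) ?_⟩⟩⟩
    · simp [h1, show j ≠ 13 by omega]
    · simp only [reg_setReg, ↓reduceIte]
      rw [abs_of_neg hneg, max_eq_right hlt.le]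
    · simp [show j ≠ 13 by omega]
    · simp only [reg_setReg, OfNat.one_ne_ofNat, ↓reduceIte]
      rw [abs_of_neg hneg, max_eq_left (by omega)]
    · simp [h1, show j ≠ 13 by omega]
    · simp only [reg_setReg, ↓reduceIte]
      rw [abs_of_nonneg (by omega), max_eq_right hlt.le]
    · simp [show j ≠ 13 by omega]
    · simp only [reg_setReg, OfNat.one_ne_ofNat, ↓reduceIte]
      rw [abs_of_nonneg (by omega), max_eq_left (by omega)]
  · exact ⟨hm, fun _ _ _ _ => rfl, h1.ge, by omega, 0, by omega, by simpa using h6,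
      fun j y hj => absurd hj (Nat.not_lt_zero _)⟩

variable {B L : ℤ} {W : ℕ}

theorem exec_tiles (hb : Bounds B L W) {tl : List TileType} {sd : TileType}
    {al : List (Pos × TileType)} (hL : L = 10 + 8 * tl.length + 10 * al.length)
    (htl : ∀ t ∈ tl, TileBound B t) {N : ℤ} {s : State} (hc : Consts B L N s)
    (h7 : s.reg 7 = 10 + 8 * tl.length) (h6 : s.reg 6 = 10)
    (hs : Holds s 0 (encodeInstance tl sd al)) (hz : ∀ a, L ≤ a → s.rd a = 0) :
    ∃ t s', Exec W (.loop (.lt (.reg 6) (.reg 7)) tileP) s t s' ∧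
      t ≤ (cost tileP + 1) * tl.length + 1 ∧ Consts B L N s' ∧ s'.reg 6 = 10 + 8 * tl.length ∧
      Holds s' 0 (encodeInstance tl sd al) ∧
      (∀ c : ℤ, 0 ≤ c → ∀ i : ℕ, i < 12 → s'.rd (L + 16 * c + i) = 0) ∧
      Table B L (fun _ => tl) s' := by
  have hLp := hb.L_pos
  let I : ℕ → State → Prop := fun m s' => Consts B L N s' ∧ s'.reg 7 = 10 + 8 * tl.length ∧
    Holds s' 0 (encodeInstance tl sd al) ∧
    (∀ c : ℤ, 0 ≤ c → ∀ i : ℕ, i < 12 → s'.rd (L + 16 * c + i) = 0) ∧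
    ∃ l l', tl = l ++ l' ∧ l'.length = m ∧ s'.reg 6 = 10 + 8 * l.length ∧
      Table B L (fun _ => l) s'
  have hl := exec_loop (W := W) (b := .lt (.reg 6) (.reg 7)) (P := tileP)
    I ?_ (m := tl.length) (s := s) ?_
  · obtain ⟨t, s', h3, h4, h5, m, hI⟩ := hl
    obtain ⟨i1, i2, i3, i4, l, l', i5, i6, i7, i8⟩ := hI
    rw [holds_lt, val_reg, val_reg, i7, i2] at h5
    have hlen := congrArg List.length i5
    rw [List.length_append] at hlen
    obtain rfl : l' = [] := List.length_eq_zero_iff.1 (by omega)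
    rw [List.append_nil] at i5
    subst i5
    exact ⟨t, s', h3, h4, i1, i7, i3, i4, i8⟩
  · rintro m s1 ⟨i1, i2, i3, i4, l, l', i5, i6, i7, i8⟩ hlt
    rw [holds_lt, val_reg, val_reg, i7, i2] at hlt
    cases l' with
    | nil =>
      rw [List.append_nil] at i5
      rw [i5] at hlt
      omega
    | cons t l' =>
      have ht : t ∈ tl := by simp [i5]
      have hlen := congrArg List.length i5
      rw [List.length_append, List.length_cons] at hlen
      refine wp_tileP hb i1 (by omega) (by omega) (htl t ht) (by rw [i7]; exact i3.tileType i5)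
        (fun u hu => htl u (by simp [i5, hu])) i8 fun s2 T2 m2 r2 e6 => ?_
      refine ⟨l'.length, by simp [← i6], i1.of_eq fun i hi => r2 i (by omega) (by omega),
        (r2 7 (by omega) (by omega)).trans i2, i3.congr fun i hi => ?_, fun c hc i hi => ?_,
        l ++ [t], l', by simp [i5], rfl, ?_, T2⟩
      · rw [length_encodeInstance] at hi
        exact m2 _ (by omega) fun c hc i' hi' => by omega
      · rw [m2 _ (by omega) fun c hc i' hi' => by omega, i4 c hc i hi]
      · rw [e6, i7, List.length_append, List.length_singleton]
        push_cast
        ring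
  · refine ⟨hc, h7, hs, fun c hc i hi => hz _ (by omega), [], tl, rfl, rfl, by simpa using h6,
      fun c hc j hj => ?_⟩
    -- Untouched cells hold 0, which is the table entry for the empty list.
    rw [hz _ (by omega)]
    rfl

theorem exec_place (hb : Bounds B L W) {tl : List TileType} {sd : TileType}
    {al : List (Pos × TileType)} (hL : L = 10 + 8 * tl.length + 10 * al.length)
    (hal : ∀ q ∈ al, TileBound B q.2 ∧ InBox B q.1) {N : ℤ} {s : State} (hc : Consts B L N s)
    (h6 : s.reg 6 = 10 + 8 * tl.length)
    (hs : Holds s 0 (encodeInstance tl sd al))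
    (hz : ∀ c : ℤ, 0 ≤ c → ∀ i : ℕ, i < 12 → s.rd (L + 16 * c + i) = 0)
    (hT : Table B L (fun _ => tl) s) :
    ∃ t s', Exec W (.loop (.lt (.reg 6) (.reg 2)) placeP) s t s' ∧
      t ≤ (cost placeP + 1) * al.length + 1 ∧ Consts B L N s' ∧
      Holds s' 0 (encodeInstance tl sd al) ∧
      (∀ c : ℤ, 0 ≤ c → s'.rd (L + 16 * c + 5) = 0) ∧
      Table B L (fun _ => tl) s' ∧ Nodes B L (fun _ => placed al) s' := by
  have hLp := hb.L_pos
  let I : ℕ → State → Prop := fun m s' => Consts B L N s' ∧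
    Holds s' 0 (encodeInstance tl sd al) ∧
    (∀ c : ℤ, 0 ≤ c → s'.rd (L + 16 * c + 5) = 0) ∧ Table B L (fun _ => tl) s' ∧
    ∃ l l', al = l ++ l' ∧ l'.length = m ∧ s'.reg 6 = 10 + 8 * tl.length + 10 * l.length ∧
      Nodes B L (fun _ => placed l) s'
  have hl := exec_loop (W := W) (b := .lt (.reg 6) (.reg 2)) (P := placeP)
    I ?_ (m := al.length) (s := s) ?_
  · obtain ⟨t, s', h3, h4, h5, m, hI⟩ := hl
    obtain ⟨i1, i2, i3, i4, l, l', i5, i6, i7, i8⟩ := hI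
    rw [holds_lt, val_reg, val_reg, i7, i1.reg2, hL] at h5
    have hlen := congrArg List.length i5
    rw [List.length_append] at hlen
    obtain rfl : l' = [] := List.length_eq_zero_iff.1 (by omega)
    rw [List.append_nil] at i5
    subst i5
    exact ⟨t, s', h3, h4, i1, i2, i3, i4, i8⟩
  · rintro m s1 ⟨i1, i2, i3, i4, l, l', i5, i6, i7, i8⟩ hlt
    rw [holds_lt, val_reg, val_reg, i7, i1.reg2, hL] at hlt
    cases l' with
    | nil =>
      rw [List.append_nil] at i5
      rw [i5] at hlt
      omega
    | cons q l' =>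
      have hq : q ∈ al := by simp [i5]
      have hlen := congrArg List.length i5
      rw [List.length_append, List.length_cons] at hlen
      refine wp_placeP (p := q.1) (t := q.2) hb i1 (by omega) (by omega) (hal q hq).1 (hal q hq).2
        (by rw [i7]; exact i2.placedTile i5) i8 fun s2 N2 m2 r2 e6 => ?_
      refine ⟨l'.length, by simp [← i6], i1.of_eq fun i hi => r2 i (by omega) (by omega),
        i2.congr fun i hi => ?_, fun c hc => ?_, fun c hc j hj => ?_,
        l ++ [q], l', by simp [i5], rfl, ?_, by rwa [placed_append]⟩
      · rw [length_encodeInstance] at hi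
        exact m2 _ (by omega) fun c hc i' hi' => by omega
      · rw [m2 _ (by omega) fun c hc i' hi' => by omega, i3 c hc]
      · rw [m2 _ (by omega) fun c hc i' hi' => by omega, i4 c hc j hj]
      · rw [e6, i7, List.length_append, List.length_singleton]
        push_cast
        ring
  · refine ⟨hc, hs, fun c hc => hz c hc 5 (by omega), hT, [], al, rfl, rfl, by simpa using h6,
      fun p hp => ?_⟩
    have hpb := hp.posCode_bounds (by linarith [hb.B_ge])
    exact ⟨fun j hj => hz _ hpb.1 j (by omega), hz _ hpb.1 4 (by omega)⟩

variable {α : Assembly} {T : Finset TileType} {tl : List TileType}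

/-- The mark cells have not been written during preprocessing, so they still hold 0 and every
position but the origin is unvisited. -/
theorem Rep.start (hx : Context B L W α T tl) (h0 : (0 : Pos) ∈ α.dom) {s s' : State}
    (hN : Nodes B L (fun _ => α.tile) s) (hT : Table B L (fun _ => tl) s)
    (hz : ∀ c : ℤ, 0 ≤ c → s.rd (L + 16 * c + 5) = 0)
    (hrd : ∀ x, 0 ≤ x → s'.rd x = if x = node B L 0 + 5 then L else
      if x = L + 11 then 0 else if x = L + 10 then 0 else
      if x = L + 9 then L else if x = L + 8 then node B L 0 else s.rd x)
    (hc : Consts B L α.size s') (h6 : s'.reg 6 = L) (h8 : s'.reg 8 = 1) :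
    Rep B L α tl .start s' := by
  have hb := hx.bounds
  have hL := hb.L_pos
  have hw : InBox B 0 := (hx.box 0 h0).mono
  obtain ⟨c, hc1, hc2, hc3⟩ := node_bounds hb hw
  have key : ∀ (a : ℤ) (i : ℕ), 0 ≤ a → (i < 5 ∨ 12 ≤ i) → i < 16 →
      s'.rd (L + 16 * a + i) = s.rd (L + 16 * a + i) := fun a i ha hi hi' => by
    rw [hrd _ (by omega), if_neg (by omega), if_neg (by omega), if_neg (by omega),
      if_neg (by omega), if_neg (by omega)]
  have zero : ∀ i, i ≤ SearchState.start.k → i = 0 := fun i hi => Nat.le_zero.1 hi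
  constructor
  · exact hc
  · simp [SearchState.start, h6]
  · simp [SearchState.start, h8]
  · exact hN.congr hb fun a ha i hi => key a i ha (.inl hi) (by omega)
  · refine hT.congr fun a ha i hi => ?_
    have := key a (12 + i) ha.le (.inr (by omega)) (by omega)
    push_cast at this
    exact this
  · intro i hi
    obtain rfl := zero i hi
    rw [hrd _ (by omega), if_neg (by omega), if_neg (by omega), if_neg (by omega),
      if_neg (by omega), if_pos (by omega)]
    rfl
  · intro i hi
    obtain rfl := zero i hi
    rw [hrd _ (by omega), if_neg (by omega), if_neg (by omega), if_neg (by omega),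
      if_pos (by omega)]
    simp [SearchState.start]
  · intro i hi
    obtain rfl := zero i hi
    rw [hrd _ (by omega), if_neg (by omega), if_neg (by omega), if_pos (by omega)]
    simp [SearchState.start]
  · intro i hi
    obtain rfl := zero i hi
    rw [hrd _ (by omega), if_neg (by omega), if_pos (by omega)]
    simp [SearchState.start]
  · intro p hp
    simp only [SearchState.start]
    obtain ⟨c', hc1', hc2', hc3'⟩ := node_bounds hb hp
    by_cases hpw : p = 0
    · subst hpw
      rw [Function.update_self, hrd _ (by omega), if_pos rfl]
      simp [markCode]
    · rw [Function.update_of_ne hpw, hrd _ (by omega),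
        if_neg fun e => hpw (node_inj hb hp hw (by omega)), if_neg (by omega), if_neg (by omega),
        if_neg (by omega), if_neg (by omega), hc1', hz c' hc2']
      rfl
  · intro i hi
    simp [SearchState.start]

/-- The states in which the search has at most `m` steps left. -/
def Searching (B L : ℤ) (α : Assembly) (T : Finset TileType) (tl : List TileType) (sd : TileType)
    (m : ℕ) (s : State) : Prop :=
  (α.tile 0 = some sd ∧ s.reg 5 = 1 ∧ ∃ σ F, SearchInv α T σ F ∧ Rep B L α tl σ s ∧
    σ.measure α < m) ∨
  (s.reg 5 = 0 ∧ (s.reg 0 = 1 ∧ (α.tile 0 = some sd ∧ Good α T) ∨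
    s.reg 0 = 0 ∧ ¬ (α.tile 0 = some sd ∧ Good α T)))

theorem exec_seedP (hx : Context B L W α T tl) {sd : TileType} (hsd : sd ∈ T)
    (hsb : TileBound B sd) (h10 : 10 ≤ L) {s : State} (hc : Consts B L α.size s)
    (hN : Nodes B L (fun _ => α.tile) s) (hT : Table B L (fun _ => tl) s)
    (hz : ∀ c : ℤ, 0 ≤ c → s.rd (L + 16 * c + 5) = 0) (hs : Holds s 2 (encodeTile sd)) :
    ∃ t s', Exec W seedP s t s' ∧ t ≤ cost seedP ∧
      Searching B L α T tl sd (6 * α.size + 6) s' := by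
  refine exec_of_wp ?_
  have hb := hx.bounds
  have hBB := hb.B_le
  have hL := hb.L_pos
  have hLB := hb.L_le
  have hB := hb.B_ge
  have h2 := hb.sq_le
  have hB0 : 0 < B := by linarith
  have hw : InBox B 0 := ⟨⟨by simp; omega, by simp; omega⟩, by simp; omega, by simp; omega⟩
  obtain ⟨c, hc1, hc2, hc3⟩ := node_bounds hb hw
  have hnode : B * (64 * B) + B * 16 + L = node B L 0 := by
    simp only [node, posCode, Prod.fst_zero, Prod.snd_zero]
    ring
  have hBB' : B * (64 * B) = 64 * (B * B) := by ring
  simp only [seedP, wp_block_cons, wp_arith, wp_move, val_reg, val_const, eval_add, eval_mul,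
    reg_setReg, Nat.reduceEqDiff, OfNat.one_ne_ofNat, ↓reduceIte, hc.reg1, hc.reg2, hc.reg3, hnode]
  refine ⟨abs_le.2 ⟨by omega, by omega⟩, abs_le.2 ⟨by omega, by omega⟩,
    abs_le.2 ⟨by omega, by omega⟩, abs_le.2 ⟨by omega, by omega⟩, abs_le.2 ⟨by omega, by omega⟩, ?_⟩
  rw [← length_encodeTile sd]
  refine wp_hashP hB0 _ hsb.tile (by rw [length_encodeTile]; exact hb.pow_le) (by simp [hc.reg1])
    (by simp) (by simp [length_encodeTile]; omega)
    (by simp only [reg_setReg, ↓reduceIte]; exact hs.of_mem_eq rfl) fun s' hm h11 hr => ?_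
  replace h11 : s'.reg 11 = tileCode B sd := h11
  have gm : s'.mem = s.mem := hm
  have g17 : s'.reg 17 = node B L 0 := by rw [hr 17 (by omega) (by omega)]; simp
  have gr : ∀ i < 10, s'.reg i = s.reg i := fun i hi => by
    rw [hr i (by omega) (by omega)]
    simp [show i ≠ 10 by omega, show i ≠ 13 by omega, show i ≠ 14 by omega, show i ≠ 17 by omega]
  have hrd : s'.rd (node B L 0 + 4) = codeAt B (α.tile 0) := by
    rw [rd_eq_of_mem_eq gm]
    exact (hN 0 hw).2
  simp only [wp_block_cons, wp_arith, wp_load, wp_ite, wp_move, holds_eq, val_reg,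
    val_const, eval_add, reg_setReg, rd_setReg, Nat.reduceEqDiff, ↓reduceIte, g17, h11, hrd,
    gr 2 (by omega), hc.reg2]
  have hiff : codeAt B (α.tile 0) = tileCode B sd ↔ α.tile 0 = some sd := by
    cases h : α.tile 0 with
    | none => simpa [codeAt] using (tileCode_bounds hB0 hsb).1.ne
    | some t =>
      simp only [codeAt, Option.some.injEq]
      exact ⟨fun e => tileCode_inj (hx.assembly _ _ h) hsb e, fun e => by rw [e]⟩
  rw [hiff]
  refine ⟨abs_le.2 ⟨by omega, by omega⟩, ⟨by omega, by omega⟩, fun h0 => ⟨abs_le.2 ⟨by omega,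
    by omega⟩, ?_⟩, fun h0 => wp_rejectP (by omega) fun s1 e5 e0 =>
      .inr ⟨e5, .inr ⟨e0, fun h => h0 h.1⟩⟩⟩
  refine wp_pushP (f := L) (n := node B L 0) (by simp) (by simp [g17])
    (by omega) (by omega) (by omega) (by omega) fun s1 hrd1 hr1 => ?_
  have h0d : (0 : Pos) ∈ α.dom := by simp [Assembly.mem_dom, h0]
  simp only [wp_block_cons, wp_block_nil, wp_move, val_const, length_encodeTile]
  refine ⟨by rw [abs_one]; omega, by rw [abs_one]; omega, .inl ⟨h0, by simp, .start, _,
    .start ⟨sd, hsd, h0⟩, Rep.start hx h0d hN hT hz (fun x hx => ?_) (hc.of_eq fun i hi => ?_) ?_ ?_,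
    ?_⟩⟩
  · have e : ∀ v w z, ((s'.setReg 14 v).setReg 14 w |>.setReg 6 z).rd x = s.rd x := fun v w z =>
      rd_eq_of_mem_eq gm x
    rw [rd_setReg, rd_setReg, hrd1 x hx, e]
  · simp [show i ≠ 5 by omega, show i ≠ 8 by omega, hr1 i (by omega), show i ≠ 6 by omega,
      show i ≠ 14 by omega, gr i (by omega)]
  · simp [hr1 6 (by omega)]
  · simp
  · simp only [SearchState.measure, SearchState.start, Finset.sum_range_succ, Finset.sum_range_zero]
    omega

theorem exec_search (hx : Context B L W α T tl) {sd : TileType} {m : ℕ} {s : State}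
    (h : Searching B L α T tl sd m s) :
    ∃ t s', Exec W (.loop (.eq (.reg 5) (.const 1)) searchP) s t s' ∧
      t ≤ (cost searchP + 1) * m + 1 ∧ (s'.reg 0 = 1 ∧ (α.tile 0 = some sd ∧ Good α T) ∨
    s'.reg 0 = 0 ∧ ¬ (α.tile 0 = some sd ∧ Good α T)) := by
  have hl := exec_loop (W := W) (b := .eq (.reg 5) (.const 1))
    (P := searchP) (Searching B L α T tl sd) ?_ h
  · obtain ⟨t, s', h3, h4, h5, m, hI⟩ := hl
    rw [holds_eq, val_reg, val_const] at h5
    obtain ⟨-, hI, -⟩ | ⟨-, hI⟩ := hI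
    · exact absurd hI h5
    · exact ⟨t, s', h3, h4, hI⟩
  · rintro m s1 (⟨h0, e5, σ, F, hI, hR, hm⟩ | ⟨e5, -⟩) hb
    · refine wp_mono (fun s2 hs2 => ?_) (wp_searchP hx hI hR e5)
      obtain ⟨r, hst, hp⟩ := hs2
      cases r with
      | cont σ' =>
        obtain ⟨⟨F', hF'⟩, hlt⟩ := hI.step_cont hst
        exact ⟨σ.measure α, hm, .inl ⟨h0, hp.2, σ', F', hF', hp.1, hlt⟩⟩
      | halt b =>
        have hg := hI.step_halt hst
        -- The strict inequality between the measure and `m` leaves room for the halting step.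
        refine ⟨0, by omega, .inr ⟨hp.1, hp.2.imp (fun h => ⟨h.1, h0, hg.1 h.2⟩)
          fun h => ⟨h.1, fun h' => h.2 (hg.2 h'.2)⟩⟩⟩
    · rw [holds_eq, val_reg, val_const, e5] at hb
      exact absurd hb (by norm_num)

end WordRAM

/-! ### The complete run and its running time. -/

open ATAM WordRAM in
theorem exec_mainP (T : Finset TileType) (sd : TileType) (hsd : sd ∈ T) (α : Assembly)
    (tl : List TileType) (al : List (Pos × TileType)) (hT : ListsTiles tl T)
    (hα : ListsAssembly al α) :
    ∃ t out, Runs mainP 12 (encodeInstance tl sd al) t out ∧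
      t ≤ cost headP + ((cost scanP + 1) * (10 + 8 * tl.length + 10 * al.length) + 1 +
        (cost constP + ((cost tileP + 1) * tl.length + 1 + ((cost placeP + 1) * al.length + 1 +
          (cost seedP + ((cost searchP + 1) * (6 * al.length + 6) + 1)))))) ∧
      (out = 1 ∧ (α.tile 0 = some sd ∧ Good α T) ∨
        out = 0 ∧ ¬ (α.tile 0 = some sd ∧ Good α T)) := by
  set x := encodeInstance tl sd al with hx
  have hlen : x.length = 10 + 8 * tl.length + 10 * al.length := length_encodeInstance
  have hsize := length_eq_size hα
  have htl1 : 1 ≤ tl.length := List.length_pos_of_mem ((hT.2 sd).2 hsd)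
  have hal1 : 1 ≤ al.length := by
    obtain ⟨p⟩ := α.connected.nonempty
    rw [hsize]
    exact Finset.card_pos.2 ⟨p.1, Assembly.mem_dom.2 p.2⟩
  set n := x.length + maxAbs x + 2 with hn
  have hWn : wordBound 12 x = n ^ 12 := rfl
  set W := wordBound 12 x with hW
  have hn28 : 28 ≤ n := by omega
  have hnW : n ≤ W := by
    rw [hWn]
    exact Nat.le_self_pow (by omega) n
  obtain ⟨t1, s1, E1, c1, m1, a2, a4, a7, a1, a6⟩ :=
    exec_headP (tl := tl) (sd := sd) (al := al) (W := W) (by omega)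
  obtain ⟨t2, s2, E2, c2, m2, r2, b0, b1, b2⟩ :=
    exec_scan (x := x) (W := W) hnW m1 (by rw [a2, hlen]; push_cast; ring) a1 a6
  -- This base exceeds every absolute value in the input by at least 2, so entries are digits and
  -- coordinates stay one away from the border of the box; it is also at most the base `n` of
  -- `wordBound`.
  set B : ℤ := s2.reg 1 + x.length + 2 with hB
  set L : ℤ := (x.length : ℤ) with hLdef
  have hL : L = 10 + 8 * tl.length + 10 * al.length := by rw [hLdef, hlen]; push_cast; ring
  have hBn : B ≤ n := by rw [hB, hn]; push_cast; omega
  have hB28 : 28 ≤ B := by omega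
  have hWn' : (n : ℤ) ^ 12 = W := by rw [hWn]; push_cast; rfl
  have hW8 : 2 * B ^ 8 ≤ W := hWn' ▸ two_mul_pow_eight_le (by omega) (by omega) hBn
  have hW2 : 1000 * (B * B) ≤ W := hWn' ▸ thousand_mul_sq_le (by omega) (by omega) hBn
  have hb : Bounds B L W := ⟨by omega, by omega, hB28, hW8, hW2⟩
  have habs : ∀ y ∈ x, |y| < B - 2 := fun y hy => by
    have := b2 y hy
    omega
  have htile : ∀ t ∈ tl, TileBound B t := fun t ht => tileBound_of fun y hy => by
    have := habs y (by
      simp only [hx, encodeInstance, List.mem_append, List.mem_flatMap]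
      exact .inl (.inr ⟨t, ht, hy⟩))
    omega
  have hplaced : ∀ q ∈ al, ∀ y ∈ encodePlacedTile q, |y| < B - 2 := fun q hq y hy => habs y (by
    simp only [hx, encodeInstance, List.mem_append, List.mem_flatMap]
    exact .inr ⟨q, hq, hy⟩)
  have halb : ∀ q ∈ al, TileBound B q.2 := fun q hq => tileBound_of fun y hy => by
    have := hplaced q hq y (by simp [encodePlacedTile, hy])
    omega
  have hbox : ∀ q ∈ al, InBox (B - 1) q.1 := fun q hq => by
    have h1 := abs_lt.1 (hplaced q hq q.1.1 (by simp [encodePlacedTile]))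
    have h2 := abs_lt.1 (hplaced q hq q.1.2 (by simp [encodePlacedTile]))
    exact ⟨⟨by omega, by omega⟩, by omega, by omega⟩
  have hctx : Context B L W α T tl := ⟨hb, fun p t h => halb _ ((hα.2 p t).2 h), fun p hp => by
    obtain ⟨t, ht⟩ := Assembly.exists_tile hp
    exact hbox _ ((hα.2 p t).2 ht), hT, htile, by rw [← hsize]; omega⟩
  obtain ⟨t3, s3, E3, c3, m3, k3, r3, e6⟩ : ∃ t s', Exec W constP s2 t s' ∧ t ≤ cost constP ∧
      s'.mem = s2.mem ∧ Consts B L al.length s' ∧ s'.reg 7 = 10 + 8 * tl.length ∧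
      s'.reg 6 = 10 := by
    refine exec_of_wp ?_
    have e2 : s2.reg 2 = L := (r2 2 (by omega) (by omega) (by omega)).trans (by rw [a2, hL])
    have e4 : s2.reg 4 = al.length := (r2 4 (by omega) (by omega) (by omega)).trans a4
    have e7 : s2.reg 7 = 10 + 8 * tl.length := (r2 7 (by omega) (by omega) (by omega)).trans a7
    have hBB := hb.B_le
    simp only [constP, wp_block_cons, wp_block_nil, wp_arith, wp_move, val_reg, val_const, eval_add,
      eval_mul, reg_setReg, ↓reduceIte, e2]
    have eB : s2.reg 1 + L + 2 = B := rfl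
    rw [eB]
    refine ⟨abs_le.2 ⟨by omega, by omega⟩, abs_le.2 ⟨by omega, by omega⟩,
      abs_le.2 ⟨by omega, by omega⟩, abs_le.2 ⟨by omega, by omega⟩, rfl,
      ⟨by simp, by simp [e2], ?_, by simp [e4]⟩, by simp [e7], by simp⟩
    simp
    ring
  have hmem3 : s3.mem = (init x).mem := m3.trans m2
  obtain ⟨t4, s4, E4, c4, k4, e46, h4, z4, T4⟩ := exec_tiles hb hL htile k3 r3 e6
    ((holds_init x).of_mem_eq hmem3) fun a ha => by
      rw [rd_eq_of_mem_eq hmem3]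
      exact rd_init_of_le x ha
  obtain ⟨t5, s5, E5, c5, k5, h5, z5, T5, N5⟩ := exec_place hb hL
    (fun q hq => ⟨halb q hq, (hbox q hq).mono⟩) k4 e46 h4 z4 T4
  rw [placed_eq hα] at N5
  rw [hsize] at k5
  obtain ⟨t6, s6, E6, c6, h6⟩ := exec_seedP hctx hsd (htile sd ((hT.2 sd).2 hsd)) (by omega) k5 N5
    T5 z5 h5.parts.2.1
  obtain ⟨t7, s7, E7, c7, h7⟩ := exec_search hctx h6
  refine ⟨_, _, ⟨s7, .seq E1 (.seq E2 (.seq E3 (.seq E4 (.seq E5 (.seq E6 E7))))), rfl⟩, ?_, h7⟩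
  rw [hlen] at c2
  rw [← hsize] at c7
  omega

theorem mainTheorem2 :
    ∃ (P : WordRAM.Prog) (k : ℕ), ∀ K : ℕ, ∃ C : ℕ,
      ∀ (T : Finset ATAM.TileType) (s : ATAM.TileType) (hs : s ∈ T) (α : ATAM.Assembly)
        (tl : List ATAM.TileType) (al : List (ATAM.Pos × ATAM.TileType)),
        ATAM.ListsTiles tl T → ATAM.ListsAssembly al α →
        T.card ≤ K * α.size →
        ∃ (t : ℕ) (out : ℤ),
          WordRAM.Runs P k (ATAM.encodeInstance tl s al) t out ∧
          t ≤ C * (α.size * (Nat.log 2 T.card + 1)) ∧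
          (out = 0 ∨ out = 1) ∧
          (out = 1 ↔ (ATAM.SeededTAS.ofTile T s hs 1 one_pos).UniquelyProduces α) := by
  generalize hc1 : WordRAM.cost WordRAM.headP = a1
  generalize hc2 : WordRAM.cost WordRAM.scanP + 1 = a2
  generalize hc3 : WordRAM.cost WordRAM.constP = a3
  generalize hc4 : WordRAM.cost WordRAM.tileP + 1 = a4
  generalize hc5 : WordRAM.cost WordRAM.placeP + 1 = a5
  generalize hc6 : WordRAM.cost WordRAM.seedP = a6
  generalize hc7 : WordRAM.cost WordRAM.searchP + 1 = a7
  -- The costs of the phases are added up. The input has length `10 + 8 * |T| + 10 * |α|`, at most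
  -- `(20 + 8 * K) * |α|`, and the search makes at most `6 * |α| + 6` steps, hence at most `12 *
  -- |α|`.
  refine ⟨WordRAM.mainP, 12, fun K => ⟨a1 + (a2 * (20 + 8 * K) + 1 + (a3 + (a4 * K + 1 +
    (a5 + 1 + (a6 + (a7 * 12 + 1)))))), ?_⟩⟩
  intro T s hs α tl al hT hα hK
  obtain ⟨t, out, hrun, ht, hout⟩ := exec_mainP T s hs α tl al hT hα
  refine ⟨t, out, hrun, ?_, ?_, ?_⟩
  · rw [hc1, hc2, hc3, hc4, hc5, hc6, hc7, WordRAM.length_eq_card hT,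
      WordRAM.length_eq_size hα] at ht
    have hpos : 1 ≤ α.size := by
      obtain ⟨p⟩ := α.connected.nonempty
      exact Finset.card_pos.2 ⟨p.1, ATAM.Assembly.mem_dom.2 p.2⟩
    generalize α.size = n at *
    generalize T.card = m at *
    -- The logarithmic factor is dropped: the running time is already linear in `α.size`.
    refine ht.trans (le_trans ?_ (Nat.mul_le_mul_left _ (Nat.le_mul_of_pos_right n (Nat.succ_pos _))))
    have h2 : a2 * (10 + 8 * m + 10 * n) ≤ a2 * ((20 + 8 * K) * n) :=
      Nat.mul_le_mul_left _ (by nlinarith)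
    have h4 : a4 * m ≤ a4 * (K * n) := Nat.mul_le_mul_left _ hK
    have h7 : a7 * (6 * n + 6) ≤ a7 * (12 * n) := Nat.mul_le_mul_left _ (by omega)
    have g1 : a1 ≤ a1 * n := Nat.le_mul_of_pos_right _ hpos
    have g3 : a3 ≤ a3 * n := Nat.le_mul_of_pos_right _ hpos
    have g6 : a6 ≤ a6 * n := Nat.le_mul_of_pos_right _ hpos
    calc _ ≤ a1 * n + (a2 * ((20 + 8 * K) * n) + n + (a3 * n + (a4 * (K * n) + n +
          (a5 * n + n + (a6 * n + (a7 * (12 * n) + n)))))) := by omega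
      _ = _ := by ring
  · exact hout.elim (fun h => .inr h.1) fun h => .inl h.1
  · rw [ATAM.uniquelyProduces_iff_good]
    obtain ⟨h1, h2⟩ | ⟨h1, h2⟩ := hout
    · exact iff_of_true h1 h2
    · exact iff_of_false (by rw [h1]; norm_num) h2
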